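/- Let $\mathcal N$ be a complex manifold with $\dim_{\mathbb C}\mathcal N\ge 2$ containing an embedded projective line $L\cong\mathbb P^1$, and let $f:\mathcal N\to\mathcal N$ be a dominant holomorphic map (its image contains a nonempty open set) with $f(L)\subseteq L$. Let $a,b$ be integers with $b\ge 2$. Assume: (i) $L$ is transversally superattracting of degree $a$: if $\chi$ is a holomorphic function near a point $\eta\in L$ that vanishes along $L$, then for every $\xi\in L$ with $f(\xi)=\eta$ the function $\chi\circ f$ vanishes at $\xi$ to order at least $a$ along $L$; (ii) $f|_L$ is conjugate to $z\mapsto z^b$, i.e. there is a biholomorphic map $\iota:\mathbb P^1\to L$ with $f(\iota(z))=\iota(z^b)$ for all $z\in\mathbb P^1$; let $S=\iota(\{|z|=1\})$ be the resulting invariant circle. For a neighborhood $\Omega$ of $S$ put $$W^s_{\mathrm{loc}}(S)=W^s_{\mathrm{loc},\Omega}(S)=\{x\in\mathcal N:\ f^n(x)\in\Omega\text{ for all }n\ge 0\text{ and } f^n(x)\to S\text{ as }n\to\infty\}.$$ If $a\ge b$, then $W^s_{\mathrm{loc}}(S)$ is a real analytic hypersurface for every sufficiently small open neighborhood $\Omega$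 of $S$: there is an open neighborhood $\Omega_0$ of $S$ such that, for every open $\Omega$ with $S\subseteq\Omega\subseteq\Omega_0$, every point of $W^s_{\mathrm{loc},\Omega}(S)$ has an open neighborhood $U\subseteq\mathcal N$ and a real analytic function $\psi:U\to\mathbb R$ with nowhere vanishing differential such that $W^s_{\mathrm{loc},\Omega}(S)\cap U=\{\psi=0\}$. -/

import Mathlib

open Set Filter Topology
open scoped Manifold ContDiff OnePoint

/-- The standard affine coordinate `ℂ → ℙ¹` around the point at infinity of the Riemann sphere
`ℙ¹ = ℂ ∪ {∞}`: it sends `ζ` to `1/ζ`, and `0` to `∞`. -/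
noncomputable def sphereChartInfty (ζ : ℂ) : OnePoint ℂ :=
  if ζ = 0 then ∞ else ((ζ⁻¹ : ℂ) : OnePoint ℂ)

/-- The map `z ↦ z ^ b` of the Riemann sphere (for `b ≥ 1`), with `∞ ↦ ∞`. -/
def spherePow (b : ℕ) : OnePoint ℂ → OnePoint ℂ :=
  OnePoint.map (fun z : ℂ => z ^ b)

/-- The unit circle `|z| = 1` in the Riemann sphere. -/
def sphereUnitCircle : Set (OnePoint ℂ) :=
  (fun z : ℂ => (z : OnePoint ℂ)) '' {z : ℂ | ‖z‖ = 1}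

/-- `ι : ℙ¹ → N` is a holomorphic embedding of the Riemann sphere: it is injective, and it is a
holomorphic immersion when read in each of the two standard affine coordinates of the sphere.
(In a Hausdorff `N` it is then a homeomorphism onto its image, since the sphere is compact.) -/
structure IsSphereEmbedding (E : Type*) [NormedAddCommGroup E] [NormedSpace ℂ E]
    {N : Type*} [TopologicalSpace N] [ChartedSpace E N] (ι : OnePoint ℂ → N) : Prop where
  injective : Function.Injective ι
  holomorphic_zero : ContMDiff 𝓘(ℂ, ℂ) 𝓘(ℂ, E) ω (fun z : ℂ => ι (z : OnePoint ℂ))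
  holomorphic_infty : ContMDiff 𝓘(ℂ, ℂ) 𝓘(ℂ, E) ω (fun ζ : ℂ => ι (sphereChartInfty ζ))
  immersion_zero : ∀ z : ℂ,
    Function.Injective (mfderiv 𝓘(ℂ, ℂ) 𝓘(ℂ, E) (fun z : ℂ => ι (z : OnePoint ℂ)) z)
  immersion_infty : ∀ ζ : ℂ,
    Function.Injective (mfderiv 𝓘(ℂ, ℂ) 𝓘(ℂ, E) (fun ζ : ℂ => ι (sphereChartInfty ζ)) ζ)

/-- A holomorphic map is dominant if its image contains a nonempty open set. -/
def IsDominantMap {N : Type*} [TopologicalSpace N] (f : N → N) : Prop :=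
  (interior (range f)).Nonempty

/-- The function `g`, holomorphic near the point `p`, vanishes at `p` to order at least `a`:
in the chart at `p`, all Taylor coefficients of degree `< a` are zero,
that is, `g = O(|v - p| ^ a)`. -/
def VanishesToOrderAt (E : Type*) [NormedAddCommGroup E] [NormedSpace ℂ E]
    {N : Type*} [TopologicalSpace N] [ChartedSpace E N] (g : N → ℂ) (a : ℕ) (p : N) : Prop :=
  (fun v : E => g ((extChartAt 𝓘(ℂ, E) p).symm v))
    =O[𝓝 (extChartAt 𝓘(ℂ, E) p p)] (fun v : E => ‖v - extChartAt 𝓘(ℂ, E) p p‖ ^ a)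

/-- The germ at `ξ ∈ L` of the holomorphic function `g` vanishes to order at least `a`
along `L`: it vanishes to that order at all points of `L` near `ξ`. -/
def VanishesToOrderAlong (E : Type*) [NormedAddCommGroup E] [NormedSpace ℂ E]
    {N : Type*} [TopologicalSpace N] [ChartedSpace E N] (g : N → ℂ) (L : Set N) (a : ℕ)
    (ξ : N) : Prop :=
  ∀ᶠ p in 𝓝[L] ξ, VanishesToOrderAt E g a p

/-- `L` is transversally superattracting for `f` with degree `a`: whenever `ξ, η ∈ L`,
`f ξ = η`, and `χ` is a holomorphic function near `η` that vanishes along `L`, the function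
`χ ∘ f` vanishes at `ξ` to order at least `a` along `L`. -/
def TransversallySuperattracting (E : Type*) [NormedAddCommGroup E] [NormedSpace ℂ E]
    {N : Type*} [TopologicalSpace N] [ChartedSpace E N] (f : N → N) (L : Set N)
    (a : ℕ) : Prop :=
  ∀ ξ ∈ L, ∀ η ∈ L, f ξ = η → ∀ (U : Set N) (χ : N → ℂ), IsOpen U → η ∈ U →
    ContMDiffOn 𝓘(ℂ, E) 𝓘(ℂ, ℂ) ω χ U → (∀ y ∈ U ∩ L, χ y = 0) →
      VanishesToOrderAlong E (χ ∘ f) L a ξ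

/-- The local stable set of `S` relative to the neighbourhood `Ω`: the points whose whole
forward orbit lies in `Ω` and converges to the (compact) set `S`. -/
def localStableSet {N : Type*} [TopologicalSpace N] (f : N → N) (S Ω : Set N) : Set N :=
  {x | (∀ n : ℕ, f^[n] x ∈ Ω) ∧ Tendsto (fun n : ℕ => f^[n] x) atTop (𝓝ˢ S)}

/-- `W` is a real analytic hypersurface (a real analytic submanifold of real codimension one)
of the complex manifold `N`, regarded as a real analytic manifold: near each of its points it
is the zero set of a real analytic function with nonzero differential. -/
def IsRealAnalyticHypersurface (E : Type*) [NormedAddCommGroup E] [NormedSpace ℂ E]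
    {N : Type*} [TopologicalSpace N] [ChartedSpace E N] (W : Set N) : Prop :=
  ∀ x ∈ W, ∃ (U : Set N) (ψ : N → ℝ), IsOpen U ∧ x ∈ U ∧
    ContMDiffOn 𝓘(ℝ, E) 𝓘(ℝ, ℝ) ω ψ U ∧
    (∀ y ∈ U, mfderiv 𝓘(ℝ, E) 𝓘(ℝ, ℝ) ψ y ≠ 0) ∧
    W ∩ U = {y ∈ U | ψ y = 0}

/-! The core is a holomorphic function `φ` on a neighborhood of the circle with `φ ∘ f = φ ^ b` that
equals the affine coordinate on the sphere L. Then `‖φ‖ = 1` cuts out the local stable set. If an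
orbit stays where `1/2 < ‖φ‖ < 2`, all powers `‖φ x‖ ^ (b ^ n)` stay in that range, so `‖φ x‖ = 1`.
Conversely, an orbit with `‖φ‖ = 1` has coordinate of modulus tending to 1 and transversal size
tending to 0, so it converges to the circle. Since `φ` is a coordinate on L, its differential is
nonzero near the circle, and `log ‖φ‖` is the defining function.

Formally `φ` is the limit of the `b ^ n`-th roots of `Z (f^n x)`, where `Z` extends the affine
coordinate locally off L. It has to exist on a full neighborhood of the circle, hence also for
points whose orbits drift to the poles 0 and ∞, and this is where `a ≥ b` enters. Write `m` for the
transversal size and `p` for `poleDist`. The defect `Z (f x) / Z x ^ b - 1` is of size at most `C m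
/ p ^ b`, while one step sends `p` to at least `p ^ b / 2` and `m` to at most `C m ^ b`. So a bound
`m ≤ t p ^ b` persists, with `t` multiplied by a small `μ` each time (`good_step`), and the
logarithms of the defects are summable.

The coordinates are only local, and the `n`-th root is holomorphic only on a ball whose radius
shrinks like `κ ^ n`, on which nearby orbits visit the same charts. Its error is of order `μ ^ n ≤ κ
^ (4 n)`, which still forces complex differentiability of the limit at each point
(`differentiableAt_of_holomorphic_approx`). Osgood's lemma then gives analyticity. -/

/-! ### Differentiability from holomorphic approximation at shrinking scales. -/

section ApproxHolomorphic

variable {E F : Type*} [NormedAddCommGroup E] [NormedSpace ℂ E]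
  [NormedAddCommGroup F] [NormedSpace ℂ F]

/-- A second order Taylor estimate for bounded holomorphic functions on a ball. -/
theorem norm_sub_sub_fderiv_le_of_bound {h : E → F} {x v : E} {R M : ℝ} (hR : 0 < R)
    (hd : DifferentiableOn ℂ h (Metric.ball x R))
    (hM : ∀ y ∈ Metric.ball x R, ‖h y - h x‖ ≤ M) (hv : ‖v‖ < R) :
    ‖h (x + v) - h x - fderiv ℂ h x v‖ ≤ 2 * M * (‖v‖ / R) ^ 2 := by
  have hM0 : 0 ≤ M := (norm_nonneg _).trans (hM x (Metric.mem_ball_self hR))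
  have hmaps : MapsTo h (Metric.ball x R) (Metric.closedBall (h x) M) := fun y hy => by
    rw [mem_closedBall_iff_norm]; exact hM y hy
  have hℓ : ‖fderiv ℂ h x‖ ≤ M / R := Complex.norm_fderiv_le_div_of_mapsTo_ball hd hmaps hR
  have hda : DifferentiableAt ℂ h x := hd.differentiableAt (Metric.ball_mem_nhds x hR)
  set ℓ := fderiv ℂ h x with hℓdef
  set g : E → F := fun y => h y - ℓ (y - x) with hg
  have hgd : DifferentiableOn ℂ g (Metric.ball x R) := by
    refine hd.sub ?_
    exact (ℓ.differentiable.comp (differentiable_id.sub_const x)).differentiableOn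
  have hgx : g x = h x := by simp [hg]
  have hgm : MapsTo g (Metric.ball x R) (Metric.closedBall (g x) (2 * M)) := by
    intro y hy
    rw [mem_closedBall_iff_norm, hgx]
    have h1 := hM y hy
    have h2 : ‖ℓ (y - x)‖ ≤ M / R * R := by
      refine (ℓ.le_opNorm _).trans ?_
      have : ‖y - x‖ ≤ R := (mem_ball_iff_norm.1 hy).le
      gcongr
    rw [div_mul_cancel₀ _ hR.ne'] at h2
    calc ‖g y - h x‖ = ‖(h y - h x) - ℓ (y - x)‖ := by simp only [hg]; congr 1; abel
      _ ≤ _ := norm_sub_le _ _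
      _ ≤ 2 * M := by linarith
  -- With the linear part removed, the Schwarz lemma for maps that are little-o of the first power
  -- yields the exponent 2.
  have ho : (fun y => g y - g x) =o[𝓝 x] fun w => ‖w - x‖ ^ 1 := by
    have := hda.hasFDerivAt.isLittleO
    simp only [pow_one]
    refine (this.congr_left ?_).norm_right
    intro y; simp only [hgx]; simp only [hg]; abel
  have := Complex.dist_le_mul_div_pow_of_mapsTo_ball_of_isLittleO hgd hgm ho
    (z := x + v) (by simpa using hv)
  rw [dist_eq_norm, hgx] at this
  calc ‖h (x + v) - h x - ℓ v‖ = ‖g (x + v) - h x‖ := by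
        simp only [hg]; congr 1; simp; abel
    _ ≤ _ := by simpa using this

/-- A function that is approximated at geometric scales, with faster geometric precision, by
holomorphic functions is complex differentiable. -/
theorem differentiableAt_of_holomorphic_approx [CompleteSpace F] {φ : E → F} {x : E}
    {δ κ A M : ℝ} (hδ : 0 < δ) (hκ0 : 0 < κ) (hκ1 : κ < 1) {h : ℕ → E → F}
    (hd : ∀ n, DifferentiableOn ℂ (h n) (Metric.ball x (δ * κ ^ n)))
    (hA : ∀ n, ∀ y ∈ Metric.ball x (δ * κ ^ n), ‖h n y - φ y‖ ≤ A * κ ^ (4 * n))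
    (hM : ∀ y ∈ Metric.ball x δ, ‖φ y‖ ≤ M) : DifferentiableAt ℂ φ x := by
  have hr : ∀ n, 0 < δ * κ ^ n := fun n => by positivity
  have hκn : ∀ n, κ ^ n ≤ 1 := fun n => pow_le_one₀ hκ0.le hκ1.le
  have hA0 : 0 ≤ A := by
    have := (norm_nonneg _).trans (hA 0 x (Metric.mem_ball_self (hr 0)))
    simpa using this
  have hM0 : 0 ≤ M := (norm_nonneg _).trans (hM x (Metric.mem_ball_self hδ))
  have hsub : ∀ n, Metric.ball x (δ * κ ^ n) ⊆ Metric.ball x δ := fun n =>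
    Metric.ball_subset_ball (by nlinarith [hκn n])
  have hhM : ∀ n, ∀ y ∈ Metric.ball x (δ * κ ^ n), ‖h n y‖ ≤ M + A := by
    intro n y hy
    have h1 := hA n y hy
    have h2 := hM y (hsub n hy)
    have h3 : A * κ ^ (4 * n) ≤ A := mul_le_of_le_one_right hA0 (hκn _)
    calc ‖h n y‖ = ‖φ y + (h n y - φ y)‖ := by congr 1; abel
      _ ≤ _ := norm_add_le _ _
      _ ≤ M + A := by linarith
  set ℓ : ℕ → (E →L[ℂ] F) := fun n => fderiv ℂ (h n) x with hℓ
  have hsucc : ∀ n, Metric.ball x (δ * κ ^ (n + 1)) ⊆ Metric.ball x (δ * κ ^ n) := fun n =>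
    Metric.ball_subset_ball (by
      rw [pow_succ, ← mul_assoc]; exact mul_le_of_le_one_right (hr n).le hκ1.le)
  -- Cauchy's estimate divides a difference of order `κ ^ (4 n)` by a radius of order `κ ^ n`, so
  -- the derivatives form a Cauchy sequence.
  have hdist : ∀ n, dist (ℓ n) (ℓ (n + 1)) ≤ 4 * A / (δ * κ) * κ ^ n := by
    intro n
    have hd1 := (hd n).mono (hsucc n)
    have hd2 := hd (n + 1)
    have hx1 : DifferentiableAt ℂ (h n) x := (hd n).differentiableAt (Metric.ball_mem_nhds _ (hr n))
    have hx2 : DifferentiableAt ℂ (h (n + 1)) x :=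
      (hd (n + 1)).differentiableAt (Metric.ball_mem_nhds _ (hr _))
    have hbd : ∀ y ∈ Metric.ball x (δ * κ ^ (n + 1)),
        ‖h n y - h (n + 1) y‖ ≤ 2 * A * κ ^ (4 * n) := by
      intro y hy
      have h1 := hA n y (hsucc n hy)
      have h2 := hA (n + 1) y hy
      have h3 : κ ^ (4 * (n + 1)) ≤ κ ^ (4 * n) :=
        pow_le_pow_of_le_one hκ0.le hκ1.le (by omega)
      have h4 : A * κ ^ (4 * (n + 1)) ≤ A * κ ^ (4 * n) := by gcongr
      calc ‖h n y - h (n + 1) y‖ = ‖(h n y - φ y) - (h (n + 1) y - φ y)‖ := by congr 1; abel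
        _ ≤ _ := norm_sub_le _ _
        _ ≤ _ := by linarith
    have hmaps : MapsTo (fun y => h n y - h (n + 1) y) (Metric.ball x (δ * κ ^ (n + 1)))
        (Metric.closedBall (h n x - h (n + 1) x) (4 * A * κ ^ (4 * n))) := by
      intro y hy
      rw [mem_closedBall_iff_norm]
      have h1 := hbd y hy
      have h2 := hbd x (Metric.mem_ball_self (hr _))
      exact (norm_sub_le _ _).trans (by linarith)
    have key := Complex.norm_fderiv_le_div_of_mapsTo_ball (hd1.sub hd2) hmaps (hr _)
    have e : fderiv ℂ (h n - h (n + 1)) x = ℓ n - ℓ (n + 1) := fderiv_sub hx1 hx2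
    rw [e] at key
    rw [dist_eq_norm]
    refine key.trans ?_
    have : 4 * A * κ ^ (4 * n) / (δ * κ ^ (n + 1)) = 4 * A / (δ * κ) * κ ^ (3 * n) := by
      have : κ ^ (4 * n) = κ ^ n * κ ^ (3 * n) := by rw [← pow_add]; congr 1; omega
      rw [this, pow_succ]; field_simp
    rw [this]
    have : κ ^ (3 * n) ≤ κ ^ n := pow_le_pow_of_le_one hκ0.le hκ1.le (by omega)
    gcongr
  obtain ⟨L, hL⟩ := cauchySeq_tendsto_of_complete
    (cauchySeq_of_le_geometric κ _ hκ1 hdist)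
  have hLd := dist_le_of_le_geometric_of_tendsto κ _ hκ1 hdist hL
  set K₁ : ℝ := 4 * A / (δ * κ) / (1 - κ)
  have hLd' : ∀ n, ‖ℓ n - L‖ ≤ K₁ * κ ^ n := fun n => by
    have := hLd n; rw [dist_eq_norm] at this
    refine this.trans (le_of_eq ?_); simp only [K₁]; ring
  set K : ℝ := K₁ + 2 * (2 * (M + A)) / δ + 2 * A / (κ ^ 3 * δ) with hK
  have h1κ : 0 < 1 - κ := by linarith
  have hK₁0 : 0 ≤ K₁ := by positivity
  have hK0 : 0 ≤ K := by positivity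
  -- For `‖v‖` of order `κ ^ (3 n)` both errors are `O(κ ^ n ‖v‖)`: the Taylor remainder `(‖v‖ / κ ^
  -- n) ^ 2` by the upper bound on `‖v‖`, the approximation error `κ ^ (4 n)` by the lower one.
  have main : ∀ n, ∀ v : E, κ ^ (3 * (n + 1)) * δ < ‖v‖ → ‖v‖ ≤ κ ^ (3 * n) * δ →
      ‖v‖ < δ * κ ^ n → ‖φ (x + v) - φ x - L v‖ ≤ K * κ ^ n * ‖v‖ := by
    intro n v hv1 hv2 hv3
    have hxv : x + v ∈ Metric.ball x (δ * κ ^ n) := by simpa using hv3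
    have h1 := hA n _ hxv
    have h2 := hA n x (Metric.mem_ball_self (hr n))
    have h3 := norm_sub_sub_fderiv_le_of_bound (hr n) (hd n) (M := 2 * (M + A))
      (fun y hy => (norm_sub_le _ _).trans (by
        linarith [hhM n y hy, hhM n x (Metric.mem_ball_self (hr n))])) hv3
    have h4 : ‖ℓ n v - L v‖ ≤ K₁ * κ ^ n * ‖v‖ := by
      rw [← sub_apply]
      exact ((ℓ n - L).le_opNorm v).trans (by gcongr; exact hLd' n)
    have h5 : 2 * (2 * (M + A)) * (‖v‖ / (δ * κ ^ n)) ^ 2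
        ≤ 2 * (2 * (M + A)) / δ * κ ^ n * ‖v‖ := by
      have e1 : 2 * (2 * (M + A)) * (‖v‖ / (δ * κ ^ n)) ^ 2
          = 2 * (2 * (M + A)) / (δ * κ ^ n) ^ 2 * ‖v‖ * ‖v‖ := by field_simp
      have e2 : 2 * (2 * (M + A)) / δ * κ ^ n * ‖v‖
          = 2 * (2 * (M + A)) / (δ * κ ^ n) ^ 2 * ‖v‖ * (κ ^ (3 * n) * δ) := by
        have : κ ^ (3 * n) = κ ^ n * κ ^ n * κ ^ n := by rw [← pow_add, ← pow_add]; congr 1; omega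
        rw [this]; field_simp
      rw [e1, e2]
      gcongr
    have h6 : A * κ ^ (4 * n) ≤ A / (κ ^ 3 * δ) * κ ^ n * ‖v‖ := by
      have e1 : A * κ ^ (4 * n) = A / (κ ^ 3 * δ) * κ ^ n * (κ ^ (3 * (n + 1)) * δ) := by
        have : κ ^ (4 * n) = κ ^ n * κ ^ (3 * n) := by rw [← pow_add]; congr 1; omega
        rw [this, mul_add, pow_add]; field_simp
      rw [e1]; gcongr
    have e : φ (x + v) - φ x - L v = -(h n (x + v) - φ (x + v)) + (h n x - φ x)
        + (h n (x + v) - h n x - fderiv ℂ (h n) x v) + (ℓ n v - L v) := by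
      simp only [hℓ]; abel
    rw [e]
    refine (norm_add_le _ _).trans ?_
    refine (add_le_add_left (norm_add_le _ _) _).trans ?_
    refine (add_le_add_left (add_le_add_left (norm_add_le _ _) _) _).trans ?_
    rw [norm_neg]
    have : K * κ ^ n * ‖v‖ = K₁ * κ ^ n * ‖v‖ + 2 * (2 * (M + A)) / δ * κ ^ n * ‖v‖
        + 2 * (A / (κ ^ 3 * δ) * κ ^ n * ‖v‖) := by rw [hK]; ring
    linarith
  refine HasFDerivAt.differentiableAt (f' := L) ?_
  rw [hasFDerivAt_iff_isLittleO_nhds_zero, Asymptotics.isLittleO_iff]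
  intro ε hε
  obtain ⟨N, hN⟩ : ∃ N, K * κ ^ N < ε := by
    have : Tendsto (fun n : ℕ => K * κ ^ n) atTop (𝓝 (K * 0)) :=
      (tendsto_pow_atTop_nhds_zero_of_lt_one hκ0.le hκ1).const_mul K
    rw [mul_zero] at this
    exact (this.eventually (gt_mem_nhds hε)).exists
  have hpos : 0 < κ ^ (3 * (N + 1)) * δ := by positivity
  filter_upwards [Metric.ball_mem_nhds (0 : E) hpos] with v hv
  rw [mem_ball_zero_iff] at hv
  rcases eq_or_ne v 0 with rfl | hv0
  · simp
  have hvp : 0 < ‖v‖ := norm_pos_iff.2 hv0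
  obtain ⟨n, hn1, hn2⟩ := exists_nat_pow_near_of_lt_one (x := ‖v‖ / δ) (y := κ ^ 3)
    (by positivity) (by
      rw [div_le_one hδ]; refine hv.le.trans ?_
      exact mul_le_of_le_one_left hδ.le (hκn _)) (by positivity)
      (pow_lt_one₀ hκ0.le hκ1 (by norm_num))
  rw [← pow_mul, lt_div_iff₀ hδ] at hn1
  rw [← pow_mul, div_le_iff₀ hδ] at hn2
  have hNn : N < n := by
    by_contra hcon
    have : κ ^ (3 * (N + 1)) ≤ κ ^ (3 * (n + 1)) :=
      pow_le_pow_of_le_one hκ0.le hκ1.le (by omega)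
    have : κ ^ (3 * (N + 1)) * δ ≤ κ ^ (3 * (n + 1)) * δ := by gcongr
    linarith
  have hlt : ‖v‖ < δ * κ ^ n := by
    refine hn2.trans_lt ?_
    rw [mul_comm]
    have : κ ^ (3 * n) < κ ^ n := pow_lt_pow_right_of_lt_one₀ hκ0 hκ1 (by omega)
    gcongr
  refine (main n v hn1 hn2 hlt).trans ?_
  have : K * κ ^ n ≤ K * κ ^ N := by
    gcongr ?_ * ?_
    exact pow_le_pow_of_le_one hκ0.le hκ1.le hNn.le
  gcongr
  linarith

end ApproxHolomorphic

/-! ### Osgood's lemma in finite dimension. -/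

section SeveralVariables

variable {E F : Type*} [NormedAddCommGroup E] [NormedSpace ℂ E] [FiniteDimensional ℂ E]
  [NormedAddCommGroup F] [NormedSpace ℂ F] [CompleteSpace F]

/-- Difference quotients in a fixed direction are holomorphic in the base point and approximate the
directional derivative, so the approximation criterion applies. A finite basis reassembles the full
derivative. -/
theorem differentiableOn_fderiv_of_isOpen {f : E → F} {U : Set E} (hU : IsOpen U)
    (hf : DifferentiableOn ℂ f U) : DifferentiableOn ℂ (fderiv ℂ f) U := by
  intro x hx
  refine DifferentiableAt.differentiableWithinAt ?_
  obtain ⟨R, hR, hRM⟩ : ∃ R > 0, ∀ y ∈ Metric.ball x (2 * R), y ∈ U ∧ ‖f y‖ < ‖f x‖ + 1 := by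
    have h1 : ∀ᶠ y in 𝓝 x, y ∈ U ∧ ‖f y‖ < ‖f x‖ + 1 := by
      refine Filter.Eventually.and (hU.mem_nhds hx) ?_
      have := (hf.differentiableAt (hU.mem_nhds hx)).continuousAt.norm
      exact this.eventually (gt_mem_nhds (lt_add_one _))
    obtain ⟨R, hR, h⟩ := Metric.eventually_nhds_iff_ball.1 h1
    exact ⟨R / 2, by positivity, fun y hy => h y (by convert hy using 2; ring)⟩
  set M := ‖f x‖ + 1 with hMdef
  have hM0 : 0 < M := by positivity
  have hb : ∀ y ∈ Metric.ball x R, Metric.ball y R ⊆ Metric.ball x (2 * R) := fun y hy =>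
    Metric.ball_subset_ball' (by have := Metric.mem_ball.1 hy; linarith)
  have hdy : ∀ y ∈ Metric.ball x R, DifferentiableOn ℂ f (Metric.ball y R) := fun y hy =>
    hf.mono fun z hz => (hRM z (hb y hy hz)).1
  have hby : ∀ y ∈ Metric.ball x R, ∀ z ∈ Metric.ball y R, ‖f z - f y‖ ≤ 2 * M := by
    intro y hy z hz
    refine (norm_sub_le _ _).trans ?_
    have h1 := (hRM z (hb y hy hz)).2
    have h2 := (hRM y (hb y hy (Metric.mem_ball_self hR))).2
    linarith
  have hv : ∀ v : E, DifferentiableAt ℂ (fun y => fderiv ℂ f y v) x := by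
    intro v
    set τ : ℝ := R / (‖v‖ + 1) with hτ
    have hτ0 : 0 < τ := by positivity
    have hτv : τ * ‖v‖ < R := by
      rw [hτ, div_mul_eq_mul_div, div_lt_iff₀ (by positivity)]
      nlinarith [norm_nonneg v]
    -- The quotient with step `t` has error `O(t)`; this choice gives the precision `κ ^ (4 n)` for
    -- `κ = 1/2`.
    set t : ℕ → ℝ := fun n => τ * (1 / 2 : ℝ) ^ (4 * n) with ht
    have ht0 : ∀ n, 0 < t n := fun n => by positivity
    have htv : ∀ n, ‖((t n : ℂ)) • v‖ < R := by
      intro n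
      rw [norm_smul, Complex.norm_real, Real.norm_of_nonneg (ht0 n).le]
      refine lt_of_le_of_lt ?_ hτv
      gcongr
      exact mul_le_of_le_one_right hτ0.le (pow_le_one₀ (by norm_num) (by norm_num))
    have hball : ∀ n : ℕ, Metric.ball x (R * (1 / 2) ^ n) ⊆ Metric.ball x R := fun n =>
      Metric.ball_subset_ball (mul_le_of_le_one_right hR.le
        (pow_le_one₀ (by norm_num) (by norm_num)))
    refine differentiableAt_of_holomorphic_approx (κ := 1 / 2) (δ := R)
      (A := 2 * (2 * M) * ‖v‖ ^ 2 / R ^ 2 * τ) (M := 2 * M / R * ‖v‖) hR (by norm_num) (by norm_num)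
      (h := fun n y => ((t n : ℂ))⁻¹ • (f (y + (t n : ℂ) • v) - f y)) ?_ ?_ ?_
    · intro n y hy
      have hy' := hball n hy
      refine DifferentiableAt.differentiableWithinAt ?_
      refine DifferentiableAt.const_smul (DifferentiableAt.sub ?_ ?_) _
      · refine DifferentiableAt.comp y (g := f) (f := fun y => y + (t n : ℂ) • v) ?_
          (differentiableAt_id.add_const _)
        refine (hdy y hy').differentiableAt (Metric.isOpen_ball.mem_nhds ?_)
        simpa using htv n
      · exact (hdy y hy').differentiableAt (Metric.ball_mem_nhds _ hR)
    · intro n y hy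
      have hy' := hball n hy
      have h1 := norm_sub_sub_fderiv_le_of_bound hR (hdy y hy') (hby y hy') (htv n)
      have htc : (t n : ℂ) ≠ 0 := by exact_mod_cast (ht0 n).ne'
      have e : (t n : ℂ)⁻¹ • (f (y + (t n : ℂ) • v) - f y) - fderiv ℂ f y v
          = (t n : ℂ)⁻¹ • (f (y + (t n : ℂ) • v) - f y - fderiv ℂ f y ((t n : ℂ) • v)) := by
        simp only [map_smul, smul_sub, smul_smul, inv_mul_cancel₀ htc, one_smul]
      rw [e, norm_smul, norm_inv, Complex.norm_real, Real.norm_of_nonneg (ht0 n).le]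
      rw [norm_smul, Complex.norm_real, Real.norm_of_nonneg (ht0 n).le] at h1
      calc (t n)⁻¹ * _ ≤ (t n)⁻¹ * (2 * (2 * M) * (t n * ‖v‖ / R) ^ 2) := by
            have := ht0 n
            gcongr
        _ = 2 * (2 * M) * ‖v‖ ^ 2 / R ^ 2 * t n := by have := (ht0 n).ne'; field_simp
        _ = _ := by simp only [ht]; ring
    · intro y hy
      refine (ContinuousLinearMap.le_opNorm _ _).trans ?_
      gcongr
      refine Complex.norm_fderiv_le_div_of_mapsTo_ball (hdy y hy) ?_ hR
      intro z hz
      rw [mem_closedBall_iff_norm]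
      exact hby y hy z hz
  let B := Module.finBasis ℂ E
  have e : fderiv ℂ f = fun y => ∑ i, (LinearMap.toContinuousLinearMap (B.coord i)).smulRight
      (fderiv ℂ f y (B i)) := by
    funext y
    ext v
    rw [sum_apply]
    conv_lhs => rw [← B.sum_repr v, map_sum]
    simp
  rw [e]
  refine DifferentiableAt.fun_sum fun i _ => ?_
  exact ((ContinuousLinearMap.smulRightL ℂ E F
    (LinearMap.toContinuousLinearMap (B.coord i))).differentiableAt).comp x (hv (B i))

theorem differentiableOn_iteratedFDeriv_of_isOpen {f : E → F} {U : Set E} (hU : IsOpen U)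
    (hf : DifferentiableOn ℂ f U) (n : ℕ) : DifferentiableOn ℂ (iteratedFDeriv ℂ n f) U := by
  induction n with
  | zero =>
    rw [iteratedFDeriv_zero_eq_comp]
    exact (LinearIsometryEquiv.differentiable _).comp_differentiableOn hf
  | succ n ih =>
    rw [iteratedFDeriv_succ_eq_comp_left]
    have hfd := differentiableOn_fderiv_of_isOpen hU ih
    intro x hx
    exact (ContinuousLinearMap.differentiableAt (((continuousMultilinearCurryLeftEquiv ℂ
      (fun _ : Fin (n + 1) => E) F).symm.toContinuousLinearEquiv :
        (E →L[ℂ] (E [×n]→L[ℂ] F)) →L[ℂ] (E [×(n + 1)]→L[ℂ] F)))).comp_differentiableWithinAt x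
          (hfd x hx)

/-- Cauchy's estimate is iterated `n` times, each time giving up a layer of width `R / (n + 1)`. The
growth `(n + 1) ^ n` is compensated by `n!` up to a geometric factor, which suffices for a positive
radius of convergence. -/
theorem norm_iteratedFDeriv_le_of_bound_on_ball {f : E → F} {x : E} {R M : ℝ} (hR : 0 < R)
    (hf : DifferentiableOn ℂ f (Metric.ball x R)) (hM : ∀ y ∈ Metric.ball x R, ‖f y‖ ≤ M) (n : ℕ) :
    ‖iteratedFDeriv ℂ n f x‖ ≤ M * (2 * (n + 1) / R) ^ n := by
  have hM0 : 0 ≤ M := (norm_nonneg _).trans (hM x (Metric.mem_ball_self hR))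
  set s : ℝ := R / (n + 1) with hs
  have hs0 : 0 < s := by positivity
  have hsn : (n + 1) * s = R := by rw [hs]; field_simp
  have key : ∀ k : ℕ, k ≤ n → ∀ y ∈ Metric.ball x (R - k * s),
      ‖iteratedFDeriv ℂ k f y‖ ≤ M * (2 / s) ^ k := by
    intro k
    induction k with
    | zero =>
      intro _ y hy
      simpa using hM y (by simpa using hy)
    | succ k ih =>
      intro hk y hy
      have hsub : Metric.ball y s ⊆ Metric.ball x (R - k * s) :=
        Metric.ball_subset_ball' (by
          have := Metric.mem_ball.1 hy; push_cast at this; linarith)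
      have hsub' : Metric.ball x (R - k * s) ⊆ Metric.ball x R :=
        Metric.ball_subset_ball (by
          have : 0 ≤ (k : ℝ) * s := by positivity
          linarith)
      have hd := (differentiableOn_iteratedFDeriv_of_isOpen Metric.isOpen_ball hf k).mono
        (hsub.trans hsub')
      have hb : ∀ z ∈ Metric.ball y s, ‖iteratedFDeriv ℂ k f z‖ ≤ M * (2 / s) ^ k := fun z hz =>
        ih (by omega) z (hsub hz)
      have := Complex.norm_fderiv_le_div_of_mapsTo_ball hd (R₂ := 2 * (M * (2 / s) ^ k)) (by
        intro z hz
        rw [mem_closedBall_iff_norm]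
        refine (norm_sub_le _ _).trans ?_
        linarith [hb z hz, hb y (Metric.mem_ball_self hs0)]) hs0
      rw [← norm_fderiv_iteratedFDeriv]
      refine this.trans (le_of_eq ?_)
      rw [pow_succ]; ring
  have := key n le_rfl x (Metric.mem_ball_self (by linarith))
  refine this.trans (le_of_eq ?_)
  congr 2
  rw [hs]; field_simp

/-- Restricting to a complex line identifies the homogeneous terms of the Taylor series with
one-variable Taylor coefficients, whose series is known to converge to the function. -/
theorem iteratedDeriv_comp_line {f : E → F} {U : Set E} (hU : IsOpen U)
    (hf : DifferentiableOn ℂ f U) (x v : E) (n : ℕ) :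
    ∀ t : ℂ, x + t • v ∈ U →
      iteratedDeriv n (fun t : ℂ => f (x + t • v)) t = iteratedFDeriv ℂ n f (x + t • v) fun _ => v := by
  induction n with
  | zero => intro t _; simp
  | succ n ih =>
    intro t ht
    have hline : HasDerivAt (fun t : ℂ => x + t • v) v t := by
      simpa using ((hasDerivAt_id t).smul_const v).const_add x
    have hU' : ∀ᶠ t' in 𝓝 t, x + t' • v ∈ U :=
      hline.continuousAt.eventually (hU.mem_nhds ht)
    have hev : iteratedDeriv n (fun t : ℂ => f (x + t • v))
        =ᶠ[𝓝 t] fun t' => iteratedFDeriv ℂ n f (x + t' • v) fun _ => v :=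
      hU'.mono fun t' ht' => ih t' ht'
    rw [iteratedDeriv_succ, hev.deriv_eq]
    have hd : HasFDerivAt (iteratedFDeriv ℂ n f) (fderiv ℂ (iteratedFDeriv ℂ n f) (x + t • v))
        (x + t • v) :=
      ((differentiableOn_iteratedFDeriv_of_isOpen hU hf n).differentiableAt
        (hU.mem_nhds ht)).hasFDerivAt
    have h1 := hd.comp_hasDerivAt t hline
    have h2 := (ContinuousMultilinearMap.apply ℂ (fun _ : Fin n => E) F
      (fun _ => v)).hasFDerivAt.comp_hasDerivAt t h1
    rw [iteratedFDeriv_succ_apply_left]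
    exact h2.deriv

/-- **Osgood's lemma**: complex differentiable functions on finite dimensional spaces
are analytic. -/
theorem analyticAt_of_differentiableOn {f : E → F} {U : Set E} {x : E} (hU : U ∈ 𝓝 x)
    (hf : DifferentiableOn ℂ f U) : AnalyticAt ℂ f x := by
  obtain ⟨R, hR, hRM⟩ : ∃ R > 0, ∀ y ∈ Metric.ball x R, y ∈ U ∧ ‖f y‖ < ‖f x‖ + 1 := by
    have h1 : ∀ᶠ y in 𝓝 x, y ∈ U ∧ ‖f y‖ < ‖f x‖ + 1 := by
      refine (Filter.Eventually.and hU) ?_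
      have := (hf.differentiableAt hU).continuousAt.norm
      exact this.eventually (gt_mem_nhds (lt_add_one _))
    exact Metric.eventually_nhds_iff_ball.1 h1
  set M := ‖f x‖ + 1 with hMdef
  have hM0 : 0 < M := by positivity
  have hfR : DifferentiableOn ℂ f (Metric.ball x R) := hf.mono fun y hy => (hRM y hy).1
  have hbound := norm_iteratedFDeriv_le_of_bound_on_ball hR hfR (fun y hy => (hRM y hy).2.le)
  set p : FormalMultilinearSeries ℂ E F := fun n =>
    ((n.factorial : ℂ))⁻¹ • iteratedFDeriv ℂ n f x with hp
  set r : ℝ := R / (2 * Real.exp 1) with hr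
  have hr0 : 0 < r := by positivity
  have hrR : r ≤ R := by
    rw [hr]
    refine div_le_self hR.le ?_
    have := Real.add_one_le_exp 1
    linarith
  have hpb : ∀ n, ‖p n‖ * r ^ n ≤ M * Real.exp 1 := by
    intro n
    have hf0 : (0 : ℝ) < n.factorial := by positivity
    rw [hp]
    simp only
    rw [norm_smul, norm_inv, Complex.norm_natCast]
    have h1 := hbound n
    have h2 := Real.pow_div_factorial_le_exp ((n : ℝ) + 1) (by positivity) n
    calc (n.factorial : ℝ)⁻¹ * ‖iteratedFDeriv ℂ n f x‖ * r ^ n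
        ≤ (n.factorial : ℝ)⁻¹ * (M * (2 * (n + 1) / R) ^ n) * r ^ n := by gcongr
      _ = M * (((n : ℝ) + 1) ^ n / n.factorial) * (Real.exp 1 ^ n)⁻¹ := by
          have e : (2 * ((n : ℝ) + 1) / R) ^ n * (R / (2 * Real.exp 1)) ^ n * Real.exp 1 ^ n
              = ((n : ℝ) + 1) ^ n := by
            rw [← mul_pow, ← mul_pow]; congr 1; field_simp
          rw [hr, ← e]; field_simp
      _ ≤ M * Real.exp (n + 1) * (Real.exp 1 ^ n)⁻¹ := by gcongr
      _ = M * Real.exp 1 := by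
          rw [Real.exp_add, ← Real.exp_nat_mul, mul_one]
          field_simp
  refine ⟨p, ENNReal.ofReal r, ?_, ?_, ?_⟩
  · have := p.le_radius_of_bound (r := ⟨r, hr0.le⟩) _ hpb
    convert this using 1
    exact ENNReal.ofReal_eq_coe_nnreal hr0.le
  · simpa using hr0
  · intro y hy
    have hy' : ‖y‖ < R := by
      rw [Metric.eball_ofReal, mem_ball_zero_iff] at hy
      exact hy.trans_le hrR
    -- A disc of radius greater than 1 is needed so that the one-variable series can be evaluated at
    -- `t = 1`.
    obtain ⟨ρ, hρ1, hρ⟩ : ∃ ρ : ℝ, 1 < ρ ∧ ∀ t : ℂ, ‖t‖ < ρ → ‖t • y‖ < R := by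
      rcases eq_or_ne y 0 with rfl | hy0
      · exact ⟨2, by norm_num, fun t _ => by simpa using hR⟩
      · have : 0 < ‖y‖ := norm_pos_iff.2 hy0
        refine ⟨R / ‖y‖, by rwa [one_lt_div this], fun t ht => ?_⟩
        rwa [norm_smul, ← lt_div_iff₀ this]
    have hg : DifferentiableOn ℂ (fun t : ℂ => f (x + t • y)) (Metric.ball 0 ρ) := by
      refine hfR.comp (by fun_prop) ?_
      intro t ht
      simpa using hρ t (by simpa using ht)
    have := Complex.hasSum_taylorSeries_on_ball hg (z := 1) (by simpa using hρ1)
    simp only [sub_zero, one_pow, one_smul] at this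
    convert this using 2 with n
    rw [iteratedDeriv_comp_line Metric.isOpen_ball hfR x y n 0 (by simpa using hR)]
    simp [hp]

end SeveralVariables

/-! ### The two affine coordinates of the Riemann sphere. -/

section SphereCoordinates

/-- The two standard affine coordinates of the Riemann sphere. -/
noncomputable def sphereCoord (s : Bool) : ℂ → OnePoint ℂ :=
  if s then fun z => (z : OnePoint ℂ) else sphereChartInfty

/-- The value of the affine coordinate `z` expressed in the coordinate number `s`. -/
noncomputable def affineValue (s : Bool) (c : ℂ) : ℂ := if s then c else c⁻¹

theorem sphereCoord_injective (s : Bool) : Function.Injective (sphereCoord s) := by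
  cases s with
  | true =>
    intro z w h
    simpa [sphereCoord] using h
  | false =>
    intro z w h
    simp only [sphereCoord, sphereChartInfty, Bool.false_eq_true, if_false] at h
    split_ifs at h with h1 h2 h2
    · rw [h1, h2]
    · simp at h
    · simp at h
    · simpa using h

theorem sphereCoord_true_eq_false_iff {z ζ : ℂ} :
    sphereCoord true z = sphereCoord false ζ ↔ z * ζ = 1 := by
  simp only [sphereCoord, sphereChartInfty, Bool.false_eq_true, if_false, if_true]
  split_ifs with h
  · simp [h]
  · rw [OnePoint.coe_eq_coe]
    exact ⟨fun e => by rw [e, inv_mul_cancel₀ h], eq_inv_of_mul_eq_one_left⟩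

theorem sphereCoord_eq_of_ne {s s' : Bool} (hs : s ≠ s') {z ζ : ℂ} :
    sphereCoord s z = sphereCoord s' ζ ↔ z * ζ = 1 := by
  cases s <;> cases s' <;> simp only [ne_eq, not_true_eq_false] at hs
  · rw [eq_comm, sphereCoord_true_eq_false_iff, mul_comm]
  · exact sphereCoord_true_eq_false_iff

theorem exists_sphereCoord (p : OnePoint ℂ) :
    ∃ s : Bool, ∃ z : ℂ, ‖z‖ ≤ 1 ∧ p = sphereCoord s z := by
  induction p using OnePoint.rec with
  | infty => exact ⟨false, 0, by simp, by simp [sphereCoord, sphereChartInfty]⟩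
  | coe z =>
    by_cases hz : ‖z‖ ≤ 1
    · exact ⟨true, z, hz, by simp [sphereCoord]⟩
    · have hz0 : z ≠ 0 := by rintro rfl; simp at hz
      refine ⟨false, z⁻¹, ?_, ?_⟩
      · rw [norm_inv]
        exact inv_le_one_of_one_le₀ (le_of_not_ge hz)
      · change sphereCoord true z = _
        rw [sphereCoord_true_eq_false_iff]
        exact mul_inv_cancel₀ hz0

theorem spherePow_sphereCoord {b : ℕ} (hb : b ≠ 0) (s : Bool) (z : ℂ) :
    spherePow b (sphereCoord s z) = sphereCoord s (z ^ b) := by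
  cases s with
  | true => simp [sphereCoord, spherePow]
  | false =>
    simp only [sphereCoord, sphereChartInfty, Bool.false_eq_true, if_false]
    by_cases h : z = 0
    · simp [h, hb, spherePow]
    · simp [h, spherePow]

theorem sphereCoord_mem_sphereUnitCircle (s : Bool) (z : ℂ) :
    sphereCoord s z ∈ sphereUnitCircle ↔ ‖z‖ = 1 := by
  have key : ∀ z, sphereCoord true z ∈ sphereUnitCircle ↔ ‖z‖ = 1 := by
    intro z
    constructor
    · rintro ⟨w, hw, h⟩
      have : w = z := by simpa [sphereCoord] using h
      exact this ▸ hw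
    · intro h
      exact ⟨z, h, by simp [sphereCoord]⟩
  cases s with
  | true => exact key z
  | false =>
    by_cases h : z = 0
    · subst h
      simp [sphereCoord, sphereChartInfty, sphereUnitCircle]
    · have : sphereCoord false z = sphereCoord true z⁻¹ := by
        rw [eq_comm, sphereCoord_true_eq_false_iff, inv_mul_cancel₀ h]
      rw [this, key, norm_inv, inv_eq_one]

end SphereCoordinates

/-! ### Local coordinates along and across the embedded sphere. -/

section TubeCharts

variable {E : Type*} [NormedAddCommGroup E] [NormedSpace ℂ E]
  {N : Type*} [TopologicalSpace N] [ChartedSpace E N]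

theorem IsSphereEmbedding.contMDiff_sphereCoord {ι : OnePoint ℂ → N} (hι : IsSphereEmbedding E ι)
    (s : Bool) : ContMDiff 𝓘(ℂ, ℂ) 𝓘(ℂ, E) ω (fun z => ι (sphereCoord s z)) := by
  cases s with
  | true => simpa [sphereCoord] using hι.holomorphic_zero
  | false => simpa [sphereCoord] using hι.holomorphic_infty

theorem IsSphereEmbedding.injective_mfderiv_sphereCoord {ι : OnePoint ℂ → N}
    (hι : IsSphereEmbedding E ι) (s : Bool) (z : ℂ) :
    Function.Injective (mfderiv 𝓘(ℂ, ℂ) 𝓘(ℂ, E) (fun z => ι (sphereCoord s z)) z) := by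
  cases s with
  | true => exact hι.immersion_zero z
  | false => exact hι.immersion_infty z

theorem IsSphereEmbedding.isCompact_range {ι : OnePoint ℂ → N} (hι : IsSphereEmbedding E ι) :
    IsCompact (range ι) := by
  have : range ι = ⋃ s : Bool, (fun z => ι (sphereCoord s z)) '' Metric.closedBall 0 1 := by
    ext x
    simp only [mem_range, mem_iUnion, mem_image, mem_closedBall_zero_iff]
    constructor
    · rintro ⟨p, rfl⟩
      obtain ⟨s, z, hz, rfl⟩ := exists_sphereCoord p
      exact ⟨s, z, hz, rfl⟩
    · rintro ⟨s, z, -, rfl⟩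
      exact ⟨_, rfl⟩
  rw [this]
  exact isCompact_iUnion fun s =>
    (isCompact_closedBall 0 1).image (hι.contMDiff_sphereCoord s).continuous

/-- In a Hausdorff space the points of the embedded sphere that are close to a given one
have a close coordinate. -/
theorem IsSphereEmbedding.exists_isOpen_forall_sphereCoord [T2Space N] {ι : OnePoint ℂ → N}
    (hι : IsSphereEmbedding E ι) (s : Bool) (z₀ : ℂ) {ε : ℝ} (hε : 0 < ε) :
    ∃ V : Set N, IsOpen V ∧ ι (sphereCoord s z₀) ∈ V ∧
      ∀ p, ι p ∈ V → ∃ z ∈ Metric.ball z₀ ε, p = sphereCoord s z := by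
  set K : Bool → Set ℂ := fun s' =>
    {z | sphereCoord s' z ∉ sphereCoord s '' Metric.ball z₀ ε} with hK
  have hKc : ∀ s', IsClosed (K s') := by
    intro s'
    by_cases hs : s = s'
    · subst hs
      have : K s = (Metric.ball z₀ ε)ᶜ := by
        ext z
        simp only [hK, mem_ofPred_eq, mem_compl_iff, (sphereCoord_injective s).mem_set_image]
      rw [this]
      exact Metric.isOpen_ball.isClosed_compl
    · have : K s' = ({0}ᶜ ∩ (fun z : ℂ => z⁻¹) ⁻¹' Metric.ball z₀ ε)ᶜ := by
        ext z
        simp only [hK, mem_ofPred_eq, mem_compl_iff, not_iff_not, mem_image, mem_inter_iff,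
          mem_singleton_iff, mem_preimage]
        constructor
        · rintro ⟨ζ, hζ, h⟩
          rw [sphereCoord_eq_of_ne hs] at h
          have hz : z ≠ 0 := right_ne_zero_of_mul_eq_one h
          exact ⟨hz, by rwa [← eq_inv_of_mul_eq_one_left h]⟩
        · rintro ⟨hz, h⟩
          exact ⟨_, h, by rw [sphereCoord_eq_of_ne hs, inv_mul_cancel₀ hz]⟩
      rw [this]
      refine IsOpen.isClosed_compl ?_
      exact ContinuousOn.isOpen_inter_preimage (continuousOn_inv₀ (G₀ := ℂ))
        isOpen_compl_singleton Metric.isOpen_ball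
  -- This is the image of the part of the sphere outside the coordinate disc; being compact it is
  -- closed, and `V` is its complement.
  set C : Set N := ⋃ s' : Bool, (fun z => ι (sphereCoord s' z)) '' (Metric.closedBall 0 1 ∩ K s')
  have hC : IsCompact C := isCompact_iUnion fun s' =>
    ((isCompact_closedBall 0 1).inter_right (hKc s')).image
      (hι.contMDiff_sphereCoord s').continuous
  refine ⟨Cᶜ, hC.isClosed.isOpen_compl, ?_, ?_⟩
  · simp only [C, mem_compl_iff, mem_iUnion, mem_image, not_exists, not_and]
    rintro s' z ⟨-, hz⟩ h
    exact hz (hι.injective h ▸ mem_image_of_mem _ (Metric.mem_ball_self hε))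
  · intro p hp
    by_contra hcon
    apply hp
    obtain ⟨s', z, hz, rfl⟩ := exists_sphereCoord p
    refine mem_iUnion.2 ⟨s', z, ⟨by simpa using hz, ?_⟩, rfl⟩
    rintro ⟨ζ, hζ, h⟩
    exact hcon ⟨ζ, hζ, h.symm⟩

variable (E) in
/-- A coordinate `c` along the embedded sphere, and a transversal vector valued coordinate `w`,
on an open set `V`: in a chart of the manifold, each point of `V` is the sum of a point of the
sphere (the one with coordinate `c`) and of the vector `w`. -/
structure TubeChart (ι : OnePoint ℂ → N) where
  sgn : Bool
  base : N
  V : Set N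
  c : N → ℂ
  w : N → E
  isOpen : IsOpen V
  subset_source : V ⊆ (chartAt E base).source
  contMDiffOn_c : ContMDiffOn 𝓘(ℂ, E) 𝓘(ℂ, ℂ) ω c V
  contMDiffOn_w : ContMDiffOn 𝓘(ℂ, E) 𝓘(ℂ, E) ω w V
  c_sphereCoord : ∀ z, ι (sphereCoord sgn z) ∈ V → c (ι (sphereCoord sgn z)) = z
  w_sphereCoord : ∀ z, ι (sphereCoord sgn z) ∈ V → w (ι (sphereCoord sgn z)) = 0
  exists_coord : ∀ p, ι p ∈ V → ∃ z, p = sphereCoord sgn z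
  center_mem : ∀ x ∈ V, ι (sphereCoord sgn (c x)) ∈ (chartAt E base).source
  decomp : ∀ x ∈ V, chartAt E base x = chartAt E base (ι (sphereCoord sgn (c x))) + w x

/-- In a chart the sphere is a curve `γ` with nonzero velocity. A functional `ℓ` with value 1 on
that velocity makes `ℓ ∘ γ` locally invertible, and projection along the kernel of `ℓ` gives the
coordinate `c`; `w` is the remaining displacement from the curve. -/
theorem IsSphereEmbedding.exists_tubeChart [T2Space N] [IsManifold 𝓘(ℂ, E) ω N]
    {ι : OnePoint ℂ → N} (hι : IsSphereEmbedding E ι) (p : OnePoint ℂ) :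
    ∃ T : TubeChart E ι, ι p ∈ T.V := by
  obtain ⟨s, z₀, -, rfl⟩ := exists_sphereCoord p
  set γN : ℂ → N := fun z => ι (sphereCoord s z) with hγN
  have hγN_smooth : ContMDiff 𝓘(ℂ, ℂ) 𝓘(ℂ, E) ω γN := hι.contMDiff_sphereCoord s
  set κ := chartAt E (γN z₀) with hκ
  have hκs : ContMDiffOn 𝓘(ℂ, E) 𝓘(ℂ, E) ω κ κ.source := contMDiffOn_chart
  set O : Set ℂ := γN ⁻¹' κ.source with hO
  have hOo : IsOpen O := κ.open_source.preimage hγN_smooth.continuous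
  have hz₀ : z₀ ∈ O := mem_chart_source E (γN z₀)
  have hγ : ContMDiffOn 𝓘(ℂ, ℂ) 𝓘(ℂ, E) ω (fun z => κ (γN z)) O :=
    hκs.comp hγN_smooth.contMDiffOn (fun z hz => hz)
  set γ : ℂ → E := fun z => κ (γN z) with hγdef
  have hγ' : ContDiffAt ℂ ω γ z₀ := (hγ.contMDiffAt (hOo.mem_nhds hz₀)).contDiffAt
  have hγd : HasDerivAt γ (deriv γ z₀) z₀ :=
    (hγ'.differentiableAt (by simp)).hasDerivAt
  have hne : deriv γ z₀ ≠ 0 := by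
    intro h0
    have h1 : mfderiv 𝓘(ℂ, ℂ) 𝓘(ℂ, E) γ z₀ = (mfderiv 𝓘(ℂ, E) 𝓘(ℂ, E) κ (γN z₀)).comp
        (mfderiv 𝓘(ℂ, ℂ) 𝓘(ℂ, E) γN z₀) :=
      mfderiv_comp z₀ ((hκs.contMDiffAt (κ.open_source.mem_nhds hz₀)).mdifferentiableAt (by simp))
        (hγN_smooth.mdifferentiableAt (by simp))
    have h2 : Function.Injective (mfderiv 𝓘(ℂ, E) 𝓘(ℂ, E) κ (γN z₀)) :=
      (isInvertible_mfderiv_extChartAt (I := 𝓘(ℂ, E)) (x := γN z₀) (y := γN z₀)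
        (mem_extChartAt_source _)).injective
    have h3 := h2.comp (hι.injective_mfderiv_sphereCoord s z₀)
    have h4 : mfderiv 𝓘(ℂ, ℂ) 𝓘(ℂ, E) γ z₀ (1 : ℂ) = 0 := by
      rw [mfderiv_eq_fderiv]
      exact h0
    have h5 : mfderiv 𝓘(ℂ, ℂ) 𝓘(ℂ, E) γ z₀ (0 : ℂ) = 0 := map_zero _
    rw [h1] at h4 h5
    exact one_ne_zero (α := ℂ) (h3 (h4.trans h5.symm))
  obtain ⟨ℓ, hℓ⟩ : ∃ ℓ : E →L[ℂ] ℂ, ℓ (deriv γ z₀) = 1 := SeparatingDual.exists_eq_one hne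
  set μ : ℂ → ℂ := fun z => ℓ (γ z) with hμ
  have hμs : ContDiffAt ℂ ω μ z₀ := ℓ.contDiff.contDiffAt.comp z₀ hγ'
  have hμd : HasFDerivAt μ ((ContinuousLinearEquiv.refl ℂ ℂ : ℂ ≃L[ℂ] ℂ) : ℂ →L[ℂ] ℂ) z₀ := by
    have h1 : HasDerivAt μ 1 z₀ := by
      rw [← hℓ]; exact ℓ.hasFDerivAt.comp_hasDerivAt z₀ hγd
    have e : ((ContinuousLinearEquiv.refl ℂ ℂ : ℂ ≃L[ℂ] ℂ) : ℂ →L[ℂ] ℂ)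
        = ContinuousLinearMap.toSpanSingleton ℂ (1 : ℂ) := by ext; simp
    rw [e]
    exact h1.hasFDerivAt
  set Φ := hμs.toOpenPartialHomeomorph μ hμd (by simp) with hΦ
  have hΦcoe : ∀ z, Φ z = μ z := fun z => rfl
  have hz₀Φ : z₀ ∈ Φ.source := hμs.mem_toOpenPartialHomeomorph_source hμd (by simp)
  have hΦsymm : ContDiffAt ℂ ω Φ.symm (μ z₀) := hμs.to_localInverse hμd (by simp)
  have hΦz₀ : Φ.symm (μ z₀) = z₀ := Φ.left_inv hz₀Φ
  obtain ⟨T, hTsub, hTo, hTz⟩ : ∃ T ⊆ {t | ContDiffAt ℂ ω Φ.symm t ∧ Φ.symm t ∈ O},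
      IsOpen T ∧ μ z₀ ∈ T := by
    refine mem_nhds_iff.1 ?_
    refine (hΦsymm.eventually (by simp)).and ?_
    refine hΦsymm.continuousAt.eventually_mem (hOo.mem_nhds ?_)
    rw [hΦz₀]; exact hz₀
  obtain ⟨ε, hε, hεΦ⟩ := Metric.isOpen_iff.1 Φ.open_source z₀ hz₀Φ
  obtain ⟨V₂, hV₂o, hV₂z, hV₂⟩ := hι.exists_isOpen_forall_sphereCoord s z₀ hε
  set V : Set N := (κ.source ∩ κ ⁻¹' (ℓ ⁻¹' T)) ∩ V₂ with hV
  have hVo : IsOpen V :=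
    (κ.isOpen_inter_preimage (hTo.preimage ℓ.continuous)).inter hV₂o
  set c : N → ℂ := fun x => Φ.symm (ℓ (κ x)) with hc
  have hc_mem : ∀ x ∈ V, c x ∈ O := fun x hx => (hTsub hx.1.2).2
  have hcs : ContMDiffOn 𝓘(ℂ, E) 𝓘(ℂ, ℂ) ω c V := by
    intro x hx
    refine ContMDiffAt.contMDiffWithinAt ?_
    have h1 : ContMDiffAt 𝓘(ℂ, E) 𝓘(ℂ, E) ω κ x := hκs.contMDiffAt (κ.open_source.mem_nhds hx.1.1)
    have h2 : ContMDiffAt 𝓘(ℂ, E) 𝓘(ℂ, ℂ) ω (fun x => ℓ (κ x)) x :=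
      ℓ.contMDiff.contMDiffAt.comp x h1
    exact (hTsub hx.1.2).1.contMDiffAt.comp x h2
  have hcoord : ∀ z, γN z ∈ V → c (γN z) = z := by
    intro z hz
    obtain ⟨z', hz', he⟩ := hV₂ _ hz.2
    have : z = z' := sphereCoord_injective s he
    subst this
    exact Φ.left_inv (hεΦ hz')
  have hγc : ContMDiffOn 𝓘(ℂ, E) 𝓘(ℂ, E) ω (fun x => γ (c x)) V := hγ.comp hcs hc_mem
  refine ⟨⟨s, γN z₀, V, c, fun x => κ x - γ (c x), hVo, fun x hx => hx.1.1, hcs, ?_, hcoord, ?_, ?_,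
    hc_mem, ?_⟩, ?_⟩
  · exact (hκs.mono fun x hx => hx.1.1).sub hγc
  · intro z hz
    have := hcoord z hz
    change κ (γN z) - κ (γN (c (γN z))) = 0
    rw [this, sub_self]
  · intro p hp
    obtain ⟨z, -, h⟩ := hV₂ p hp.2
    exact ⟨z, h⟩
  · intro x _
    change κ x = γ (c x) + (κ x - γ (c x))
    abel
  · exact ⟨⟨hz₀, hTz⟩, hV₂z⟩

end TubeCharts

/-! ### From order of vanishing along the sphere to bounds by the transversal coordinate. -/

section Vanishing

variable {E : Type*} [NormedAddCommGroup E] [NormedSpace ℂ E]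
  {N : Type*} [TopologicalSpace N] [ChartedSpace E N]

theorem VanishesToOrderAt.mono {g : N → ℂ} {a b : ℕ} (hab : b ≤ a) {p : N}
    (h : VanishesToOrderAt E g a p) : VanishesToOrderAt E g b p := by
  refine Asymptotics.IsBigO.trans h ?_
  refine Asymptotics.IsBigO.of_bound 1 ?_
  filter_upwards [Metric.ball_mem_nhds _ one_pos] with v hv
  rw [mem_ball_iff_norm] at hv
  rw [one_mul, norm_pow, norm_pow, norm_norm]
  exact pow_le_pow_of_le_one (norm_nonneg _) hv.le hab

theorem TransversallySuperattracting.mono {f : N → N} {L : Set N} {a b : ℕ} (hab : b ≤ a)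
    (h : TransversallySuperattracting E f L a) : TransversallySuperattracting E f L b :=
  fun ξ hξ η hη hf U χ hU hηU hχ h0 =>
    (h ξ hξ η hη hf U χ hU hηU hχ h0).mono fun _ hp => hp.mono hab

variable [IsManifold 𝓘(ℂ, E) ω N]

theorem vanishesToOrderAt_one {χ : N → ℂ} {p : N} (h : MDifferentiableAt 𝓘(ℂ, E) 𝓘(ℂ, ℂ) χ p)
    (h0 : χ p = 0) : VanishesToOrderAt E χ 1 p := by
  have hd : DifferentiableAt ℂ (fun v : E => χ ((extChartAt 𝓘(ℂ, E) p).symm v))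
      (extChartAt 𝓘(ℂ, E) p p) := by
    have h1 : MDifferentiableAt 𝓘(ℂ, E) 𝓘(ℂ, E) (extChartAt 𝓘(ℂ, E) p).symm
        (extChartAt 𝓘(ℂ, E) p p) :=
      ((contMDiffOn_extChartAt_symm (I := 𝓘(ℂ, E)) (n := ω) p).contMDiffAt
        (extChartAt_target_mem_nhds p)).mdifferentiableAt (by simp)
    rw [← mdifferentiableAt_iff_differentiableAt]
    refine MDifferentiableAt.comp (I' := 𝓘(ℂ, E)) _ ?_ h1
    rwa [extChartAt_to_inv]
  have := hd.isBigO_sub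
  simp only [extChartAt_to_inv, h0, sub_zero] at this
  simpa [VanishesToOrderAt] using this.norm_right

/-- Vanishing to some order may be tested in any chart of the atlas. -/
theorem VanishesToOrderAt.isBigO_chartAt {χ : N → ℂ} {a : ℕ} {p q : N}
    (h : VanishesToOrderAt E χ a p) (hp : p ∈ (chartAt E q).source) :
    (fun u : E => χ ((chartAt E q).symm (chartAt E q p + u))) =O[𝓝 0] fun u => ‖u‖ ^ a := by
  set κ := chartAt E q with hκ
  set e := extChartAt 𝓘(ℂ, E) p with he
  set θ : E → E := fun u => e (κ.symm (κ p + u)) with hθ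
  have hκp : κ p ∈ κ.target := κ.map_source hp
  have hθd : DifferentiableAt ℂ θ 0 := by
    have h1 : MDifferentiableAt 𝓘(ℂ, E) 𝓘(ℂ, E) κ.symm (κ p) :=
      ((contMDiffOn_chart_symm (I := 𝓘(ℂ, E)) (n := ω) (x := q)).contMDiffAt
        (κ.open_target.mem_nhds hκp)).mdifferentiableAt (by simp)
    have h2 : MDifferentiableAt 𝓘(ℂ, E) 𝓘(ℂ, E) e p :=
      (contMDiffAt_extChartAt (I := 𝓘(ℂ, E)) (n := ω) (x := p)).mdifferentiableAt (by simp)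
    have h3 : DifferentiableAt ℂ (fun v => e (κ.symm v)) (κ p) := by
      rw [← mdifferentiableAt_iff_differentiableAt]
      refine MDifferentiableAt.comp (I' := 𝓘(ℂ, E)) _ ?_ h1
      rwa [κ.left_inv hp]
    have h4 : DifferentiableAt ℂ (fun u : E => κ p + u) 0 := by fun_prop
    refine DifferentiableAt.comp (0 : E) (g := fun v => e (κ.symm v)) ?_ h4
    simpa using h3
  have hθ0 : θ 0 = e p := by simp [hθ, κ.left_inv hp]
  have hlim : Tendsto θ (𝓝 0) (𝓝 (e p)) := by
    rw [← hθ0]; exact hθd.continuousAt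
  have hO := Asymptotics.IsBigO.comp_tendsto h hlim
  have hsrc : ∀ᶠ u : E in 𝓝 0, κ.symm (κ p + u) ∈ e.source := by
    have hc : ContinuousAt (fun u : E => κ.symm (κ p + u)) 0 := by
      have h4 : ContinuousAt (fun u : E => κ p + u) 0 := by fun_prop
      refine ContinuousAt.comp (g := κ.symm) ?_ h4
      simpa using κ.symm.continuousAt hκp
    refine hc.eventually_mem ?_
    simp only [add_zero, κ.left_inv hp]
    exact extChartAt_source_mem_nhds p
  have hev : (fun u : E => χ (κ.symm (κ p + u))) =ᶠ[𝓝 0]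
      (fun v : E => χ (e.symm v)) ∘ θ := by
    filter_upwards [hsrc] with u hu
    simp only [Function.comp, hθ]
    rw [e.left_inv hu]
  refine hev.trans_isBigO (hO.trans ?_)
  have h5 := hθd.isBigO_sub
  rw [hθ0] at h5
  simp only [sub_zero] at h5
  exact (h5.norm_norm).pow a

variable {ι : OnePoint ℂ → N}

/-- In the chart `x` is displaced by `w x` from its foot point on the sphere. The higher order
Schwarz lemma on a ball about the foot point bounds `χ x`, with radius and constant uniform for `x`
near `ξ`. -/
theorem TubeChart.norm_le_of_vanishesToOrderAlong (hι : IsSphereEmbedding E ι) (T : TubeChart E ι)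
    {ξ : N} (hξ : ξ ∈ range ι) (hξV : ξ ∈ T.V) {χ : N → ℂ}
    (hχ : ∀ᶠ x in 𝓝 ξ, MDifferentiableAt 𝓘(ℂ, E) 𝓘(ℂ, ℂ) χ x) {a : ℕ} (ha : a ≠ 0)
    (hv : VanishesToOrderAlong E χ (range ι) a ξ) :
    ∃ C, ∀ᶠ x in 𝓝 ξ, ‖χ x‖ ≤ C * ‖T.w x‖ ^ a := by
  set κ := chartAt E T.base with hκ
  have hξκ : ξ ∈ κ.source := T.subset_source hξV
  obtain ⟨z, rfl⟩ : ∃ z, ξ = ι (sphereCoord T.sgn z) := by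
    obtain ⟨p, rfl⟩ := hξ
    obtain ⟨z, hz⟩ := T.exists_coord p hξV
    exact ⟨z, by rw [hz]⟩
  set ξ := ι (sphereCoord T.sgn z) with hξdef
  set M := ‖χ ξ‖ + 1
  have hM0 : 0 < M := by positivity
  have hP : ∀ᶠ x in 𝓝 ξ, (MDifferentiableAt 𝓘(ℂ, E) 𝓘(ℂ, ℂ) χ x ∧ ‖χ x‖ < M) ∧
      (x ∈ range ι → VanishesToOrderAt E χ a x) := by
    refine (hχ.and ?_).and (eventually_nhdsWithin_iff.1 hv)
    exact hχ.self_of_nhds.continuousAt.norm.eventually (gt_mem_nhds (lt_add_one _))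
  have hPE : ∀ᶠ u in 𝓝 (κ ξ), u ∈ κ.target ∧
      (MDifferentiableAt 𝓘(ℂ, E) 𝓘(ℂ, ℂ) χ (κ.symm u) ∧ ‖χ (κ.symm u)‖ < M) ∧
      (κ.symm u ∈ range ι → VanishesToOrderAt E χ a (κ.symm u)) := by
    refine Filter.Eventually.and (κ.open_target.mem_nhds (κ.map_source hξκ)) ?_
    have : Tendsto κ.symm (𝓝 (κ ξ)) (𝓝 ξ) := κ.tendsto_symm hξκ
    exact this.eventually hP
  obtain ⟨R, hR, hball⟩ := Metric.eventually_nhds_iff_ball.1 hPE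
  set r := R / 2 with hr
  have hr0 : 0 < r := by positivity
  -- The foot point of `x` on the sphere.
  set o : N → N := fun x => ι (sphereCoord T.sgn (T.c x)) with ho
  have hoξ : o ξ = ξ := by rw [ho]; simp only; rw [hξdef, T.c_sphereCoord z hξV]
  have hcc : ContinuousAt T.c ξ :=
    T.contMDiffOn_c.continuousOn.continuousAt (T.isOpen.mem_nhds hξV)
  have hwc : ContinuousAt T.w ξ :=
    T.contMDiffOn_w.continuousOn.continuousAt (T.isOpen.mem_nhds hξV)
  have hκo : ContinuousAt (fun x => κ (o x)) ξ := by
    have h1 : ContinuousAt o ξ :=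
      (hι.contMDiff_sphereCoord T.sgn).continuous.continuousAt.comp hcc
    refine ContinuousAt.comp (g := κ) ?_ h1
    rw [hoξ]; exact κ.continuousAt hξκ
  have hnear : ∀ᶠ x in 𝓝 ξ, x ∈ T.V ∧ ‖κ (o x) - κ ξ‖ < r ∧ ‖T.w x‖ < r := by
    refine Filter.Eventually.and (T.isOpen.mem_nhds hξV) (Filter.Eventually.and ?_ ?_)
    · have := hκo.eventually (Metric.ball_mem_nhds _ hr0)
      simpa [hoξ, dist_eq_norm] using this
    · have hw0 : ‖T.w ξ‖ < r := by rw [hξdef, T.w_sphereCoord z hξV]; simpa using hr0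
      exact hwc.norm.eventually (gt_mem_nhds hw0)
  refine ⟨M / r ^ a, ?_⟩
  filter_upwards [hnear] with x ⟨hxV, hxo, hxw⟩
  have hox : o x ∈ κ.source := T.center_mem x hxV
  set g : E → ℂ := fun u => χ (κ.symm (κ (o x) + u)) with hg
  have hin : ∀ u ∈ Metric.ball (0 : E) r, κ (o x) + u ∈ Metric.ball (κ ξ) R := by
    intro u hu
    rw [mem_ball_zero_iff] at hu
    rw [mem_ball_iff_norm]
    calc ‖κ (o x) + u - κ ξ‖ = ‖(κ (o x) - κ ξ) + u‖ := by congr 1; abel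
      _ ≤ _ := norm_add_le _ _
      _ < R := by linarith
  have hgd : DifferentiableOn ℂ g (Metric.ball 0 r) := by
    intro u hu
    refine DifferentiableAt.differentiableWithinAt ?_
    obtain ⟨ht, ⟨hd, -⟩, -⟩ := hball _ (hin u hu)
    have h1 : MDifferentiableAt 𝓘(ℂ, E) 𝓘(ℂ, E) κ.symm (κ (o x) + u) :=
      ((contMDiffOn_chart_symm (I := 𝓘(ℂ, E)) (n := ω) (x := T.base)).contMDiffAt
        (κ.open_target.mem_nhds ht)).mdifferentiableAt (by simp)
    have h3 : DifferentiableAt ℂ (fun v => χ (κ.symm v)) (κ (o x) + u) := by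
      rw [← mdifferentiableAt_iff_differentiableAt]
      exact MDifferentiableAt.comp (I' := 𝓘(ℂ, E)) _ hd h1
    exact DifferentiableAt.comp u (g := fun v => χ (κ.symm v)) h3 (by fun_prop)
  have h0r : (0 : E) ∈ Metric.ball (0 : E) r := Metric.mem_ball_self hr0
  have hvo : VanishesToOrderAt E χ a (o x) := by
    have := (hball _ (hin 0 h0r)).2.2
    rw [add_zero, κ.left_inv hox] at this
    exact this ⟨_, rfl⟩
  have hbig : g =O[𝓝 0] fun u => ‖u‖ ^ a := hvo.isBigO_chartAt hox
  have hg0 : g 0 = 0 := by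
    have := Asymptotics.IsBigO.eq_zero_of_norm_pow (x₀ := (0 : E)) (n := a) (by simpa using hbig) ha
    exact this
  obtain ⟨n, rfl⟩ := Nat.exists_eq_succ_of_ne_zero ha
  have ho' : (fun u => g u - g 0) =o[𝓝 0] fun u : E => ‖u - 0‖ ^ n := by
    simp only [hg0, sub_zero]
    refine hbig.trans_isLittleO ?_
    have : (fun u : E => ‖u‖ ^ (n + 1)) = fun u : E => ‖u‖ * ‖u‖ ^ n := by
      funext u; rw [pow_succ, mul_comm]
    rw [Nat.succ_eq_add_one, this]
    have h1 : (fun u : E => ‖u‖) =o[𝓝 0] fun _ : E => (1 : ℝ) := by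
      rw [Asymptotics.isLittleO_one_iff]
      simpa using (continuous_norm (E := E)).tendsto 0
    simpa using h1.mul_isBigO (Asymptotics.isBigO_refl (fun u : E => ‖u‖ ^ n) (𝓝 0))
  have hmaps : MapsTo g (Metric.ball 0 r) (Metric.closedBall (g 0) M) := by
    intro u hu
    rw [hg0, mem_closedBall_zero_iff]
    exact (hball _ (hin u hu)).2.1.2.le
  have := Complex.dist_le_mul_div_pow_of_mapsTo_ball_of_isLittleO hgd hmaps ho'
    (z := T.w x) (by simpa using hxw)
  have hgw : g (T.w x) = χ x := by
    simp only [hg]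
    rw [← T.decomp x hxV, κ.left_inv (T.subset_source hxV)]
  rw [hg0, dist_zero_right, dist_zero_right, hgw] at this
  refine this.trans (le_of_eq ?_)
  rw [div_pow, Nat.succ_eq_add_one]; ring

theorem TubeChart.norm_le_of_eventually_eq_zero (hι : IsSphereEmbedding E ι) (T : TubeChart E ι)
    {ξ : N} (hξ : ξ ∈ range ι) (hξV : ξ ∈ T.V) {χ : N → ℂ}
    (hχ : ∀ᶠ x in 𝓝 ξ, MDifferentiableAt 𝓘(ℂ, E) 𝓘(ℂ, ℂ) χ x)
    (h0 : ∀ᶠ x in 𝓝 ξ, x ∈ range ι → χ x = 0) :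
    ∃ C, ∀ᶠ x in 𝓝 ξ, ‖χ x‖ ≤ C * ‖T.w x‖ := by
  have := T.norm_le_of_vanishesToOrderAlong hι hξ hξV hχ one_ne_zero
    (eventually_nhdsWithin_iff.2 ((hχ.and h0).mono fun x hx hxL =>
      vanishesToOrderAt_one hx.1 (hx.2 hxL)))
  simpa using this

end Vanishing

/-! ### Distance to the poles, invariant under inversion. -/

section PoleDist

/-- A measure of the distance of `z` to `0` and `∞` in the Riemann sphere. -/
noncomputable def poleDist (z : ℂ) : ℝ := min ‖z‖ ‖z‖⁻¹

theorem poleDist_nonneg (z : ℂ) : 0 ≤ poleDist z :=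
  le_min (norm_nonneg _) (inv_nonneg.2 (norm_nonneg _))

theorem poleDist_pos {z : ℂ} (hz : z ≠ 0) : 0 < poleDist z :=
  lt_min (norm_pos_iff.2 hz) (inv_pos.2 (norm_pos_iff.2 hz))

theorem poleDist_inv (z : ℂ) : poleDist z⁻¹ = poleDist z := by
  simp [poleDist, min_comm]

theorem poleDist_le_norm (z : ℂ) : poleDist z ≤ ‖z‖ := min_le_left _ _

theorem poleDist_le_one (z : ℂ) : poleDist z ≤ 1 := by
  rcases le_total ‖z‖ 1 with h | h
  · exact (min_le_left _ _).trans h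
  · exact (min_le_right _ _).trans (inv_le_one_of_one_le₀ h)

theorem poleDist_affineValue (s : Bool) (c : ℂ) : poleDist (affineValue s c) = poleDist c := by
  cases s <;> simp [affineValue, poleDist_inv]

theorem affineValue_ne_zero_iff {s : Bool} {c : ℂ} : affineValue s c ≠ 0 ↔ c ≠ 0 := by
  cases s <;> simp [affineValue]

/-- In the coordinate at infinity the ratio is inverted. The hypotheses put it within `1/2` of 1,
where inversion at most doubles the distance to 1. -/
theorem affineValue_sub_one_le (s : Bool) {ρ : ℂ} {Q e : ℝ} (h : ‖ρ - 1‖ * Q ≤ e)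
    (he : 2 * e ≤ Q) (hQ : 0 < Q) : ‖affineValue s ρ - 1‖ * Q ≤ 2 * e := by
  have he0 : 0 ≤ e := le_trans (by positivity) h
  cases s with
  | true => simp only [affineValue, if_true]; linarith
  | false =>
    simp only [affineValue, Bool.false_eq_true, if_false]
    have h1 : ‖ρ - 1‖ ≤ 1 / 2 := by
      by_contra hc
      push Not at hc
      nlinarith
    have h2 : 1 / 2 ≤ ‖ρ‖ := by
      have := norm_sub_norm_le (1 : ℂ) ρ
      rw [norm_one, norm_sub_rev] at this
      linarith
    have hρ : ρ ≠ 0 := by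
      rintro rfl
      norm_num at h2
    have h3 : ρ⁻¹ - 1 = -(ρ⁻¹ * (ρ - 1)) := by field_simp; ring
    have h4 : ‖ρ⁻¹‖ ≤ 2 := by
      rw [norm_inv]
      exact inv_le_of_inv_le₀ (by norm_num) (by linarith)
    rw [h3, norm_neg, norm_mul]
    calc ‖ρ⁻¹‖ * ‖ρ - 1‖ * Q = ‖ρ⁻¹‖ * (‖ρ - 1‖ * Q) := by ring
      _ ≤ 2 * e := by gcongr

end PoleDist

/-! ### Local estimates for a map read in two tube charts. -/

section Transition

variable {E : Type*} [NormedAddCommGroup E] [NormedSpace ℂ E]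
  {N : Type*} [TopologicalSpace N] [ChartedSpace E N] {ι : OnePoint ℂ → N}

/-- The affine coordinate of a point of a tube chart. -/
noncomputable def TubeChart.Z (T : TubeChart E ι) (x : N) : ℂ := affineValue T.sgn (T.c x)

variable [IsManifold 𝓘(ℂ, E) ω N]

/-- Each component of `T'.w` is holomorphic and vanishes along the sphere, so superattraction
applies to it and the Schwarz bound follows componentwise. -/
theorem TubeChart.norm_w_comp_le [FiniteDimensional ℂ E] (hι : IsSphereEmbedding E ι)
    (T T' : TubeChart E ι) {g : N → N} (hg : ContMDiff 𝓘(ℂ, E) 𝓘(ℂ, E) ω g) {d a : ℕ} (ha : a ≠ 0)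
    (hgι : ∀ p, g (ι p) = ι (spherePow d p))
    (hsuper : TransversallySuperattracting E g (range ι) a) {ξ : N} (hξ : ξ ∈ range ι)
    (hξV : ξ ∈ T.V) (hgξV : g ξ ∈ T'.V) :
    ∃ C, ∀ᶠ x in 𝓝 ξ, ‖T'.w (g x)‖ ≤ C * ‖T.w x‖ ^ a := by
  let B := Module.finBasis ℂ E
  have hgξ : g ξ ∈ range ι := by
    obtain ⟨p, rfl⟩ := hξ
    exact ⟨_, (hgι p).symm⟩
  have hev : ∀ᶠ x in 𝓝 ξ, g x ∈ T'.V := hg.continuous.continuousAt.eventually_mem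
    (T'.isOpen.mem_nhds hgξV)
  have key : ∀ k, ∃ C, ∀ᶠ x in 𝓝 ξ, ‖B.coord k (T'.w (g x))‖ ≤ C * ‖T.w x‖ ^ a := by
    intro k
    set ℓ : E →L[ℂ] ℂ := LinearMap.toContinuousLinearMap (B.coord k)
    set χ : N → ℂ := fun y => ℓ (T'.w y)
    have hχ : ContMDiffOn 𝓘(ℂ, E) 𝓘(ℂ, ℂ) ω χ T'.V :=
      ℓ.contMDiff.comp_contMDiffOn T'.contMDiffOn_w
    have hχ0 : ∀ y ∈ T'.V ∩ range ι, χ y = 0 := by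
      rintro y ⟨hy, p, rfl⟩
      obtain ⟨z, rfl⟩ := T'.exists_coord p hy
      simp only [χ]
      rw [T'.w_sphereCoord z hy, map_zero]
    have hv := hsuper ξ hξ (g ξ) hgξ rfl T'.V χ T'.isOpen hgξV hχ hχ0
    refine T.norm_le_of_vanishesToOrderAlong hι hξ hξV ?_ ha hv
    filter_upwards [hev] with x hx
    exact ((hχ.contMDiffAt (T'.isOpen.mem_nhds hx)).comp x hg.contMDiffAt).mdifferentiableAt
      (by simp)
  choose C hC using key
  refine ⟨∑ k, C k * ‖B k‖, ?_⟩
  filter_upwards [eventually_all.2 hC] with x hx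
  conv_lhs => rw [← B.sum_repr (T'.w (g x))]
  rw [Finset.sum_mul]
  refine (norm_sum_le _ _).trans (Finset.sum_le_sum fun k _ => ?_)
  rw [norm_smul]
  calc _ ≤ C k * ‖T.w x‖ ^ a * ‖B k‖ := by
        have := hx k
        rw [Module.Basis.coord_apply] at this
        gcongr
    _ = _ := by ring

/-- The defect of the relation between the two coordinates is a holomorphic function vanishing on
the sphere, hence `O(‖w‖)`. Dividing by the power of the coordinate costs at most `poleDist ^ d`.
The degree is left free because `d = 1` with the identity map compares two charts. -/
theorem TubeChart.norm_Z_comp_div_sub_one_le (hι : IsSphereEmbedding E ι)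
    (T T' : TubeChart E ι) {g : N → N} (hg : ContMDiff 𝓘(ℂ, E) 𝓘(ℂ, E) ω g) {d : ℕ} (hd : d ≠ 0)
    (hgι : ∀ p, g (ι p) = ι (spherePow d p)) {ξ : N} (hξ : ξ ∈ range ι)
    (hξV : ξ ∈ T.V) (hgξV : g ξ ∈ T'.V) :
    ∃ C, ∀ᶠ x in 𝓝 ξ, T.Z x ≠ 0 → C * ‖T.w x‖ ≤ poleDist (T.Z x) ^ d →
      ‖T'.Z (g x) / T.Z x ^ d - 1‖ * poleDist (T.Z x) ^ d ≤ C * ‖T.w x‖ := by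
  have hev : ∀ᶠ x in 𝓝 ξ, x ∈ T.V ∧ g x ∈ T'.V :=
    Filter.Eventually.and (T.isOpen.mem_nhds hξV) (hg.continuous.continuousAt.eventually_mem
      (T'.isOpen.mem_nhds hgξV))
  have hc : ∀ x, x ∈ T.V → ContMDiffAt 𝓘(ℂ, E) 𝓘(ℂ, ℂ) ω T.c x := fun x hx =>
    T.contMDiffOn_c.contMDiffAt (T.isOpen.mem_nhds hx)
  have hc' : ∀ x, g x ∈ T'.V → ContMDiffAt 𝓘(ℂ, E) 𝓘(ℂ, ℂ) ω (fun x => T'.c (g x)) x := fun x hx =>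
    (T'.contMDiffOn_c.contMDiffAt (T'.isOpen.mem_nhds hx)).comp x hg.contMDiffAt
  have hL : ∀ x, x ∈ T.V → g x ∈ T'.V → x ∈ range ι →
      sphereCoord T.sgn (T.c x ^ d) = sphereCoord T'.sgn (T'.c (g x)) := by
    rintro x hx hgx ⟨p, rfl⟩
    obtain ⟨z, rfl⟩ := T.exists_coord p hx
    rw [T.c_sphereCoord z hx]
    rw [hgι, spherePow_sphereCoord hd] at hgx ⊢
    obtain ⟨z', hz'⟩ := T'.exists_coord _ hgx
    rw [hz'] at hgx ⊢
    rw [T'.c_sphereCoord z' hgx]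
  by_cases hs : T.sgn = T'.sgn
  · set χ : N → ℂ := fun x => T'.c (g x) - T.c x ^ d with hχ
    obtain ⟨C, hC⟩ := T.norm_le_of_eventually_eq_zero hι hξ hξV (χ := χ) (by
      filter_upwards [hev] with x hx
      have h1 : ContDiff ℂ ω (fun p : ℂ × ℂ => p.1 - p.2 ^ d) := by fun_prop
      exact (h1.contMDiff.contMDiffAt.comp x
        ((hc' x hx.2).prodMk_space (hc x hx.1))).mdifferentiableAt (by simp)) (by
      filter_upwards [hev] with x hx hxL
      have := hL x hx.1 hx.2 hxL
      rw [hs] at this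
      simp only [hχ]
      rw [sphereCoord_injective _ this, sub_self])
    refine ⟨2 * C, ?_⟩
    filter_upwards [hC] with x hx hZ hsmall
    have hcx : T.c x ≠ 0 := affineValue_ne_zero_iff.1 hZ
    have hQ : 0 < poleDist (T.Z x) ^ d := pow_pos (poleDist_pos hZ) d
    have e : T'.Z (g x) / T.Z x ^ d = affineValue T.sgn (T'.c (g x) / T.c x ^ d) := by
      rw [TubeChart.Z, TubeChart.Z, ← hs]
      cases T.sgn <;> simp [affineValue, div_eq_mul_inv, mul_comm]
    rw [e, mul_assoc]
    refine affineValue_sub_one_le T.sgn ?_ (by linarith) hQ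
    have h1 : T'.c (g x) / T.c x ^ d - 1 = χ x / T.c x ^ d := by
      rw [hχ]; field_simp
    have h2 : poleDist (T.Z x) ^ d ≤ ‖T.c x‖ ^ d := by
      rw [TubeChart.Z, poleDist_affineValue]
      exact pow_le_pow_left₀ (poleDist_nonneg _) (poleDist_le_norm _) _
    have h3 : 0 < ‖T.c x‖ := norm_pos_iff.2 hcx
    rw [h1, norm_div, norm_pow]
    calc ‖χ x‖ / ‖T.c x‖ ^ d * poleDist (T.Z x) ^ d ≤ ‖χ x‖ / ‖T.c x‖ ^ d * ‖T.c x‖ ^ d := by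
          gcongr
      _ = ‖χ x‖ := by field_simp
      _ ≤ _ := hx
  -- When the two charts use opposite affine coordinates, the relation on the sphere is that a
  -- product equals 1, and no division is needed.
  · set χ : N → ℂ := fun x => T'.c (g x) * T.c x ^ d - 1 with hχ
    obtain ⟨C, hC⟩ := T.norm_le_of_eventually_eq_zero hι hξ hξV (χ := χ) (by
      filter_upwards [hev] with x hx
      have h1 : ContDiff ℂ ω (fun p : ℂ × ℂ => p.1 * p.2 ^ d - 1) := by fun_prop
      exact (h1.contMDiff.contMDiffAt.comp x
        ((hc' x hx.2).prodMk_space (hc x hx.1))).mdifferentiableAt (by simp)) (by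
      filter_upwards [hev] with x hx hxL
      have := hL x hx.1 hx.2 hxL
      rw [sphereCoord_eq_of_ne hs] at this
      simp only [hχ]
      rw [mul_comm, this, sub_self])
    refine ⟨2 * C, ?_⟩
    filter_upwards [hC] with x hx hZ hsmall
    have hQ : 0 < poleDist (T.Z x) ^ d := pow_pos (poleDist_pos hZ) d
    have hQ1 : poleDist (T.Z x) ^ d ≤ 1 := pow_le_one₀ (poleDist_nonneg _) (poleDist_le_one _)
    have e : T'.Z (g x) / T.Z x ^ d = affineValue T'.sgn (T'.c (g x) * T.c x ^ d) := by
      rw [TubeChart.Z, TubeChart.Z]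
      revert hs
      cases T.sgn <;> cases T'.sgn <;> intro hs <;> simp [affineValue, div_eq_mul_inv, mul_comm] at hs ⊢
    rw [e, mul_assoc]
    refine affineValue_sub_one_le _ ?_ (by linarith) hQ
    exact (mul_le_of_le_one_right (norm_nonneg _) hQ1).trans hx

end Transition

/-! ### Compactness arguments. -/

section Uniformity

variable {X J : Type*} [TopologicalSpace X]

/-- Local estimates with constants, indexed by finitely many sets, are uniform near a compact
set. -/
theorem IsCompact.exists_uniform_constant [Finite J] {K : Set X} (hK : IsCompact K)
    {S : J → Set X} {Q : J → ℝ → X → Prop}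
    (hmono : ∀ j x, ∀ ⦃C C' : ℝ⦄, C ≤ C' → Q j C x → Q j C' x)
    (h : ∀ ξ ∈ K, ∀ j, ξ ∈ closure (S j) → ∃ C, ∀ᶠ x in 𝓝 ξ, Q j C x) :
    ∃ C, ∀ᶠ x in 𝓝ˢ K, ∀ j, x ∈ S j → Q j C x := by
  have hloc : ∀ ξ ∈ K, ∃ C, ∀ᶠ x in 𝓝 ξ, ∀ j, x ∈ S j → Q j C x := by
    intro ξ hξ
    have : ∀ j, ∃ C, ∀ᶠ x in 𝓝 ξ, x ∈ S j → Q j C x := by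
      intro j
      by_cases hj : ξ ∈ closure (S j)
      · obtain ⟨C, hC⟩ := h ξ hξ j hj
        exact ⟨C, hC.mono fun x hx _ => hx⟩
      · refine ⟨0, ?_⟩
        filter_upwards [isClosed_closure.isOpen_compl.mem_nhds hj] with x hx hxS
        exact absurd (subset_closure hxS) hx
    choose C hC using this
    obtain ⟨M, hM⟩ := (Set.finite_range C).bddAbove
    refine ⟨M, ?_⟩
    filter_upwards [eventually_all.2 hC] with x hx j hxj
    exact hmono j x (hM ⟨j, rfl⟩) (hx j hxj)
  refine hK.induction_on (p := fun K => ∃ C, ∀ᶠ x in 𝓝ˢ K, ∀ j, x ∈ S j → Q j C x) ?_ ?_ ?_ ?_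
  · exact ⟨0, by simp⟩
  · rintro s t hst ⟨C, hC⟩
    exact ⟨C, hC.filter_mono (nhdsSet_mono hst)⟩
  · rintro s t ⟨C, hC⟩ ⟨C', hC'⟩
    refine ⟨max C C', ?_⟩
    rw [nhdsSet_union, eventually_sup]
    exact ⟨hC.mono fun x hx j hj => hmono j x (le_max_left _ _) (hx j hj),
      hC'.mono fun x hx j hj => hmono j x (le_max_right _ _) (hx j hj)⟩
  · intro ξ hξ
    obtain ⟨C, hC⟩ := hloc ξ hξ
    refine ⟨{x | ∀ᶠ y in 𝓝 x, ∀ j, y ∈ S j → Q j C y},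
      mem_nhdsWithin_of_mem_nhds (eventually_eventually_nhds.2 hC), C, ?_⟩
    rw [eventually_nhdsSet_iff_forall]
    exact fun x hx => hx

/-- If the zeros of nonnegative continuous functions on compact sets lie in an open set,
then so do the points where they are small. -/
theorem exists_pos_forall_lt_mem [Finite J] {K : J → Set X} (hK : ∀ j, IsCompact (K j))
    {h : J → X → ℝ} (hc : ∀ j, ContinuousOn (h j) (K j)) (h0 : ∀ j, ∀ x ∈ K j, 0 ≤ h j x)
    {O : Set X} (hO : IsOpen O) (hz : ∀ j, ∀ x ∈ K j, h j x = 0 → x ∈ O) :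
    ∃ η > 0, ∀ j, ∀ x ∈ K j, h j x < η → x ∈ O := by
  have : ∀ j, ∃ η > 0, ∀ x ∈ K j, h j x < η → x ∈ O := by
    intro j
    have hcpt : IsCompact (K j \ O) := (hK j).diff hO
    rcases (K j \ O).eq_empty_or_nonempty with he | hne
    · refine ⟨1, one_pos, fun x hx _ => ?_⟩
      by_contra hxO
      exact (he ▸ (⟨hx, hxO⟩ : x ∈ K j \ O) : x ∈ (∅ : Set X))
    · obtain ⟨x₀, hx₀, hmin⟩ := hcpt.exists_isMinOn hne ((hc j).mono sdiff_subset)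
      refine ⟨h j x₀, ?_, fun x hx hlt => ?_⟩
      · refine lt_of_le_of_ne (h0 j x₀ hx₀.1) fun h' => hx₀.2 (hz j x₀ hx₀.1 h'.symm)
      · by_contra hxO
        exact absurd (hmin ⟨hx, hxO⟩) (not_le.2 hlt)
  choose η hη hηO using this
  cases isEmpty_or_nonempty J
  · exact ⟨1, one_pos, fun j => isEmptyElim j⟩
  · obtain ⟨j₀, hj₀⟩ := Finite.exists_min η
    exact ⟨η j₀, hη j₀, fun j x hx hlt => hηO j x hx (hlt.trans_le (hj₀ j))⟩

end Uniformity

/-! ### Uniform estimates around the whole sphere. -/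

section TubeAtlases

variable (E : Type*) [NormedAddCommGroup E] [NormedSpace ℂ E]
  {N : Type*} [TopologicalSpace N] [ChartedSpace E N]

/-- Finitely many tube charts around the embedded sphere, with two layers of shrunk domains. -/
structure TubeAtlas (ι : OnePoint ℂ → N) (I : Type*) where
  T : I → TubeChart E ι
  V' : I → Set N
  V : I → Set N
  isOpen_V' : ∀ i, IsOpen (V' i)
  isOpen_V : ∀ i, IsOpen (V i)
  closure_V' : ∀ i, closure (V' i) ⊆ V i
  isCompact_closure_V : ∀ i, IsCompact (closure (V i))
  closure_V : ∀ i, closure (V i) ⊆ (T i).V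
  cover : range ι ⊆ ⋃ i, V' i

theorem IsSphereEmbedding.exists_tubeAtlas [FiniteDimensional ℂ E] [T2Space N]
    [IsManifold 𝓘(ℂ, E) ω N] {ι : OnePoint ℂ → N} (hι : IsSphereEmbedding E ι) :
    ∃ n : ℕ, Nonempty (TubeAtlas E ι (Fin n)) := by
  have : ProperSpace E := FiniteDimensional.proper ℂ E
  have : LocallyCompactSpace N := ChartedSpace.locallyCompactSpace E N
  have hex : ∀ x ∈ range ι, ∃ (T : TubeChart E ι) (V' V : Set N), x ∈ V' ∧ IsOpen V' ∧ IsOpen V ∧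
      closure V' ⊆ V ∧ IsCompact (closure V) ∧ closure V ⊆ T.V := by
    rintro _ ⟨p, rfl⟩
    obtain ⟨T, hT⟩ := hι.exists_tubeChart p
    obtain ⟨K, hK, hpK, hKT⟩ := exists_compact_subset T.isOpen hT
    obtain ⟨K', hK', hpK', hKK'⟩ := exists_compact_subset isOpen_interior hpK
    have h1 : closure (interior K) ⊆ K := closure_minimal interior_subset hK.isClosed
    refine ⟨T, interior K', interior K, hpK', isOpen_interior, isOpen_interior, ?_,
      hK.of_isClosed_subset isClosed_closure h1, h1.trans hKT⟩
    exact (closure_minimal interior_subset hK'.isClosed).trans hKK'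
  choose T V' V hmem hV'o hVo hV'V hVc hVT using hex
  obtain ⟨t, htcov⟩ := hι.isCompact_range.elim_nhds_subcover' V'
    (fun x hx => (hV'o x hx).mem_nhds (hmem x hx))
  have hL : ∀ i : Fin t.card, (t.equivFin.symm i : range ι).1 ∈ range ι := fun i =>
    (t.equivFin.symm i).1.2
  refine ⟨t.card, ⟨⟨fun i => T _ (hL i), fun i => V' _ (hL i), fun i => V _ (hL i),
    fun i => hV'o _ (hL i), fun i => hVo _ (hL i), fun i => hV'V _ (hL i), fun i => hVc _ (hL i),
    fun i => hVT _ (hL i), ?_⟩⟩⟩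
  intro x hx
  obtain ⟨y, hy, hxy⟩ := mem_iUnion₂.1 (htcov hx)
  have key : ∀ y' : range ι, y' = y → x ∈ V' y' y'.2 := by rintro _ rfl; exact hxy
  exact mem_iUnion.2 ⟨t.equivFin ⟨y, hy⟩, key _ (by simp)⟩

/-- The estimates satisfied by a map near the superattracting sphere: `Z` is the coordinate along
the sphere, `m` the size of the transversal coordinate. -/
structure TubeDynamics {X I : Type*} (f : X → X) (b : ℕ) (V' V : I → Set X) (Z : I → X → ℂ)
    (m : I → X → ℝ) (C η : ℝ) : Prop where
  two_le : 2 ≤ b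
  one_le_C : 1 ≤ C
  m_nonneg : ∀ i x, 0 ≤ m i x
  subset : ∀ i, V' i ⊆ V i
  cover : ∀ i x, x ∈ V i → m i x < η → ∃ j, f x ∈ V' j
  m_step : ∀ i j x, x ∈ V i → m i x < η → f x ∈ V j → m j (f x) ≤ C * m i x ^ b
  Z_step : ∀ i j x, x ∈ V i → m i x < η → f x ∈ V j → Z i x ≠ 0 →
    C * m i x ≤ poleDist (Z i x) ^ b →
    ‖Z j (f x) / Z i x ^ b - 1‖ * poleDist (Z i x) ^ b ≤ C * m i x
  Z_change : ∀ i j x, x ∈ V i → m i x < η → x ∈ V j → Z i x ≠ 0 → C * m i x ≤ poleDist (Z i x) →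
    ‖Z j x / Z i x - 1‖ * poleDist (Z i x) ≤ C * m i x

variable {E} {ι : OnePoint ℂ → N} {I : Type*}

theorem TubeChart.mem_range_of_w_eq_zero (T : TubeChart E ι) {x : N} (hx : x ∈ T.V)
    (hw : T.w x = 0) : x = ι (sphereCoord T.sgn (T.c x)) := by
  have := T.decomp x hx
  rw [hw, add_zero] at this
  exact (chartAt E T.base).injOn (T.subset_source hx) (T.center_mem x hx) this

/-- On each compact closure `w` vanishes only on the sphere. Estimates valid near the sphere thus
become estimates under the single condition that `‖w‖` is small. -/
theorem TubeAtlas.exists_forall_norm_w_lt_mem [Finite I] (A : TubeAtlas E ι I) {O : Set N}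
    (hO : O ∈ 𝓝ˢ (range ι)) : ∃ η > 0, ∀ i, ∀ x ∈ A.V i, ‖(A.T i).w x‖ < η → x ∈ O := by
  obtain ⟨O', hO', hL, hsub⟩ := mem_nhdsSet_iff_exists.1 hO
  obtain ⟨η, hη, h⟩ := exists_pos_forall_lt_mem (K := fun i => closure (A.V i))
    A.isCompact_closure_V (h := fun i x => ‖(A.T i).w x‖)
    (fun i => ((A.T i).contMDiffOn_w.continuousOn.mono (A.closure_V i)).norm)
    (fun i x _ => norm_nonneg _) hO' (fun i x hx h0 => by
      rw [(A.T i).mem_range_of_w_eq_zero (A.closure_V i hx) (norm_eq_zero.1 h0)]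
      exact hL ⟨_, rfl⟩)
  exact ⟨η, hη, fun i x hx hlt => hsub (h i x (subset_closure hx) hlt)⟩

theorem TubeAtlas.exists_forall_near_circle_mem [Finite I] (A : TubeAtlas E ι I) {O : Set N}
    (hO : O ∈ 𝓝ˢ (ι '' sphereUnitCircle)) :
    ∃ η > 0, ∀ i, ∀ x ∈ A.V i, ‖(A.T i).w x‖ + |‖(A.T i).c x‖ - 1| < η → x ∈ O := by
  obtain ⟨O', hO', hL, hsub⟩ := mem_nhdsSet_iff_exists.1 hO
  obtain ⟨η, hη, h⟩ := exists_pos_forall_lt_mem (K := fun i => closure (A.V i))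
    A.isCompact_closure_V (h := fun i x => ‖(A.T i).w x‖ + |‖(A.T i).c x‖ - 1|)
    (fun i => ((A.T i).contMDiffOn_w.continuousOn.mono (A.closure_V i)).norm.add
      ((((A.T i).contMDiffOn_c.continuousOn.mono (A.closure_V i)).norm.sub
        continuousOn_const).abs))
    (fun i x _ => by positivity) hO' (fun i x hx h0 => by
      have h1 : ‖(A.T i).w x‖ = 0 := by
        linarith [norm_nonneg ((A.T i).w x), abs_nonneg (‖(A.T i).c x‖ - 1)]
      have h2 : |‖(A.T i).c x‖ - 1| = 0 := by linarith
      rw [(A.T i).mem_range_of_w_eq_zero (A.closure_V i hx) (norm_eq_zero.1 h1)]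
      refine hL (mem_image_of_mem _ ?_)
      rw [sphereCoord_mem_sphereUnitCircle]
      linarith [abs_eq_zero.1 h2])
  exact ⟨η, hη, fun i x hx hlt => hsub (h i x (subset_closure hx) hlt)⟩

variable [IsManifold 𝓘(ℂ, E) ω N]

theorem TubeAtlas.exists_norm_w_comp_le [FiniteDimensional ℂ E] [Finite I]
    (hι : IsSphereEmbedding E ι) (A : TubeAtlas E ι I)
    {g : N → N} (hg : ContMDiff 𝓘(ℂ, E) 𝓘(ℂ, E) ω g) {d a : ℕ} (ha : a ≠ 0)
    (hgι : ∀ p, g (ι p) = ι (spherePow d p))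
    (hsuper : TransversallySuperattracting E g (range ι) a) :
    ∃ C, ∀ᶠ x in 𝓝ˢ (range ι), ∀ ij : I × I, x ∈ A.V ij.1 ∩ g ⁻¹' A.V ij.2 →
      ‖(A.T ij.2).w (g x)‖ ≤ C * ‖(A.T ij.1).w x‖ ^ a := by
  refine hι.isCompact_range.exists_uniform_constant ?_ ?_
  · intro j x C C' hC h
    exact h.trans (by gcongr)
  · intro ξ hξ ij hcl
    have h1 : ξ ∈ closure (A.V ij.1) := closure_mono inter_subset_left hcl
    have h2 : g ξ ∈ closure (A.V ij.2) :=
      hg.continuous.closure_preimage_subset _ (closure_mono inter_subset_right hcl)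
    exact TubeChart.norm_w_comp_le hι _ _ hg ha hgι hsuper hξ (A.closure_V _ h1) (A.closure_V _ h2)

theorem TubeAtlas.exists_norm_Z_comp_le [Finite I] (hι : IsSphereEmbedding E ι)
    (A : TubeAtlas E ι I) {g : N → N} (hg : ContMDiff 𝓘(ℂ, E) 𝓘(ℂ, E) ω g) {d : ℕ} (hd : d ≠ 0)
    (hgι : ∀ p, g (ι p) = ι (spherePow d p)) :
    ∃ C, ∀ᶠ x in 𝓝ˢ (range ι), ∀ ij : I × I, x ∈ A.V ij.1 ∩ g ⁻¹' A.V ij.2 →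
      ((A.T ij.1).Z x ≠ 0 → C * ‖(A.T ij.1).w x‖ ≤ poleDist ((A.T ij.1).Z x) ^ d →
      ‖(A.T ij.2).Z (g x) / (A.T ij.1).Z x ^ d - 1‖ * poleDist ((A.T ij.1).Z x) ^ d
        ≤ C * ‖(A.T ij.1).w x‖) := by
  refine hι.isCompact_range.exists_uniform_constant (Q := fun (ij : I × I) (C : ℝ) x =>
    (A.T ij.1).Z x ≠ 0 → C * ‖(A.T ij.1).w x‖ ≤ poleDist ((A.T ij.1).Z x) ^ d →
      ‖(A.T ij.2).Z (g x) / (A.T ij.1).Z x ^ d - 1‖ * poleDist ((A.T ij.1).Z x) ^ d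
        ≤ C * ‖(A.T ij.1).w x‖) ?_ ?_
  · intro j x C C' hC h hZ hs
    have : C * ‖(A.T j.1).w x‖ ≤ C' * ‖(A.T j.1).w x‖ := by gcongr
    exact (h hZ (this.trans hs)).trans this
  · intro ξ hξ ij hcl
    have h1 : ξ ∈ closure (A.V ij.1) := closure_mono inter_subset_left hcl
    have h2 : g ξ ∈ closure (A.V ij.2) :=
      hg.continuous.closure_preimage_subset _ (closure_mono inter_subset_right hcl)
    exact TubeChart.norm_Z_comp_div_sub_one_le hι _ _ hg hd hgι hξ (A.closure_V _ h1)
      (A.closure_V _ h2)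

theorem spherePow_one (p : OnePoint ℂ) : spherePow 1 p = p := by
  obtain ⟨s, z, -, rfl⟩ := exists_sphereCoord p
  rw [spherePow_sphereCoord one_ne_zero, pow_one]

/-- This is the reason for two layers: an orbit is kept in the smaller sets `V'`, and a nearby orbit
then remains in the larger sets `V`, with distance growing by at most a factor `C` per step. -/
theorem TubeAtlas.exists_lipschitz [Finite I] (hι : IsSphereEmbedding E ι)
    (A : TubeAtlas E ι I) {g : N → N} (hg : ContMDiff 𝓘(ℂ, E) 𝓘(ℂ, E) ω g) :
    ∃ C, ∀ᶠ x in 𝓝ˢ (range ι), ∀ ij : I × I, x ∈ A.V' ij.1 ∩ g ⁻¹' A.V' ij.2 →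
      ∀ y ∈ (chartAt E (A.T ij.1).base).source,
        C * ‖chartAt E (A.T ij.1).base y - chartAt E (A.T ij.1).base x‖ < 1 →
        y ∈ A.V ij.1 ∧ g y ∈ (chartAt E (A.T ij.2).base).source ∧
        ‖chartAt E (A.T ij.2).base (g y) - chartAt E (A.T ij.2).base (g x)‖
          ≤ C * ‖chartAt E (A.T ij.1).base y - chartAt E (A.T ij.1).base x‖ := by
  refine hι.isCompact_range.exists_uniform_constant (Q := fun (ij : I × I) (C : ℝ) x =>
    ∀ y ∈ (chartAt E (A.T ij.1).base).source,
        C * ‖chartAt E (A.T ij.1).base y - chartAt E (A.T ij.1).base x‖ < 1 →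
        y ∈ A.V ij.1 ∧ g y ∈ (chartAt E (A.T ij.2).base).source ∧
        ‖chartAt E (A.T ij.2).base (g y) - chartAt E (A.T ij.2).base (g x)‖
          ≤ C * ‖chartAt E (A.T ij.1).base y - chartAt E (A.T ij.1).base x‖) ?_ ?_
  · intro j x C C' hC h y hy hs
    have : C * ‖chartAt E (A.T j.1).base y - chartAt E (A.T j.1).base x‖
      ≤ C' * ‖chartAt E (A.T j.1).base y - chartAt E (A.T j.1).base x‖ := by gcongr
    obtain ⟨h1, h2, h3⟩ := h y hy (this.trans_lt hs)
    exact ⟨h1, h2, h3.trans this⟩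
  · rintro ξ hξ ⟨i, j⟩ hcl
    have h1 : ξ ∈ A.V i := A.closure_V' i (closure_mono inter_subset_left hcl)
    have h2 : g ξ ∈ A.V j := A.closure_V' j
      (hg.continuous.closure_preimage_subset _ (closure_mono inter_subset_right hcl))
    simp only
    set κ := chartAt E (A.T i).base
    set κ' := chartAt E (A.T j).base
    have h1s : ξ ∈ κ.source := (A.T i).subset_source (A.closure_V i (subset_closure h1))
    have h2s : g ξ ∈ κ'.source := (A.T j).subset_source (A.closure_V j (subset_closure h2))
    have hF : ContDiffAt ℂ 1 (fun u => κ' (g (κ.symm u))) (κ ξ) := by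
      have e1 : ContMDiffAt 𝓘(ℂ, E) 𝓘(ℂ, E) ω κ.symm (κ ξ) :=
        (contMDiffOn_chart_symm (I := 𝓘(ℂ, E)) (n := ω) (x := (A.T i).base)).contMDiffAt
          (κ.open_target.mem_nhds (κ.map_source h1s))
      have e2 : ContMDiffAt 𝓘(ℂ, E) 𝓘(ℂ, E) ω (fun u => g (κ.symm u)) (κ ξ) :=
        hg.contMDiffAt.comp _ e1
      have e3 : ContMDiffAt 𝓘(ℂ, E) 𝓘(ℂ, E) ω (fun u => κ' (g (κ.symm u))) (κ ξ) := by
        refine ContMDiffAt.comp (I' := 𝓘(ℂ, E)) (κ ξ) ?_ e2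
        refine (contMDiffOn_chart (I := 𝓘(ℂ, E)) (n := ω) (x := (A.T j).base)).contMDiffAt
          (κ'.open_source.mem_nhds ?_)
        rwa [κ.left_inv h1s]
      exact e3.contDiffAt.of_le (by simp)
    obtain ⟨Λ, t, ht, hΛ⟩ := hF.exists_lipschitzOnWith
    have hev : ∀ᶠ u in 𝓝 (κ ξ), u ∈ t ∧ (κ.symm u ∈ A.V i ∧ g (κ.symm u) ∈ κ'.source) := by
      refine Filter.Eventually.and ht ?_
      refine (κ.tendsto_symm h1s).eventually
        (p := fun x => x ∈ A.V i ∧ g x ∈ κ'.source)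
        (Filter.Eventually.and ((A.isOpen_V i).mem_nhds h1) ?_)
      exact hg.continuous.continuousAt.eventually_mem (κ'.open_source.mem_nhds h2s)
    obtain ⟨r, hr, hball⟩ := Metric.eventually_nhds_iff_ball.1 hev
    -- `Λ` is the Lipschitz constant; `2 / r` makes the smallness hypothesis place `y` within `r /
    -- 2` of `x` in the chart.
    refine ⟨max (Λ : ℝ) (2 / r), ?_⟩
    have hx : ∀ᶠ x in 𝓝 ξ, x ∈ κ.source ∧ κ x ∈ Metric.ball (κ ξ) (r / 2) :=
      Filter.Eventually.and (κ.open_source.mem_nhds h1s)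
        ((κ.continuousAt h1s).eventually_mem (Metric.ball_mem_nhds _ (by positivity)))
    filter_upwards [hx] with x ⟨hxs, hxr⟩ y hys hlt
    have hn : ‖κ y - κ x‖ < r / 2 := by
      have : 2 / r * ‖κ y - κ x‖ < 1 := lt_of_le_of_lt (by gcongr; exact le_max_right _ _) hlt
      rw [div_mul_eq_mul_div, div_lt_one hr] at this
      linarith
    have hyr : κ y ∈ Metric.ball (κ ξ) r := by
      rw [mem_ball_iff_norm] at hxr ⊢
      calc ‖κ y - κ ξ‖ = ‖(κ y - κ x) + (κ x - κ ξ)‖ := by congr 1; abel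
        _ ≤ _ := norm_add_le _ _
        _ < r := by linarith
    have hxr' : κ x ∈ Metric.ball (κ ξ) r := Metric.ball_subset_ball (by linarith) hxr
    obtain ⟨hyt, hyV, hyg⟩ := hball _ hyr
    obtain ⟨hxt, -, -⟩ := hball _ hxr'
    rw [κ.left_inv hys] at hyV hyg
    refine ⟨hyV, hyg, ?_⟩
    have := hΛ.norm_sub_le hyt hxt
    rw [κ.left_inv hys, κ.left_inv hxs] at this
    exact this.trans (by gcongr; exact le_max_left _ _)

/-- A map that is transversally superattracting to a sufficient order satisfies the uniform
estimates of `TubeDynamics`, and a Lipschitz estimate in the charts. -/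
theorem TubeAtlas.exists_tubeDynamics [FiniteDimensional ℂ E] [Finite I]
    (hι : IsSphereEmbedding E ι) (A : TubeAtlas E ι I)
    {f : N → N} (hf : ContMDiff 𝓘(ℂ, E) 𝓘(ℂ, E) ω f) {b : ℕ} (hb : 2 ≤ b)
    (hconj : ∀ p, f (ι p) = ι (spherePow b p))
    (hsuper : TransversallySuperattracting E f (range ι) b) :
    ∃ C η : ℝ, 0 < η ∧ TubeDynamics f b A.V' A.V (fun i => (A.T i).Z) (fun i x => ‖(A.T i).w x‖) C η ∧
      ∀ i j x, x ∈ A.V' i → ‖(A.T i).w x‖ < η → f x ∈ A.V' j →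
      ∀ y ∈ (chartAt E (A.T i).base).source,
        C * ‖chartAt E (A.T i).base y - chartAt E (A.T i).base x‖ < 1 →
        y ∈ A.V i ∧ f y ∈ (chartAt E (A.T j).base).source ∧
        ‖chartAt E (A.T j).base (f y) - chartAt E (A.T j).base (f x)‖
          ≤ C * ‖chartAt E (A.T i).base y - chartAt E (A.T i).base x‖ := by
  have hid : ContMDiff 𝓘(ℂ, E) 𝓘(ℂ, E) ω (id : N → N) := contMDiff_id
  have hidι : ∀ p, id (ι p) = ι (spherePow 1 p) := fun p => by rw [spherePow_one]; rfl
  obtain ⟨C₁, h₁⟩ := A.exists_norm_w_comp_le hι hf (by omega : b ≠ 0) hconj hsuper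
  obtain ⟨C₂, h₂⟩ := A.exists_norm_Z_comp_le hι hf (by omega : b ≠ 0) hconj
  obtain ⟨C₃, h₃⟩ := A.exists_norm_Z_comp_le hι hid one_ne_zero hidι
  obtain ⟨C₄, h₄⟩ := A.exists_lipschitz hι hf
  have hcov : ∀ᶠ x in 𝓝ˢ (range ι), ∃ j, f x ∈ A.V' j := by
    rw [eventually_nhdsSet_iff_forall]
    rintro _ ⟨p, rfl⟩
    obtain ⟨j, hj⟩ := mem_iUnion.1 (A.cover ⟨spherePow b p, rfl⟩)
    rw [← hconj] at hj
    exact (hf.continuous.continuousAt.eventually_mem ((A.isOpen_V' j).mem_nhds hj)).mono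
      fun x hx => ⟨j, hx⟩
  obtain ⟨η, hη, hηm⟩ := A.exists_forall_norm_w_lt_mem
    ((((h₁.and h₂).and h₃).and h₄).and hcov)
  set C : ℝ := max 1 (max C₁ (max C₂ (max C₃ C₄))) with hC
  have hC1 : C₁ ≤ C := by simp [hC]
  have hC2 : C₂ ≤ C := by simp [hC]
  have hC3 : C₃ ≤ C := by simp [hC]
  have hC4 : C₄ ≤ C := by simp [hC]
  have hsub : ∀ i, A.V' i ⊆ A.V i := fun i => subset_closure.trans (A.closure_V' i)
  refine ⟨C, η, hη, ⟨hb, by simp [hC], fun i x => norm_nonneg _, hsub, ?_, ?_, ?_, ?_⟩, ?_⟩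
  · intro i x hx hm
    exact (hηm i x hx hm).2
  · intro i j x hx hm hfx
    refine ((hηm i x hx hm).1.1.1.1 (i, j) ⟨hx, hfx⟩).trans ?_
    simp only
    gcongr
  · intro i j x hx hm hfx hZ hs
    have hle : C₂ * ‖(A.T i).w x‖ ≤ C * ‖(A.T i).w x‖ := by gcongr
    exact ((hηm i x hx hm).1.1.1.2 (i, j) ⟨hx, hfx⟩ hZ (hle.trans hs)).trans hle
  · intro i j x hx hm hfx hZ hs
    have hle : C₃ * ‖(A.T i).w x‖ ≤ C * ‖(A.T i).w x‖ := by gcongr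
    have := (hηm i x hx hm).1.1.2 (i, j) ⟨hx, hfx⟩ hZ
    simp only [pow_one, id] at this
    exact (this (hle.trans hs)).trans hle
  · intro i j x hx hm hfx y hy hs
    have hle : C₄ * ‖chartAt E (A.T i).base y - chartAt E (A.T i).base x‖
      ≤ C * ‖chartAt E (A.T i).base y - chartAt E (A.T i).base x‖ := by gcongr
    obtain ⟨h1, h2, h3⟩ := (hηm i x (hsub i hx) hm).1.2 (i, j) ⟨hx, hfx⟩ y hy (hle.trans_lt hs)
    exact ⟨h1, h2, h3.trans hle⟩

end TubeAtlases

/-! ### Elementary estimates on ratios and logarithms. -/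

section ComplexEstimates

theorem poleDist_pow (z : ℂ) (n : ℕ) : poleDist (z ^ n) = poleDist z ^ n := by
  rw [poleDist, poleDist, norm_pow, ← inv_pow]
  rcases le_total ‖z‖ ‖z‖⁻¹ with h | h
  · rw [min_eq_left h, min_eq_left (pow_le_pow_left₀ (norm_nonneg _) h n)]
  · rw [min_eq_right h, min_eq_right (pow_le_pow_left₀ (inv_nonneg.2 (norm_nonneg _)) h n)]

theorem half_poleDist_le_mul {r : ℂ} (h : ‖r - 1‖ ≤ 1 / 2) (z : ℂ) :
    poleDist z / 2 ≤ poleDist (r * z) := by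
  have h1 : 1 / 2 ≤ ‖r‖ := by
    have := norm_sub_norm_le (1 : ℂ) r
    rw [norm_one, norm_sub_rev] at this
    linarith
  have h2 : ‖r‖ ≤ 2 := by
    have := norm_add_le (r - 1) 1
    rw [sub_add_cancel, norm_one] at this
    linarith
  have h3 : 1 / 2 ≤ ‖r‖⁻¹ := by
    rw [one_div]
    exact inv_anti₀ (by linarith) h2
  rw [poleDist, poleDist, norm_mul, mul_inv]
  refine le_min ?_ ?_
  · have := min_le_left ‖z‖ ‖z‖⁻¹
    nlinarith [norm_nonneg z]
  · have := min_le_right ‖z‖ ‖z‖⁻¹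
    nlinarith [inv_nonneg.2 (norm_nonneg z)]

theorem norm_log_le_of_norm_sub_one_le {r : ℂ} {e : ℝ} (h : ‖r - 1‖ ≤ e) (he : e ≤ 1 / 2) :
    ‖Complex.log r‖ ≤ 2 * e := by
  have h1 := Complex.norm_log_one_add_half_le_self (h.trans he)
  rw [add_sub_cancel] at h1
  linarith [norm_nonneg (r - 1)]

theorem ne_zero_of_norm_sub_one_le {r : ℂ} {e : ℝ} (h : ‖r - 1‖ ≤ e) (he : e ≤ 1 / 2) : r ≠ 0 := by
  rintro rfl
  norm_num at h
  linarith

theorem eq_of_exp_eq_of_norm_le {z w : ℂ} (h : Complex.exp z = Complex.exp w) (hz : ‖z‖ ≤ 3)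
    (hw : ‖w‖ ≤ 3) : z = w := by
  have key : ∀ u : ℂ, ‖u‖ ≤ 3 → -Real.pi < u.im ∧ u.im ≤ Real.pi := by
    intro u hu
    have h1 := abs_le.1 ((Complex.abs_im_le_norm u).trans hu)
    have h2 := Real.pi_gt_three
    constructor <;> linarith [h1.1, h1.2]
  exact Complex.exp_inj_of_neg_pi_lt_of_le_pi (key z hz).1 (key z hz).2 (key w hw).1 (key w hw).2 h

end ComplexEstimates

/-! ### The invariant coordinate as a limit of roots along orbits. -/

section Dynamics

variable {X I : Type*}

/-- Smallness conditions on the size `θ` of a region where the dynamics is controlled;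
`μ` is the resulting contraction factor. -/
structure IsTubeRadius (b : ℕ) (C η θ μ : ℝ) : Prop where
  lt_eta : θ < η
  small : 2 * C * θ * (b + 1) ≤ 1
  mu_eq : μ = C * 2 ^ b * θ
  mu_le : μ ≤ 1 / 2

/-- The transversal size of `x` is at most `t`, relatively to its distance to the poles. -/
def TubeGood (b : ℕ) (V : I → Set X) (Z : I → X → ℂ) (m : I → X → ℝ) (η t : ℝ) (i : I) (x : X) :
    Prop :=
  x ∈ V i ∧ m i x < η ∧ Z i x ≠ 0 ∧ m i x ≤ t * poleDist (Z i x) ^ b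

/-- `TubeGood` for all the charts at `x`. -/
def TubeStart (b : ℕ) (V' V : I → Set X) (Z : I → X → ℂ) (m : I → X → ℝ) (η t : ℝ) (x : X) :
    Prop :=
  (∃ i, x ∈ V' i) ∧ ∀ i, x ∈ V i → TubeGood b V Z m η t i x

/-- The defect of invariance of the coordinate, along an orbit with itinerary `s`. -/
noncomputable def tubeRatio (f : X → X) (b : ℕ) (Z : I → X → ℂ) (s : ℕ → I) (x : X) (k : ℕ) : ℂ :=
  Z (s (k + 1)) (f^[k + 1] x) / Z (s k) (f^[k] x) ^ b

/-- The branch of the `b ^ n`-th root of the coordinate of the `n`-th iterate which is close to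
the coordinate of the point. -/
noncomputable def tubeApprox (f : X → X) (b : ℕ) (Z : I → X → ℂ) (n : ℕ) (s : ℕ → I) (x : X) : ℂ :=
  Z (s 0) x * Complex.exp
    (∑ k ∈ Finset.range n, ((b : ℂ)⁻¹) ^ (k + 1) * Complex.log (tubeRatio f b Z s x k))

/-- The limit of `tubeApprox`: an invariant coordinate. -/
noncomputable def tubeLimit (f : X → X) (b : ℕ) (Z : I → X → ℂ) (idx : X → I) (x : X) : ℂ :=
  Z (idx x) x * Complex.exp
    (∑' k, ((b : ℂ)⁻¹) ^ (k + 1) * Complex.log (tubeRatio f b Z (fun k => idx (f^[k] x)) x k))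

variable {f : X → X} {b : ℕ} {V' V : I → Set X} {Z : I → X → ℂ} {m : I → X → ℝ} {C η θ μ : ℝ}

namespace TubeDynamics

theorem radius_mul_le (D : TubeDynamics f b V' V Z m C η) (R : IsTubeRadius b C η θ μ) {t : ℝ}
    (ht : 0 ≤ t) (htθ : t ≤ θ) : 2 * (C * t) * (b + 1) ≤ 1 ∧ C * t ≤ 1 / 2 ∧ t ≤ 1 / 2 := by
  have hC := D.one_le_C
  have h1 : 2 * (C * t) * (b + 1) ≤ 1 := by
    refine le_trans ?_ R.small
    rw [mul_assoc 2 C θ]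
    gcongr
  have hb : (0 : ℝ) ≤ b := Nat.cast_nonneg b
  have h0 : 0 ≤ C * t := by positivity
  have h2 : C * t ≤ 1 / 2 := by nlinarith
  exact ⟨h1, h2, by nlinarith⟩

/-- With `Q = poleDist (Z i x) ^ b`, the new distance to the poles is at least `Q / 2`, while the
new transversal size is at most `C (t Q) ^ b = C 2 ^ b t ^ b (Q / 2) ^ b`. The powers of `Q` cancel
exactly because the transversal order is `b`; what remains is `C 2 ^ b t ^ b ≤ μ t`. -/
theorem good_step (D : TubeDynamics f b V' V Z m C η) (R : IsTubeRadius b C η θ μ) {t : ℝ}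
    (ht : 0 ≤ t) (htθ : t ≤ θ) {i j : I} {x : X} (h : TubeGood b V Z m η t i x) (hfx : f x ∈ V j) :
    ‖Z j (f x) / Z i x ^ b - 1‖ ≤ C * t ∧ TubeGood b V Z m η (μ * t) j (f x) := by
  obtain ⟨hxV, hm, hZ, hmt⟩ := h
  obtain ⟨-, hCt, ht1⟩ := D.radius_mul_le R ht htθ
  have hC := D.one_le_C
  have hb := D.two_le
  set Q := poleDist (Z i x) ^ b with hQ
  have hQ0 : 0 < Q := pow_pos (poleDist_pos hZ) b
  have hCm : C * m i x ≤ C * t * Q := by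
    rw [mul_assoc]; gcongr
  have h1 := D.Z_step i j x hxV hm hfx hZ (hCm.trans (by rw [← hQ]; nlinarith))
  have hr : ‖Z j (f x) / Z i x ^ b - 1‖ ≤ C * t := by
    have := h1.trans hCm
    exact le_of_mul_le_mul_right this hQ0
  refine ⟨hr, ?_⟩
  have hZb : Z i x ^ b ≠ 0 := pow_ne_zero b hZ
  have hZj : Z j (f x) = Z j (f x) / Z i x ^ b * Z i x ^ b := by field_simp
  have hZj0 : Z j (f x) ≠ 0 := by
    rw [hZj]
    exact mul_ne_zero (ne_zero_of_norm_sub_one_le hr hCt) hZb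
  have hpd : Q / 2 ≤ poleDist (Z j (f x)) := by
    rw [hZj, hQ, ← poleDist_pow]
    exact half_poleDist_le_mul (hr.trans hCt) _
  -- Here `b ≥ 2` produces the spare factor `θ` from which the contraction `μ` is made.
  have hpow : t ^ b ≤ θ * t := by
    calc t ^ b ≤ t ^ 2 := pow_le_pow_of_le_one ht (by linarith) hb
      _ = t * t := sq t
      _ ≤ θ * t := by gcongr
  have hmj : m j (f x) ≤ μ * t * poleDist (Z j (f x)) ^ b := by
    have hm0 := D.m_nonneg i x
    have hθ0 : 0 ≤ θ := ht.trans htθ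
    calc m j (f x) ≤ C * m i x ^ b := D.m_step i j x hxV hm hfx
      _ ≤ C * (t * Q) ^ b := by gcongr
      _ = C * 2 ^ b * t ^ b * (Q / 2) ^ b := by
          rw [mul_pow, div_pow]; field_simp
      _ ≤ C * 2 ^ b * (θ * t) * poleDist (Z j (f x)) ^ b := by gcongr
      _ = _ := by rw [R.mu_eq]; ring
  refine ⟨hfx, ?_, hZj0, hmj⟩
  have hp1 : poleDist (Z j (f x)) ^ b ≤ 1 := pow_le_one₀ (poleDist_nonneg _) (poleDist_le_one _)
  have hμ0 : 0 ≤ μ := by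
    rw [R.mu_eq]
    have hθ0 : 0 ≤ θ := ht.trans htθ
    positivity
  have : μ * t * poleDist (Z j (f x)) ^ b ≤ t := by
    have h2 : μ * t ≤ t := by nlinarith [R.mu_le]
    have h3 : 0 ≤ μ * t := by positivity
    nlinarith
  linarith [R.lt_eta]

theorem norm_Z_div_sub_one_le (D : TubeDynamics f b V' V Z m C η) (R : IsTubeRadius b C η θ μ)
    {t : ℝ} (ht : 0 ≤ t) (htθ : t ≤ θ) {i j : I} {x : X} (h : TubeGood b V Z m η t i x)
    (hx : x ∈ V j) : ‖Z j x / Z i x - 1‖ ≤ C * t := by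
  obtain ⟨hxV, hm, hZ, hmt⟩ := h
  obtain ⟨-, hCt, ht1⟩ := D.radius_mul_le R ht htθ
  have hC := D.one_le_C
  have hb := D.two_le
  have hp := poleDist_pos hZ
  have hle : poleDist (Z i x) ^ b ≤ poleDist (Z i x) := by
    conv_rhs => rw [← pow_one (poleDist (Z i x))]
    exact pow_le_pow_of_le_one hp.le (poleDist_le_one _) (by omega)
  have hCm : C * m i x ≤ C * t * poleDist (Z i x) := by
    rw [mul_assoc]; gcongr; exact hmt.trans (by gcongr)
  have h1 := D.Z_change i j x hxV hm hx hZ (hCm.trans (by nlinarith))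
  exact le_of_mul_le_mul_right (h1.trans hCm) hp

theorem good_iterate (D : TubeDynamics f b V' V Z m C η) (R : IsTubeRadius b C η θ μ) {t : ℝ}
    (ht : 0 ≤ t) (htθ : t ≤ θ) {s : ℕ → I} {x : X} (h : TubeGood b V Z m η t (s 0) x) {n : ℕ}
    (hs : ∀ k ≤ n, f^[k] x ∈ V (s k)) :
    ∀ k ≤ n, TubeGood b V Z m η (μ ^ k * t) (s k) (f^[k] x) := by
  have hμ0 : 0 ≤ μ := by
    rw [R.mu_eq]
    have hθ0 : 0 ≤ θ := ht.trans htθ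
    have hC := D.one_le_C
    positivity
  intro k
  induction k with
  | zero => intro _; simpa using h
  | succ k ih =>
    intro hk
    have hle : μ ^ k * t ≤ θ :=
      (mul_le_of_le_one_left ht (pow_le_one₀ hμ0 (by linarith [R.mu_le]))).trans htθ
    have hmem := hs (k + 1) hk
    rw [Function.iterate_succ_apply'] at hmem
    have := (D.good_step R (by positivity) hle (ih (by omega)) hmem).2
    rw [Function.iterate_succ_apply', pow_succ', mul_assoc]
    exact this

theorem mu_nonneg (D : TubeDynamics f b V' V Z m C η) (R : IsTubeRadius b C η θ μ) (hθ : 0 ≤ θ) :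
    0 ≤ μ := by
  rw [R.mu_eq]
  have hC := D.one_le_C
  positivity

theorem norm_tubeRatio_sub_one_le (D : TubeDynamics f b V' V Z m C η) (R : IsTubeRadius b C η θ μ)
    {t : ℝ} (ht : 0 ≤ t) (htθ : t ≤ θ) {s : ℕ → I} {x : X} (h : TubeGood b V Z m η t (s 0) x) {n : ℕ}
    (hs : ∀ k ≤ n, f^[k] x ∈ V (s k)) {k : ℕ} (hk : k < n) :
    ‖tubeRatio f b Z s x k - 1‖ ≤ C * (μ ^ k * t) ∧ C * (μ ^ k * t) ≤ C * t ∧ C * t ≤ 1 / 2 := by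
  have hμ0 := D.mu_nonneg R (ht.trans htθ)
  have hC := D.one_le_C
  have h1 : μ ^ k * t ≤ t := mul_le_of_le_one_left ht (pow_le_one₀ hμ0 (by linarith [R.mu_le]))
  have hmem := hs (k + 1) hk
  rw [Function.iterate_succ_apply'] at hmem
  have := (D.good_step R (by positivity) (h1.trans htθ) (D.good_iterate R ht htθ h hs k hk.le) hmem).1
  refine ⟨?_, by gcongr, (D.radius_mul_le R ht htθ).2.1⟩
  rw [tubeRatio, Function.iterate_succ_apply']
  exact this

theorem tubeApprox_succ (f : X → X) (b : ℕ) (Z : I → X → ℂ) (n : ℕ) (s : ℕ → I) (x : X) :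
    tubeApprox f b Z (n + 1) s x = tubeApprox f b Z n s x *
      Complex.exp (((b : ℂ)⁻¹) ^ (n + 1) * Complex.log (tubeRatio f b Z s x n)) := by
  rw [tubeApprox, tubeApprox, Finset.sum_range_succ, Complex.exp_add, mul_assoc]

/-- Raised to the power `b ^ (n + 1)`, the last exponential becomes the ratio itself and the product
telescopes. -/
theorem tubeApprox_pow (D : TubeDynamics f b V' V Z m C η) (R : IsTubeRadius b C η θ μ)
    {t : ℝ} (ht : 0 ≤ t) (htθ : t ≤ θ) {s : ℕ → I} {x : X} (h : TubeGood b V Z m η t (s 0) x) {n : ℕ}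
    (hs : ∀ k ≤ n, f^[k] x ∈ V (s k)) :
    tubeApprox f b Z n s x ^ b ^ n = Z (s n) (f^[n] x) := by
  induction n with
  | zero => simp [tubeApprox]
  | succ n ih =>
    obtain ⟨h1, h2, h3⟩ := D.norm_tubeRatio_sub_one_le R ht htθ h hs (Nat.lt_succ_self n)
    have hr0 := ne_zero_of_norm_sub_one_le h1 (h2.trans h3)
    have hb0 : (b : ℂ) ≠ 0 := by
      have := D.two_le
      exact_mod_cast (by omega : b ≠ 0)
    have hZ := (D.good_iterate R ht htθ h hs n n.le_succ).2.2.1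
    rw [tubeApprox_succ, mul_pow, ← Complex.exp_nat_mul, pow_succ b n, pow_mul,
      ih fun k hk => hs k (by omega)]
    have e : ((b ^ n * b : ℕ) : ℂ) * ((b : ℂ)⁻¹ ^ (n + 1) * Complex.log (tubeRatio f b Z s x n))
        = Complex.log (tubeRatio f b Z s x n) := by
      push_cast
      rw [← pow_succ, ← mul_assoc, ← mul_pow, mul_inv_cancel₀ hb0, one_pow, one_mul]
    rw [e, Complex.exp_log hr0, tubeRatio]
    field_simp

/-- Two itineraries of the same orbit give almost the same root. -/
theorem tubeApprox_eq_mul_exp (D : TubeDynamics f b V' V Z m C η) (R : IsTubeRadius b C η θ μ)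
    {t : ℝ} (ht : 0 ≤ t) (htθ : t ≤ θ) {s s' : ℕ → I} {x : X} (h : TubeGood b V Z m η t (s 0) x)
    (h' : TubeGood b V Z m η t (s' 0) x) {n : ℕ} (hs : ∀ k ≤ n, f^[k] x ∈ V (s k))
    (hs' : ∀ k ≤ n, f^[k] x ∈ V (s' k)) :
    tubeApprox f b Z n s x = tubeApprox f b Z n s' x * Complex.exp (((b : ℂ)⁻¹) ^ n *
      Complex.log (Z (s n) (f^[n] x) / Z (s' n) (f^[n] x))) := by
  have hμ0 := D.mu_nonneg R (ht.trans htθ)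
  have hC := D.one_le_C
  obtain ⟨hsm, hCt, -⟩ := D.radius_mul_le R ht htθ
  have hb0 : (b : ℂ) ≠ 0 := by
    have := D.two_le
    exact_mod_cast (by omega : b ≠ 0)
  have hchange : ∀ k ≤ n, ‖Z (s k) (f^[k] x) / Z (s' k) (f^[k] x) - 1‖ ≤ C * t := by
    intro k hk
    have h1 : μ ^ k * t ≤ t := mul_le_of_le_one_left ht (pow_le_one₀ hμ0 (by linarith [R.mu_le]))
    refine (D.norm_Z_div_sub_one_le R (by positivity) (h1.trans htθ)
      (D.good_iterate R ht htθ h' hs' k hk) (hs k hk)).trans ?_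
    gcongr
  induction n with
  | zero =>
    have h0 := ne_zero_of_norm_sub_one_le (hchange 0 le_rfl) hCt
    simp only [Function.iterate_zero, id] at h0
    have hZ := h'.2.2.1
    simp only [tubeApprox, Finset.range_zero, Finset.sum_empty, Complex.exp_zero, mul_one, pow_zero,
      one_mul, Function.iterate_zero, id]
    rw [Complex.exp_log h0]
    field_simp
  | succ n ih =>
    rw [tubeApprox_succ, tubeApprox_succ, ih (fun k hk => hs k (by omega))
      (fun k hk => hs' k (by omega)) (fun k hk => hchange k (by omega)), mul_assoc, mul_assoc,
      ← Complex.exp_add, ← Complex.exp_add]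
    obtain ⟨r1, r2, -⟩ := D.norm_tubeRatio_sub_one_le R ht htθ h hs (Nat.lt_succ_self n)
    obtain ⟨r1', r2', -⟩ := D.norm_tubeRatio_sub_one_le R ht htθ h' hs' (Nat.lt_succ_self n)
    have q1 := hchange n n.le_succ
    have q2 := hchange (n + 1) le_rfl
    have hZ := (D.good_iterate R ht htθ h hs n n.le_succ).2.2.1
    have hZ' := (D.good_iterate R ht htθ h' hs' n n.le_succ).2.2.1
    have hZ2 := (D.good_iterate R ht htθ h hs (n + 1) le_rfl).2.2.1
    have hZ2' := (D.good_iterate R ht htθ h' hs' (n + 1) le_rfl).2.2.1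
    have r0 := ne_zero_of_norm_sub_one_le r1 (r2.trans hCt)
    have r0' := ne_zero_of_norm_sub_one_le r1' (r2'.trans hCt)
    have q10 := ne_zero_of_norm_sub_one_le q1 hCt
    have q20 := ne_zero_of_norm_sub_one_le q2 hCt
    have l1 := norm_log_le_of_norm_sub_one_le (r1.trans r2) hCt
    have l1' := norm_log_le_of_norm_sub_one_le (r1'.trans r2') hCt
    have l2 := norm_log_le_of_norm_sub_one_le q1 hCt
    have l3 := norm_log_le_of_norm_sub_one_le q2 hCt
    -- Both sides have the same exponential. The condition `2 C θ (b + 1) ≤ 1` bounds both by 3,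
    -- which is less than π, so the logarithms agree without a multiple of `2πi`.
    have key : Complex.log (tubeRatio f b Z s x n)
        + b * Complex.log (Z (s n) (f^[n] x) / Z (s' n) (f^[n] x))
        = Complex.log (tubeRatio f b Z s' x n)
          + Complex.log (Z (s (n + 1)) (f^[n + 1] x) / Z (s' (n + 1)) (f^[n + 1] x)) := by
      refine eq_of_exp_eq_of_norm_le ?_ ?_ ?_
      · rw [Complex.exp_add, Complex.exp_add, Complex.exp_nat_mul, Complex.exp_log r0,
          Complex.exp_log r0', Complex.exp_log q10, Complex.exp_log q20, tubeRatio, tubeRatio, div_pow]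
        field_simp
      · refine (norm_add_le _ _).trans ?_
        rw [norm_mul, Complex.norm_natCast]
        have : (b : ℝ) * ‖Complex.log (Z (s n) (f^[n] x) / Z (s' n) (f^[n] x))‖
            ≤ b * (2 * (C * t)) := by gcongr
        linarith
      · refine (norm_add_le _ _).trans ?_
        linarith
    congr 2
    have e : ((b : ℂ)⁻¹) ^ n = ((b : ℂ)⁻¹) ^ (n + 1) * b := by
      rw [pow_succ, mul_assoc, inv_mul_cancel₀ hb0, mul_one]
    rw [e]
    linear_combination ((b : ℂ)⁻¹) ^ (n + 1) * key

/-- The covering property restores membership in a small set `V'` after every step, so the orbit can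
be followed forever, even when it drifts to a pole. -/
theorem iterate_mem_of_start (D : TubeDynamics f b V' V Z m C η) (R : IsTubeRadius b C η θ μ)
    {t : ℝ} (ht : 0 ≤ t) (htθ : t ≤ θ) {idx : X → I} (hidx : ∀ x, (∃ i, x ∈ V' i) → x ∈ V' (idx x))
    {x : X} (h : TubeStart b V' V Z m η t x) :
    ∀ n, f^[n] x ∈ V' (idx (f^[n] x)) ∧
      TubeGood b V Z m η (μ ^ n * t) (idx (f^[n] x)) (f^[n] x) := by
  have hmem0 : x ∈ V' (idx x) := hidx x h.1
  have hg0 := h.2 _ (D.subset _ hmem0)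
  have hμ0 := D.mu_nonneg R (ht.trans htθ)
  intro n
  induction n with
  | zero => exact ⟨hmem0, by simpa using hg0⟩
  | succ n ih =>
    have hle : μ ^ n * t ≤ θ :=
      (mul_le_of_le_one_left ht (pow_le_one₀ hμ0 (by linarith [R.mu_le]))).trans htθ
    have hmem : f^[n + 1] x ∈ V' (idx (f^[n + 1] x)) := by
      refine hidx _ ?_
      rw [Function.iterate_succ_apply']
      exact D.cover _ _ ih.2.1 ih.2.2.1
    refine ⟨hmem, ?_⟩
    have h2 := D.subset _ hmem
    rw [pow_succ', mul_assoc]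
    rw [Function.iterate_succ_apply'] at h2 ⊢
    exact (D.good_step R (by positivity) hle ih.2 h2).2

theorem norm_tubeLog_le (D : TubeDynamics f b V' V Z m C η) (R : IsTubeRadius b C η θ μ)
    {t : ℝ} (ht : 0 ≤ t) (htθ : t ≤ θ) {idx : X → I} (hidx : ∀ x, (∃ i, x ∈ V' i) → x ∈ V' (idx x))
    {x : X} (h : TubeStart b V' V Z m η t x) (n j : ℕ) :
    ‖((b : ℂ)⁻¹) ^ (j + n + 1) * Complex.log (tubeRatio f b Z (fun k => idx (f^[k] x)) x (j + n))‖
      ≤ ((b : ℝ)⁻¹) ^ n * (2 * (C * (μ ^ n * t))) * (1 / 2 * (1 / 2) ^ j) := by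
  have hμ0 := D.mu_nonneg R (ht.trans htθ)
  have hC := D.one_le_C
  have horb := D.iterate_mem_of_start R ht htθ hidx h
  obtain ⟨h1, h2, h3⟩ := D.norm_tubeRatio_sub_one_le R ht htθ (s := fun k => idx (f^[k] x))
    (h.2 _ (D.subset _ (horb 0).1)) (n := j + n + 1) (fun k _ => D.subset _ (horb k).1)
    (Nat.lt_succ_self (j + n))
  have hl := norm_log_le_of_norm_sub_one_le h1 (h2.trans h3)
  have hb2 : (2 : ℝ) ≤ b := by exact_mod_cast D.two_le
  have hbinv : (b : ℝ)⁻¹ ≤ 1 / 2 := by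
    rw [one_div]; exact inv_anti₀ (by norm_num) hb2
  have hb0 : 0 ≤ (b : ℝ)⁻¹ := by positivity
  have hμj : μ ^ (j + n) ≤ μ ^ n := by
    rw [pow_add]
    exact mul_le_of_le_one_left (pow_nonneg hμ0 n) (pow_le_one₀ hμ0 (by linarith [R.mu_le]))
  rw [norm_mul, norm_pow, norm_inv, Complex.norm_natCast]
  calc (b : ℝ)⁻¹ ^ (j + n + 1) * _
      ≤ (b : ℝ)⁻¹ ^ (j + n + 1) * (2 * (C * (μ ^ (j + n) * t))) := by gcongr
    _ = (b : ℝ)⁻¹ ^ n * ((b : ℝ)⁻¹ * (b : ℝ)⁻¹ ^ j) * (2 * (C * (μ ^ (j + n) * t))) := by ring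
    _ ≤ (b : ℝ)⁻¹ ^ n * (1 / 2 * (1 / 2) ^ j) * (2 * (C * (μ ^ n * t))) := by gcongr
    _ = _ := by ring

/-- The orbit roots converge geometrically to `tubeLimit`. -/
theorem exists_tubeLimit_tail (D : TubeDynamics f b V' V Z m C η) (R : IsTubeRadius b C η θ μ)
    {t : ℝ} (ht : 0 ≤ t) (htθ : t ≤ θ) {idx : X → I} (hidx : ∀ x, (∃ i, x ∈ V' i) → x ∈ V' (idx x))
    {x : X} (h : TubeStart b V' V Z m η t x) (n : ℕ) :
    ∃ u : ℂ, tubeLimit f b Z idx x = tubeApprox f b Z n (fun k => idx (f^[k] x)) x * Complex.exp u ∧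
      ‖u‖ ≤ ((b : ℝ)⁻¹) ^ n * (2 * (C * (μ ^ n * t))) := by
  set a : ℕ → ℂ := fun k => ((b : ℂ)⁻¹) ^ (k + 1) *
    Complex.log (tubeRatio f b Z (fun k => idx (f^[k] x)) x k) with ha
  have hgeom : ∀ B : ℝ, HasSum (fun j : ℕ => B * (1 / 2 * (1 / 2 : ℝ) ^ j)) B := by
    intro B
    have := ((hasSum_geometric_of_lt_one (r := (1 / 2 : ℝ)) (by norm_num) (by norm_num)).mul_left
      (1 / 2)).mul_left B
    rwa [show B * (1 / 2 * (1 - 1 / 2 : ℝ)⁻¹) = B by norm_num] at this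
  have hbound := D.norm_tubeLog_le R ht htθ hidx h
  have hsum : Summable a := by
    exact Summable.of_norm_bounded (hgeom (((b : ℝ)⁻¹) ^ 0 * (2 * (C * (μ ^ 0 * t))))).summable
      (fun j => hbound 0 j)
  refine ⟨∑' j, a (j + n), ?_, ?_⟩
  · rw [tubeLimit, tubeApprox, mul_assoc, ← Complex.exp_add, hsum.sum_add_tsum_nat_add n]
    rfl
  · exact tsum_of_norm_bounded (hgeom _) (fun j => hbound n j)

/-- Multiplication by `b` shifts the series of logarithms by one index; the first term then
exponentiates to `Z (f x) / Z x ^ b`. -/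
theorem tubeLimit_map (D : TubeDynamics f b V' V Z m C η) (R : IsTubeRadius b C η θ μ)
    {t : ℝ} (ht : 0 ≤ t) (htθ : t ≤ θ) {idx : X → I} (hidx : ∀ x, (∃ i, x ∈ V' i) → x ∈ V' (idx x))
    {x : X} (h : TubeStart b V' V Z m η t x) :
    tubeLimit f b Z idx (f x) = tubeLimit f b Z idx x ^ b := by
  set a : ℕ → ℂ := fun k => ((b : ℂ)⁻¹) ^ (k + 1) *
    Complex.log (tubeRatio f b Z (fun k => idx (f^[k] x)) x k) with ha
  have hb0 : (b : ℂ) ≠ 0 := by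
    have := D.two_le
    exact_mod_cast (by omega : b ≠ 0)
  have hsum : Summable a := by
    refine Summable.of_norm_bounded
      (g := fun j => ((b : ℝ)⁻¹) ^ 0 * (2 * (C * (μ ^ 0 * t))) * (1 / 2 * (1 / 2 : ℝ) ^ j)) ?_
      (fun j => D.norm_tubeLog_le R ht htθ hidx h 0 j)
    exact ((summable_geometric_of_lt_one (by norm_num) (by norm_num)).mul_left _).mul_left _
  have horb := D.iterate_mem_of_start R ht htθ hidx h
  obtain ⟨h1, h2, h3⟩ := D.norm_tubeRatio_sub_one_le R ht htθ (s := fun k => idx (f^[k] x))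
    (h.2 _ (D.subset _ (horb 0).1)) (n := 1) (fun k _ => D.subset _ (horb k).1) zero_lt_one
  have hr0 := ne_zero_of_norm_sub_one_le h1 (h2.trans h3)
  have hZ : Z (idx x) x ≠ 0 := (horb 0).2.2.2.1
  have hshift : ∀ k, ((b : ℂ)⁻¹) ^ (k + 1) *
      Complex.log (tubeRatio f b Z (fun k => idx (f^[k] (f x))) (f x) k) = b * a (k + 1) := by
    intro k
    have e : ((b : ℂ)⁻¹) ^ (k + 1) = b * ((b : ℂ)⁻¹) ^ (k + 1 + 1) := by
      rw [pow_succ _ (k + 1), mul_comm (b : ℂ), mul_assoc, inv_mul_cancel₀ hb0, mul_one]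
    rw [e, mul_assoc]
    rfl
  have hsplit := hsum.sum_add_tsum_nat_add 1
  rw [Finset.sum_range_one] at hsplit
  have ha0 : (b : ℂ) * a 0 = Complex.log (tubeRatio f b Z (fun k => idx (f^[k] x)) x 0) := by
    simp only [ha, zero_add, pow_one]
    rw [← mul_assoc, mul_inv_cancel₀ hb0, one_mul]
  rw [tubeLimit, tubeLimit, mul_pow, ← Complex.exp_nat_mul]
  simp only [hshift]
  change _ = _ * Complex.exp (b * ∑' k, a k)
  rw [tsum_mul_left, ← hsplit, mul_add, ha0, Complex.exp_add, Complex.exp_log hr0, tubeRatio]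
  simp only [zero_add, Function.iterate_one, Function.iterate_zero, id]
  field_simp

/-- The itinerary `s` is arbitrary: one half of the error comes from replacing it by the one chosen
by `idx`, the other from the tail of the series. Fixing `s` is what allows comparison with an
approximation that is holomorphic near a given point. -/
theorem exists_tubeApprox_eq (D : TubeDynamics f b V' V Z m C η) (R : IsTubeRadius b C η θ μ)
    {t : ℝ} (ht : 0 ≤ t) (htθ : t ≤ θ) {idx : X → I} (hidx : ∀ x, (∃ i, x ∈ V' i) → x ∈ V' (idx x))
    {x : X} (h : TubeStart b V' V Z m η t x) {s : ℕ → I} {n : ℕ}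
    (hs : ∀ k ≤ n, f^[k] x ∈ V (s k)) :
    ∃ u : ℂ, tubeApprox f b Z n s x = tubeLimit f b Z idx x * Complex.exp u ∧
      ‖u‖ ≤ 4 * (C * (μ ^ n * t)) := by
  obtain ⟨u, hu, hun⟩ := D.exists_tubeLimit_tail R ht htθ hidx h n
  have hμ0 := D.mu_nonneg R (ht.trans htθ)
  have hC := D.one_le_C
  have horb := D.iterate_mem_of_start R ht htθ hidx h
  have hcomp := D.tubeApprox_eq_mul_exp R ht htθ (s := s) (s' := fun k => idx (f^[k] x))
    (h.2 _ (hs 0 (Nat.zero_le n))) (h.2 _ (D.subset _ (horb 0).1)) hs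
    (fun k _ => D.subset _ (horb k).1)
  have h1 : μ ^ n * t ≤ t := mul_le_of_le_one_left ht (pow_le_one₀ hμ0 (by linarith [R.mu_le]))
  have hlog := norm_log_le_of_norm_sub_one_le (D.norm_Z_div_sub_one_le R (by positivity)
    (h1.trans htθ) (horb n).2 (hs n le_rfl)) (D.radius_mul_le R (by positivity) (h1.trans htθ)).2.1
  have hb1 : ((b : ℝ)⁻¹) ^ n ≤ 1 := by
    have hb2 : (2 : ℝ) ≤ b := by exact_mod_cast D.two_le
    exact pow_le_one₀ (by positivity) (inv_le_one_of_one_le₀ (by linarith))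
  have hpos : 0 ≤ 2 * (C * (μ ^ n * t)) := by positivity
  refine ⟨((b : ℂ)⁻¹) ^ n * Complex.log (Z (s n) (f^[n] x) / Z (idx (f^[n] x)) (f^[n] x)) - u,
    ?_, ?_⟩
  · rw [hcomp, hu, mul_assoc, ← Complex.exp_add]
    congr 2
    ring
  · refine (norm_sub_le _ _).trans ?_
    rw [norm_mul, norm_pow, norm_inv, Complex.norm_natCast]
    have e1 : ((b : ℝ)⁻¹) ^ n * ‖Complex.log (Z (s n) (f^[n] x) / Z (idx (f^[n] x)) (f^[n] x))‖
        ≤ 2 * (C * (μ ^ n * t)) := by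
      calc _ ≤ 1 * (2 * (C * (μ ^ n * t))) := by gcongr
        _ = _ := one_mul _
    have e2 : ((b : ℝ)⁻¹) ^ n * (2 * (C * (μ ^ n * t))) ≤ 2 * (C * (μ ^ n * t)) :=
      mul_le_of_le_one_left hpos hb1
    linarith

/-- Raising to the power `b ^ n` cancels the factor `b ^ (-n)` in the tail, leaving an error of
order `μ ^ n`. When the limit has modulus 1, the orbit's coordinate therefore tends to the unit
circle. -/
theorem exists_Z_iterate_eq (D : TubeDynamics f b V' V Z m C η) (R : IsTubeRadius b C η θ μ)
    {t : ℝ} (ht : 0 ≤ t) (htθ : t ≤ θ) {idx : X → I} (hidx : ∀ x, (∃ i, x ∈ V' i) → x ∈ V' (idx x))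
    {x : X} (h : TubeStart b V' V Z m η t x) (n : ℕ) :
    ∃ u : ℂ, Z (idx (f^[n] x)) (f^[n] x) = tubeLimit f b Z idx x ^ b ^ n * Complex.exp u ∧
      ‖u‖ ≤ 2 * (C * (μ ^ n * t)) := by
  obtain ⟨u, hu, hun⟩ := D.exists_tubeLimit_tail R ht htθ hidx h n
  have horb := D.iterate_mem_of_start R ht htθ hidx h
  have hpow := D.tubeApprox_pow R ht htθ (s := fun k => idx (f^[k] x)) (n := n)
    (h.2 _ (D.subset _ (horb 0).1)) (fun k _ => D.subset _ (horb k).1)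
  have hb0 : (b : ℝ) ≠ 0 := by
    have := D.two_le
    exact_mod_cast (by omega : b ≠ 0)
  refine ⟨-((b ^ n : ℕ) * u), ?_, ?_⟩
  · rw [hu, mul_pow, hpow, Complex.exp_neg, Complex.exp_nat_mul]
    field_simp [Complex.exp_ne_zero]
  · rw [norm_neg, norm_mul, Complex.norm_natCast]
    calc ((b ^ n : ℕ) : ℝ) * ‖u‖ ≤ ((b ^ n : ℕ) : ℝ) * (((b : ℝ)⁻¹) ^ n * (2 * (C * (μ ^ n * t)))) := by
          gcongr
      _ = _ := by
          push_cast
          rw [← mul_assoc, ← mul_pow, mul_inv_cancel₀ hb0, one_pow, one_mul]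

/-- The limit coordinate is the coordinate at points of the sphere. -/
theorem tubeLimit_eq_of_start_zero (D : TubeDynamics f b V' V Z m C η) (R : IsTubeRadius b C η θ μ)
    (hθ : 0 ≤ θ) {idx : X → I} (hidx : ∀ x, (∃ i, x ∈ V' i) → x ∈ V' (idx x))
    {x : X} (h : TubeStart b V' V Z m η 0 x) {i : I} (hi : x ∈ V i) :
    tubeLimit f b Z idx x = Z i x := by
  obtain ⟨u, hu, hun⟩ := D.exists_tubeApprox_eq R le_rfl hθ hidx h (s := fun _ => i) (n := 0)
    (fun k hk => by rw [Nat.le_zero.1 hk]; exact hi)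
  have : u = 0 := by simpa using hun
  simpa [this, tubeApprox] using hu.symm

end TubeDynamics

end Dynamics

/-! ### Holomorphy of the invariant coordinate. -/

section Holomorphy

variable {E : Type*} [NormedAddCommGroup E] [NormedSpace ℂ E]
  {N : Type*} [TopologicalSpace N] [ChartedSpace E N] {ι : OnePoint ℂ → N} {I : Type*}
  {f : N → N} {b : ℕ} {C η θ μ : ℝ}

/-- Points close to `x` follow the itinerary of `x` for a long time. -/
theorem TubeAtlas.iterate_mem_of_close (A : TubeAtlas E ι I) (hC : 1 ≤ C)
    (hlip : ∀ i j x, x ∈ A.V' i → ‖(A.T i).w x‖ < η → f x ∈ A.V' j →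
      ∀ y ∈ (chartAt E (A.T i).base).source,
        C * ‖chartAt E (A.T i).base y - chartAt E (A.T i).base x‖ < 1 →
        y ∈ A.V i ∧ f y ∈ (chartAt E (A.T j).base).source ∧
        ‖chartAt E (A.T j).base (f y) - chartAt E (A.T j).base (f x)‖
          ≤ C * ‖chartAt E (A.T i).base y - chartAt E (A.T i).base x‖)
    {s : ℕ → I} {x y : N} (hx : ∀ k, f^[k] x ∈ A.V' (s k))
    (hm : ∀ k, ‖(A.T (s k)).w (f^[k] x)‖ < η) (hy : y ∈ (chartAt E (A.T (s 0)).base).source) {n : ℕ}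
    (hxy : C ^ (n + 1) * ‖chartAt E (A.T (s 0)).base y - chartAt E (A.T (s 0)).base x‖ < 1) :
    ∀ k ≤ n, f^[k] y ∈ A.V (s k) := by
  set d := ‖chartAt E (A.T (s 0)).base y - chartAt E (A.T (s 0)).base x‖ with hd
  have hd0 : 0 ≤ d := norm_nonneg _
  have hsmall : ∀ k ≤ n, C * (C ^ k * d) < 1 := by
    intro k hk
    refine lt_of_le_of_lt ?_ hxy
    rw [← mul_assoc, ← pow_succ']
    have : C ^ (k + 1) ≤ C ^ (n + 1) := pow_le_pow_right₀ hC (by omega)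
    gcongr
  have key : ∀ k ≤ n, f^[k] y ∈ (chartAt E (A.T (s k)).base).source ∧
      ‖chartAt E (A.T (s k)).base (f^[k] y) - chartAt E (A.T (s k)).base (f^[k] x)‖ ≤ C ^ k * d := by
    intro k
    induction k with
    | zero => intro _; exact ⟨hy, by simp [hd]⟩
    | succ k ih =>
      intro hk
      obtain ⟨h1, h2⟩ := ih (by omega)
      have hx' := hx (k + 1)
      rw [Function.iterate_succ_apply'] at hx'
      have := hlip (s k) (s (k + 1)) (f^[k] x) (hx k) (hm k) hx' (f^[k] y) h1
        (lt_of_le_of_lt (by gcongr) (hsmall k (by omega)))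
      rw [Function.iterate_succ_apply', Function.iterate_succ_apply']
      refine ⟨this.2.1, this.2.2.trans ?_⟩
      rw [pow_succ', mul_assoc]
      gcongr
  intro k hk
  obtain ⟨h1, h2⟩ := key k hk
  have hx' := hx (k + 1)
  rw [Function.iterate_succ_apply'] at hx'
  exact (hlip (s k) (s (k + 1)) (f^[k] x) (hx k) (hm k) hx' (f^[k] y) h1
    (lt_of_le_of_lt (by gcongr) (hsmall k hk))).1

theorem TubeChart.mdifferentiableAt_Z (T : TubeChart E ι) {x : N} (hx : x ∈ T.V) (hZ : T.Z x ≠ 0) :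
    MDifferentiableAt 𝓘(ℂ, E) 𝓘(ℂ, ℂ) T.Z x := by
  have h1 : MDifferentiableAt 𝓘(ℂ, E) 𝓘(ℂ, ℂ) T.c x :=
    (T.contMDiffOn_c.contMDiffAt (T.isOpen.mem_nhds hx)).mdifferentiableAt (by simp)
  have hc : T.c x ≠ 0 := affineValue_ne_zero_iff.1 hZ
  have h2 : DifferentiableAt ℂ (affineValue T.sgn) (T.c x) := by
    cases T.sgn with
    | true =>
      have : affineValue true = fun c => c := by funext c; simp [affineValue]
      rw [this]; exact differentiableAt_id
    | false =>
      have : affineValue false = fun c => c⁻¹ := by funext c; simp [affineValue]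
      rw [this]; exact differentiableAt_inv hc
  exact h2.mdifferentiableAt.comp x h1

variable [IsManifold 𝓘(ℂ, E) ω N]

theorem differentiableAt_comp_chartAt_symm {F : Type*} [NormedAddCommGroup F] [NormedSpace ℂ F]
    {g : N → F} {x p : N} (hx : x ∈ (chartAt E p).source)
    (hg : MDifferentiableAt 𝓘(ℂ, E) 𝓘(ℂ, F) g x) :
    DifferentiableAt ℂ (fun u => g ((chartAt E p).symm u)) (chartAt E p x) := by
  set κ := chartAt E p
  have h1 : MDifferentiableAt 𝓘(ℂ, E) 𝓘(ℂ, E) κ.symm (κ x) :=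
    ((contMDiffOn_chart_symm (I := 𝓘(ℂ, E)) (n := ω) (x := p)).contMDiffAt
      (κ.open_target.mem_nhds (κ.map_source hx))).mdifferentiableAt (by simp)
  rw [← mdifferentiableAt_iff_differentiableAt]
  refine MDifferentiableAt.comp (I' := 𝓘(ℂ, E)) _ ?_ h1
  rwa [κ.left_inv hx]

/-- Every ratio lies within `1/2` of 1, hence in the domain of the principal logarithm, and no
coordinate in a denominator vanishes. -/
theorem TubeAtlas.differentiableAt_tubeApprox (A : TubeAtlas E ι I)
    (hf : ContMDiff 𝓘(ℂ, E) 𝓘(ℂ, E) ω f)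
    (D : TubeDynamics f b A.V' A.V (fun i => (A.T i).Z) (fun i x => ‖(A.T i).w x‖) C η)
    (R : IsTubeRadius b C η θ μ) (hθ : 0 ≤ θ) {s : ℕ → I} {y p : N}
    (hy : y ∈ (chartAt E p).source)
    (hgood : TubeGood b A.V (fun i => (A.T i).Z) (fun i x => ‖(A.T i).w x‖) η θ (s 0) y) {n : ℕ}
    (hs : ∀ k ≤ n, f^[k] y ∈ A.V (s k)) :
    DifferentiableAt ℂ (fun u => tubeApprox f b (fun i => (A.T i).Z) n s ((chartAt E p).symm u))
      (chartAt E p y) := by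
  set κ := chartAt E p with hκ
  have hiter : ∀ k, ContMDiff 𝓘(ℂ, E) 𝓘(ℂ, E) ω f^[k] := by
    intro k
    induction k with
    | zero => exact contMDiff_id
    | succ k ih => rw [Function.iterate_succ']; exact hf.comp ih
  have hZd : ∀ k ≤ n, DifferentiableAt ℂ (fun u => (A.T (s k)).Z (f^[k] (κ.symm u))) (κ y) := by
    intro k hk
    refine differentiableAt_comp_chartAt_symm (g := fun x => (A.T (s k)).Z (f^[k] x)) hy ?_
    have h1 := (A.T (s k)).mdifferentiableAt_Z (A.closure_V _ (subset_closure (hs k hk)))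
      (D.good_iterate R hθ le_rfl hgood hs k hk).2.2.1
    exact MDifferentiableAt.comp (I' := 𝓘(ℂ, E)) (g := (A.T (s k)).Z) (f := f^[k]) y h1
      ((hiter k).mdifferentiableAt (by simp))
  unfold tubeApprox
  refine DifferentiableAt.mul (hZd 0 (Nat.zero_le n)) (DifferentiableAt.cexp ?_)
  refine DifferentiableAt.fun_sum fun k hk => DifferentiableAt.const_mul ?_ _
  have hk' : k < n := Finset.mem_range.1 hk
  have hZ := (D.good_iterate R hθ le_rfl hgood hs k hk'.le).2.2.1
  obtain ⟨h1, h2, h3⟩ := D.norm_tubeRatio_sub_one_le R hθ le_rfl hgood hs hk'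
  refine DifferentiableAt.clog ?_ ?_
  · simp only [tubeRatio, div_eq_mul_inv]
    refine DifferentiableAt.fun_mul (hZd (k + 1) hk') (((hZd k hk'.le).fun_pow b).fun_inv ?_)
    rw [κ.left_inv hy]
    exact pow_ne_zero b hZ
  · rw [κ.left_inv hy]
    have := Complex.mem_slitPlane_of_norm_lt_one
      (lt_of_le_of_lt (h1.trans (h2.trans h3)) (by norm_num : (1 / 2 : ℝ) < 1))
    rwa [add_sub_cancel] at this

/-- The limit coordinate is holomorphic. -/
theorem TubeAtlas.analyticAt_tubeLimit [FiniteDimensional ℂ E] (A : TubeAtlas E ι I)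
    (hf : ContMDiff 𝓘(ℂ, E) 𝓘(ℂ, E) ω f)
    (D : TubeDynamics f b A.V' A.V (fun i => (A.T i).Z) (fun i x => ‖(A.T i).w x‖) C η)
    (R : IsTubeRadius b C η θ μ) (hθ : 0 ≤ θ) (hμ : μ ≤ (1 / (2 * C)) ^ 4)
    (hlip : ∀ i j x, x ∈ A.V' i → ‖(A.T i).w x‖ < η → f x ∈ A.V' j →
      ∀ y ∈ (chartAt E (A.T i).base).source,
        C * ‖chartAt E (A.T i).base y - chartAt E (A.T i).base x‖ < 1 →
        y ∈ A.V i ∧ f y ∈ (chartAt E (A.T j).base).source ∧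
        ‖chartAt E (A.T j).base (f y) - chartAt E (A.T j).base (f x)‖
          ≤ C * ‖chartAt E (A.T i).base y - chartAt E (A.T i).base x‖)
    {idx : N → I} (hidx : ∀ x, (∃ i, x ∈ A.V' i) → x ∈ A.V' (idx x))
    {Ω : Set N} (hΩ : IsOpen Ω) (hstart : ∀ x ∈ Ω, TubeStart b A.V' A.V (fun i => (A.T i).Z)
      (fun i x => ‖(A.T i).w x‖) η θ x) {x : N} (hx : x ∈ Ω) {i : I} (hxi : x ∈ A.V' i) :
    AnalyticAt ℂ (fun u => tubeLimit f b (fun i => (A.T i).Z) idx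
      ((chartAt E (A.T i).base).symm u)) (chartAt E (A.T i).base x) := by
  set κ := chartAt E (A.T i).base with hκ
  set φ : N → ℂ := tubeLimit f b (fun i => (A.T i).Z) idx with hφ
  have hC := D.one_le_C
  have hμ0 := D.mu_nonneg R hθ
  have hV'V := D.subset
  have hV'κ : A.V' i ⊆ κ.source := fun z hz =>
    (A.T i).subset_source (A.closure_V i (subset_closure (hV'V i hz)))
  have hpoint : ∀ z ∈ Ω ∩ A.V' i, DifferentiableAt ℂ (fun u => φ (κ.symm u)) (κ z) := by
    rintro z ⟨hzΩ, hzi⟩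
    have hzκ := hV'κ hzi
    -- The itinerary of the center `z` is frozen; its first entry is the chart in which
    -- differentiability is tested.
    set s : ℕ → I := fun k => if k = 0 then i else idx (f^[k] z) with hs
    have hs0 : s 0 = i := by simp [hs]
    have horb := D.iterate_mem_of_start R hθ le_rfl hidx (hstart z hzΩ)
    have hmem : ∀ k, f^[k] z ∈ A.V' (s k) := by
      intro k
      by_cases hk : k = 0
      · subst hk; simpa [hs] using hzi
      · simpa [hs, hk] using (horb k).1
    have hgood := fun n => D.good_iterate R hθ le_rfl (s := s) (x := z) (n := n)
      ((hstart z hzΩ).2 _ (hV'V _ (hmem 0)))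
    have hm : ∀ k, ‖(A.T (s k)).w (f^[k] z)‖ < η := fun k =>
      (hgood k (fun l _ => hV'V _ (hmem l)) k le_rfl).2.1
    -- Distances grow by at most `C` per step, so points within `κ' ^ (n + 1)` of `z` follow its
    -- itinerary for `n` steps. The assumption `μ ≤ κ' ^ 4` makes the error at that stage `O(κ' ^ (4
    -- n))`.
    set κ' : ℝ := 1 / (2 * C) with hκ'
    have hκ'0 : 0 < κ' := by positivity
    have hκ'1 : κ' < 1 := by
      rw [hκ', div_lt_one (by positivity)]; linarith
    have hZc : ContinuousAt (A.T i).Z z :=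
      ((A.T i).mdifferentiableAt_Z (A.closure_V i (subset_closure (hV'V i hzi)))
        ((hstart z hzΩ).2 i (hV'V i hzi)).2.2.1).continuousAt
    have hev : ∀ᶠ u in 𝓝 (κ z), u ∈ κ.target ∧ (κ.symm u ∈ Ω ∧ κ.symm u ∈ A.V' i ∧
        ‖(A.T i).Z (κ.symm u)‖ < ‖(A.T i).Z z‖ + 1) := by
      refine Filter.Eventually.and (κ.open_target.mem_nhds (κ.map_source hzκ)) ?_
      refine (κ.tendsto_symm hzκ).eventually (p := fun y => y ∈ Ω ∧ y ∈ A.V' i ∧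
        ‖(A.T i).Z y‖ < ‖(A.T i).Z z‖ + 1) ?_
      refine Filter.Eventually.and (hΩ.mem_nhds hzΩ) (Filter.Eventually.and
        ((A.isOpen_V' i).mem_nhds hzi) ?_)
      exact hZc.norm.eventually (gt_mem_nhds (lt_add_one _))
    obtain ⟨r, hr, hball⟩ := Metric.eventually_nhds_iff_ball.1 hev
    set δ := min r κ' with hδ
    have hδ0 : 0 < δ := lt_min hr hκ'0
    have hsub : ∀ n : ℕ, Metric.ball (κ z) (δ * κ' ^ n) ⊆ Metric.ball (κ z) r := by
      intro n
      refine Metric.ball_subset_ball ?_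
      exact (mul_le_of_le_one_right hδ0.le (pow_le_one₀ hκ'0.le hκ'1.le)).trans (min_le_left _ _)
    have hfollow : ∀ n : ℕ, ∀ u ∈ Metric.ball (κ z) (δ * κ' ^ n),
        ∀ k ≤ n, f^[k] (κ.symm u) ∈ A.V (s k) := by
      intro n u hu
      obtain ⟨hut, -, huV, -⟩ := hball u (hsub n hu)
      refine A.iterate_mem_of_close hC hlip hmem hm ?_ ?_
      · rw [hs0]; exact hV'κ huV
      · rw [hs0, ← hκ, κ.right_inv hut]
        rw [mem_ball_iff_norm] at hu
        calc C ^ (n + 1) * ‖u - κ z‖ < C ^ (n + 1) * (δ * κ' ^ n) := by gcongr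
          _ ≤ C ^ (n + 1) * (κ' * κ' ^ n) := by gcongr; exact min_le_right _ _
          _ = (C * κ') ^ (n + 1) := by rw [← pow_succ', mul_pow]
          _ ≤ 1 := by
            refine pow_le_one₀ (by positivity) ?_
            rw [hκ']
            field_simp
            norm_num
    have hgoodu : ∀ u ∈ Metric.ball (κ z) r, TubeGood b A.V (fun i => (A.T i).Z)
        (fun i x => ‖(A.T i).w x‖) η θ (s 0) (κ.symm u) := by
      intro u hu
      obtain ⟨-, huΩ, huV, -⟩ := hball u hu
      rw [hs0]
      exact (hstart _ huΩ).2 i (hV'V i huV)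
    obtain ⟨-, hCθ, -⟩ := D.radius_mul_le R hθ le_rfl
    have hsm := (D.radius_mul_le R hθ le_rfl).1
    have hb2 : (2 : ℝ) ≤ b := by exact_mod_cast D.two_le
    have hCθ4 : 4 * (C * θ) ≤ 1 := by nlinarith [mul_nonneg (by linarith : (0:ℝ) ≤ C) hθ]
    have hexp : ∀ n : ℕ, ∀ w : ℂ, ‖w‖ ≤ 4 * (C * (μ ^ n * θ)) →
        ‖Complex.exp w - 1‖ ≤ 8 * (C * θ) * κ' ^ (4 * n) := by
      intro n w hw
      have h1 : μ ^ n ≤ κ' ^ (4 * n) := by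
        rw [pow_mul]; exact pow_le_pow_left₀ hμ0 hμ n
      have h2 : κ' ^ (4 * n) ≤ 1 := pow_le_one₀ hκ'0.le hκ'1.le
      have h3 : 4 * (C * (μ ^ n * θ)) ≤ 4 * (C * θ) * κ' ^ (4 * n) := by
        calc 4 * (C * (μ ^ n * θ)) ≤ 4 * (C * (κ' ^ (4 * n) * θ)) := by gcongr
          _ = _ := by ring
      have h4 : ‖w‖ ≤ 1 := (hw.trans h3).trans (mul_le_one₀ hCθ4 (by positivity) h2)
      refine (Complex.norm_exp_sub_one_le h4).trans ?_
      linarith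
    have hφM : ∀ u ∈ Metric.ball (κ z) r, ‖φ (κ.symm u)‖ ≤ (‖(A.T i).Z z‖ + 1) * 3 := by
      intro u hu
      obtain ⟨-, huΩ, huV, huZ⟩ := hball u hu
      obtain ⟨w, hw, hwn⟩ := D.exists_tubeApprox_eq R hθ le_rfl hidx (hstart _ huΩ) (s := fun _ => i)
        (n := 0) (fun k hk => by rw [Nat.le_zero.1 hk]; exact hV'V i huV)
      have h0 : (A.T i).Z (κ.symm u) = φ (κ.symm u) * Complex.exp w := by
        simpa [tubeApprox] using hw
      have h1 : φ (κ.symm u) = (A.T i).Z (κ.symm u) * Complex.exp (-w) := by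
        rw [h0, mul_assoc, ← Complex.exp_add, add_neg_cancel, Complex.exp_zero, mul_one]
      have h2 := hexp 0 (-w) (by rwa [norm_neg])
      have h3 : ‖Complex.exp (-w)‖ ≤ 3 := by
        have h5 := norm_add_le (Complex.exp (-w) - 1) 1
        rw [sub_add_cancel, norm_one] at h5
        simp only [mul_zero, pow_zero, mul_one] at h2
        linarith
      rw [h1, norm_mul]
      gcongr
    refine differentiableAt_of_holomorphic_approx (κ := κ') (δ := δ)
      (A := (‖(A.T i).Z z‖ + 1) * 3 * (8 * (C * θ))) (M := (‖(A.T i).Z z‖ + 1) * 3) hδ0 hκ'0 hκ'1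
      (h := fun n u => tubeApprox f b (fun i => (A.T i).Z) n s (κ.symm u)) ?_ ?_ ?_
    · intro n u hu
      refine DifferentiableAt.differentiableWithinAt ?_
      obtain ⟨hut, -, huV, -⟩ := hball u (hsub n hu)
      have := A.differentiableAt_tubeApprox hf D R hθ (hV'κ huV) (hgoodu u (hsub n hu))
        (hfollow n u hu)
      rwa [← hκ, κ.right_inv hut] at this
    · intro n u hu
      obtain ⟨-, huΩ, -, -⟩ := hball u (hsub n hu)
      obtain ⟨w, hw, hwn⟩ := D.exists_tubeApprox_eq R hθ le_rfl hidx (hstart _ huΩ)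
        (hfollow n u hu)
      rw [hw]
      have : φ (κ.symm u) * Complex.exp w - φ (κ.symm u)
          = φ (κ.symm u) * (Complex.exp w - 1) := by ring
      rw [← hφ, this, norm_mul, mul_assoc (_ * 3)]
      gcongr
      · exact hφM u (hsub n hu)
      · exact hexp n w hwn
    · intro u hu
      refine hφM u (Metric.ball_subset_ball (min_le_left _ _) hu)
  have hopen : IsOpen (Ω ∩ A.V' i) := hΩ.inter (A.isOpen_V' i)
  have hnhds : κ.target ∩ κ.symm ⁻¹' (Ω ∩ A.V' i) ∈ 𝓝 (κ x) := by
    refine (κ.isOpen_inter_preimage_symm hopen).mem_nhds ⟨κ.map_source (hV'κ hxi), ?_⟩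
    rw [mem_preimage, κ.left_inv (hV'κ hxi)]
    exact ⟨hx, hxi⟩
  refine analyticAt_of_differentiableOn hnhds ?_
  rintro u ⟨hut, hu⟩
  have := hpoint _ hu
  rw [κ.right_inv hut] at this
  exact this.differentiableWithinAt

end Holomorphy

/-! ### The function `log ‖φ‖` on the underlying real analytic manifold. -/

section LogNorm

variable {E : Type*} [NormedAddCommGroup E] [NormedSpace ℂ E]

theorem contDiffAt_log_norm {G : E → ℂ} {u : E} (hG : AnalyticAt ℂ G u) (h0 : G u ≠ 0) :
    ContDiffAt ℝ ω (fun v => Real.log ‖G v‖) u := by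
  have h1 : ContDiffAt ℝ ω G u := hG.contDiffAt.restrict_scalars ℝ
  exact (h1.norm ℝ h0).log (norm_ne_zero_iff.2 h0)

/-- By complex linearity some direction `v` satisfies `dG v = G u`; along it `‖G‖ ^ 2` has
derivative `2 ‖G u‖ ^ 2`, which is nonzero. -/
theorem fderiv_log_norm_ne_zero {G : E → ℂ} {u : E} (hG : AnalyticAt ℂ G u) (h0 : G u ≠ 0)
    (hd : fderiv ℂ G u ≠ 0) : fderiv ℝ (fun v => Real.log ‖G v‖) u ≠ 0 := by
  intro hzero
  obtain ⟨v, hv⟩ : ∃ v, fderiv ℂ G u v = G u := by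
    obtain ⟨v, hv⟩ : ∃ v, fderiv ℂ G u v ≠ 0 := by
      by_contra! h
      exact hd (ContinuousLinearMap.ext h)
    exact ⟨(G u / fderiv ℂ G u v) • v, by rw [map_smul, smul_eq_mul, div_mul_cancel₀ _ hv]⟩
  have hline : HasDerivAt (fun t : ℝ => u + t • v) v 0 := by
    simpa using ((hasDerivAt_id (0 : ℝ)).smul_const v).const_add u
  have hu : u + (0 : ℝ) • v = u := by simp
  have h1 : HasDerivAt (fun t : ℝ => G (u + t • v)) (G u) 0 := by
    have h2 : HasFDerivAt G ((fderiv ℂ G u).restrictScalars ℝ) (u + (0 : ℝ) • v) := by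
      rw [hu]; exact hG.differentiableAt.hasFDerivAt.restrictScalars ℝ
    have := h2.comp_hasDerivAt (0 : ℝ) hline
    simpa [hv, Function.comp_def] using this
  have h3 : HasDerivAt (fun t : ℝ => Real.log ‖G (u + t • v)‖) 0 0 := by
    have h2 : HasFDerivAt (fun v => Real.log ‖G v‖) (0 : E →L[ℝ] ℝ) (u + (0 : ℝ) • v) := by
      rw [hu, ← hzero]
      exact ((contDiffAt_log_norm hG h0).differentiableAt (by simp)).hasFDerivAt
    simpa [Function.comp_def] using h2.comp_hasDerivAt (0 : ℝ) hline
  have h4 : HasDerivAt (fun t : ℝ => ‖G (u + t • v)‖ ^ 2) (2 * ‖G u‖ ^ 2) 0 := by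
    simpa [hu, real_inner_self_eq_norm_sq] using h1.norm_sq
  have h5 : HasDerivAt (fun t : ℝ => Real.exp (2 * Real.log ‖G (u + t • v)‖)) 0 0 := by
    simpa using (h3.const_mul 2).exp
  have hev : (fun t : ℝ => ‖G (u + t • v)‖ ^ 2) =ᶠ[𝓝 0]
      fun t : ℝ => Real.exp (2 * Real.log ‖G (u + t • v)‖) := by
    have hne : ∀ᶠ t : ℝ in 𝓝 0, G (u + t • v) ≠ 0 :=
      h1.continuousAt.eventually_ne (by rwa [hu])
    filter_upwards [hne] with t ht
    rw [two_mul, Real.exp_add, Real.exp_log (norm_pos_iff.2 ht), sq]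
  have h6 := h4.unique (h5.congr_of_eventuallyEq hev)
  exact (mul_ne_zero two_ne_zero (pow_ne_zero 2 (norm_ne_zero_iff.2 h0))) h6

variable {N : Type*} [TopologicalSpace N] [ChartedSpace E N]

theorem IsManifold.real_of_complex [IsManifold 𝓘(ℂ, E) ω N] : IsManifold 𝓘(ℝ, E) ω N := by
  refine isManifold_of_contDiffOn _ _ _ fun e e' he he' => ?_
  have h := StructureGroupoid.compatible (contDiffGroupoid ω 𝓘(ℂ, E)) he he'
  rw [contDiffGroupoid, mem_groupoid_of_pregroupoid] at h
  exact ContDiffOn.restrict_scalars ℝ h.1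

theorem contMDiffAt_log_norm [IsManifold 𝓘(ℝ, E) ω N] {φ : N → ℂ} {x p : N}
    (hx : x ∈ (chartAt E p).source)
    (hG : AnalyticAt ℂ (fun u => φ ((chartAt E p).symm u)) (chartAt E p x)) (h0 : φ x ≠ 0) :
    ContMDiffAt 𝓘(ℝ, E) 𝓘(ℝ, ℝ) ω (fun y => Real.log ‖φ y‖) x := by
  set κ := chartAt E p with hκ
  have h1 := (contDiffAt_log_norm hG (by rwa [κ.left_inv hx])).contMDiffAt
  have h2 : ContMDiffAt 𝓘(ℝ, E) 𝓘(ℝ, E) ω κ x :=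
    (contMDiffOn_chart (I := 𝓘(ℝ, E)) (n := ω) (x := p)).contMDiffAt (κ.open_source.mem_nhds hx)
  refine (h1.comp x h2).congr_of_eventuallyEq ?_
  filter_upwards [κ.open_source.mem_nhds hx] with y hy
  simp [κ.left_inv hy]

theorem mfderiv_log_norm_ne_zero [IsManifold 𝓘(ℝ, E) ω N] {φ : N → ℂ} {x p : N}
    (hx : x ∈ (chartAt E p).source)
    (hG : AnalyticAt ℂ (fun u => φ ((chartAt E p).symm u)) (chartAt E p x)) (h0 : φ x ≠ 0)
    (hd : fderiv ℂ (fun u => φ ((chartAt E p).symm u)) (chartAt E p x) ≠ 0) :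
    mfderiv 𝓘(ℝ, E) 𝓘(ℝ, ℝ) (fun y => Real.log ‖φ y‖) x ≠ 0 := by
  intro hzero
  set κ := chartAt E p with hκ
  refine fderiv_log_norm_ne_zero hG (by rwa [κ.left_inv hx]) hd ?_
  have h1 : MDifferentiableAt 𝓘(ℝ, E) 𝓘(ℝ, E) κ.symm (κ x) :=
    ((contMDiffOn_chart_symm (I := 𝓘(ℝ, E)) (n := ω) (x := p)).contMDiffAt
      (κ.open_target.mem_nhds (κ.map_source hx))).mdifferentiableAt (by simp)
  have h2 : HasMFDerivAt 𝓘(ℝ, E) 𝓘(ℝ, ℝ) (fun y => Real.log ‖φ y‖) (κ.symm (κ x)) 0 := by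
    have := ((contMDiffAt_log_norm hx hG h0).mdifferentiableAt (by simp)).hasMFDerivAt
    rw [hzero] at this
    rw [κ.left_inv hx]
    exact this
  have h3 := h2.comp (κ x) h1.hasMFDerivAt
  have h4 : mfderiv 𝓘(ℝ, E) 𝓘(ℝ, ℝ) (fun u => Real.log ‖φ (κ.symm u)‖) (κ x) = 0 :=
    h3.mfderiv.trans (ContinuousLinearMap.ext fun v => rfl)
  rwa [mfderiv_eq_fderiv] at h4

end LogNorm

/-! ### The local stable set as a level set. -/

section StableSet

variable {E : Type*} [NormedAddCommGroup E] [NormedSpace ℂ E]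
  {N : Type*} [TopologicalSpace N] [ChartedSpace E N]

theorem eq_one_of_forall_pow_mem {r : ℝ} (hr : 0 ≤ r) {b : ℕ} (hb : 2 ≤ b)
    (h : ∀ n : ℕ, 1 / 2 < r ^ b ^ n ∧ r ^ b ^ n < 2) : r = 1 := by
  have hn : ∀ n, n ≤ b ^ n := fun n => (Nat.lt_pow_self (by omega)).le
  rcases lt_trichotomy r 1 with h1 | h1 | h1
  · obtain ⟨n, hn'⟩ := exists_pow_lt_of_lt_one (by norm_num : (0 : ℝ) < 1 / 2) h1
    exact absurd ((h n).1.trans_le (pow_le_pow_of_le_one hr h1.le (hn n))) hn'.not_gt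
  · exact h1
  · obtain ⟨n, hn'⟩ := pow_unbounded_of_one_lt 2 h1
    exact absurd ((pow_le_pow_right₀ h1.le (hn n)).trans_lt (h n).2) hn'.not_gt

/-- A coordinate `φ` that conjugates the map to `z ↦ z ^ b` describes the local stable set of a
repelling circle, provided that the level set `‖φ‖ = 1` is attracted by the circle. -/
theorem isRealAnalyticHypersurface_localStableSet {f : N → N} (hf : Continuous f) {b : ℕ}
    (hb : 2 ≤ b) {φ : N → ℂ} {S Ω₀ Ω : Set N}
    (hmap : ∀ x ∈ Ω₀, φ (f x) = φ x ^ b)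
    (hnorm : ∀ x ∈ Ω₀, 1 / 2 < ‖φ x‖ ∧ ‖φ x‖ < 2)
    (hsmooth : ∀ x ∈ Ω₀, ContMDiffAt 𝓘(ℝ, E) 𝓘(ℝ, ℝ) ω (fun y => Real.log ‖φ y‖) x)
    (hregular : ∀ x ∈ Ω₀, mfderiv 𝓘(ℝ, E) 𝓘(ℝ, ℝ) (fun y => Real.log ‖φ y‖) x ≠ 0)
    (hstable : ∀ O ∈ 𝓝ˢ S, ∀ᶠ x in 𝓝ˢ S, ‖φ x‖ = 1 → ∀ n, f^[n] x ∈ O)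
    (hconv : ∀ x ∈ Ω₀, ‖φ x‖ = 1 → Tendsto (fun n => f^[n] x) atTop (𝓝ˢ S))
    (hΩ : IsOpen Ω) (hSΩ : S ⊆ Ω) (hΩΩ₀ : Ω ⊆ Ω₀) :
    IsRealAnalyticHypersurface E (localStableSet f S Ω) := by
  have hiter : ∀ x n, (∀ k < n, f^[k] x ∈ Ω) → φ (f^[n] x) = φ x ^ b ^ n := by
    intro x n
    induction n with
    | zero => intro _; simp
    | succ n ih =>
      intro h
      rw [Function.iterate_succ_apply', hmap _ (hΩΩ₀ (h n (Nat.lt_succ_self n))),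
        ih fun k hk => h k (hk.trans (Nat.lt_succ_self n)), ← pow_mul, ← pow_succ]
  have hone : ∀ x, (∀ n, f^[n] x ∈ Ω) → ‖φ x‖ = 1 := by
    intro x hx
    refine eq_one_of_forall_pow_mem (norm_nonneg _) hb fun n => ?_
    rw [← norm_pow, ← hiter x n fun k _ => hx k]
    exact hnorm _ (hΩΩ₀ (hx n))
  -- Once in `O`, a point with `‖φ‖ = 1` never leaves `Ω` again.
  obtain ⟨O, hO, hSO, hOstable⟩ :=
    mem_nhdsSet_iff_exists.1 (hstable Ω (hΩ.mem_nhdsSet.2 hSΩ))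
  rintro x ⟨hxΩ, hxS⟩
  obtain ⟨n, hn⟩ := (hxS.eventually_mem (hO.mem_nhdsSet.2 hSO)).exists
  -- Points of `U` stay in `Ω` until they reach `O` at time `n`, so on `U` the level set condition
  -- alone keeps the whole orbit in `Ω`.
  set U : Set N := (⋂ k ∈ Finset.range (n + 1), f^[k] ⁻¹' Ω) ∩ f^[n] ⁻¹' O with hU
  have hUΩ : ∀ y ∈ U, ∀ k ≤ n, f^[k] y ∈ Ω := fun y hy k hk =>
    mem_iInter₂.1 hy.1 k (Finset.mem_range.2 (by omega))
  have hUΩ₀ : ∀ y ∈ U, y ∈ Ω₀ := fun y hy => hΩΩ₀ (hUΩ y hy 0 (Nat.zero_le n))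
  refine ⟨U, fun y => Real.log ‖φ y‖, ?_, ⟨mem_iInter₂.2 fun k _ => hxΩ k, hn⟩,
    fun y hy => (hsmooth y (hUΩ₀ y hy)).contMDiffWithinAt,
    fun y hy => hregular y (hUΩ₀ y hy), ?_⟩
  · exact (isOpen_biInter_finset fun k _ => hΩ.preimage (hf.iterate k)).inter
      (hO.preimage (hf.iterate n))
  · ext y
    constructor
    · rintro ⟨⟨hyΩ, -⟩, hyU⟩
      refine ⟨hyU, ?_⟩
      simp [hone y hyΩ]
    · rintro ⟨hyU, hy0⟩
      have hy1 : ‖φ y‖ = 1 := by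
        have h2 := (hnorm y (hUΩ₀ y hyU)).1
        exact Real.eq_one_of_pos_of_log_eq_zero (by linarith) hy0
      refine ⟨⟨fun k => ?_, hconv y (hUΩ₀ y hyU) hy1⟩, hyU⟩
      rcases le_total k n with hk | hk
      · exact hUΩ y hyU k hk
      · obtain ⟨l, rfl⟩ := Nat.exists_eq_add_of_le' hk
        rw [Function.iterate_add_apply]
        refine hOstable hyU.2 ?_ l
        rw [hiter y n fun k hk => hUΩ y hyU k hk.le, norm_pow, hy1, one_pow]

end StableSet

/-! ### Behavior near the invariant circle. -/

section CircleNeighbourhoods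

variable {E : Type*} [NormedAddCommGroup E] [NormedSpace ℂ E]
  {N : Type*} [TopologicalSpace N] [ChartedSpace E N] {ι : OnePoint ℂ → N} {I : Type*}
  {f : N → N} {b : ℕ} {C η θ μ : ℝ}

theorem TubeChart.w_eq_zero (T : TubeChart E ι) {p : OnePoint ℂ} (hp : ι p ∈ T.V) :
    T.w (ι p) = 0 := by
  obtain ⟨z, rfl⟩ := T.exists_coord p hp
  exact T.w_sphereCoord z hp

theorem TubeChart.Z_sphereCoord_true (T : TubeChart E ι) {z : ℂ}
    (hz : ι (sphereCoord true z) ∈ T.V) : T.Z (ι (sphereCoord true z)) = z := by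
  obtain ⟨ζ, hζ⟩ := T.exists_coord _ hz
  rw [hζ] at hz
  rw [hζ, TubeChart.Z, T.c_sphereCoord ζ hz]
  cases hs : T.sgn with
  | true =>
    rw [hs] at hζ
    simp [affineValue, sphereCoord_injective true hζ]
  | false =>
    rw [hs, sphereCoord_eq_of_ne (by simp)] at hζ
    simp [affineValue, eq_inv_of_mul_eq_one_left hζ]

/-- On the sphere `w = 0`, so the size parameter can be taken to be 0. All error bounds then vanish,
which identifies the limit with the affine coordinate. -/
theorem TubeAtlas.tubeStart_zero (A : TubeAtlas E ι I) (p : OnePoint ℂ)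
    (h : TubeStart b A.V' A.V (fun i => (A.T i).Z) (fun i x => ‖(A.T i).w x‖) η θ (ι p)) :
    TubeStart b A.V' A.V (fun i => (A.T i).Z) (fun i x => ‖(A.T i).w x‖) η 0 (ι p) := by
  refine ⟨h.1, fun i hi => ?_⟩
  obtain ⟨h1, h2, h3, -⟩ := h.2 i hi
  refine ⟨h1, h2, h3, ?_⟩
  simp [(A.T i).w_eq_zero (A.closure_V i (subset_closure hi))]

theorem TubeAtlas.eventually_tubeStart [Finite I] (A : TubeAtlas E ι I) (b : ℕ) (hη : 0 < η)
    {t : ℝ} (ht : 0 < t) :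
    ∀ᶠ x in 𝓝ˢ (ι '' sphereUnitCircle),
      TubeStart b A.V' A.V (fun i => (A.T i).Z) (fun i x => ‖(A.T i).w x‖) η t x := by
  refine eventually_nhdsSet_iff_forall.2 ?_
  rintro _ ⟨p, hp, rfl⟩
  refine Filter.Eventually.and ?_ (eventually_all.2 fun i => ?_)
  · obtain ⟨i, hi⟩ := mem_iUnion.1 (A.cover (mem_range_self p))
    filter_upwards [(A.isOpen_V' i).mem_nhds hi] with x hx
    exact ⟨i, hx⟩
  by_cases hcl : ι p ∈ closure (A.V i)
  · have hV := A.closure_V i hcl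
    have hw := (A.T i).w_eq_zero hV
    obtain ⟨z, rfl⟩ := (A.T i).exists_coord p hV
    rw [sphereCoord_mem_sphereUnitCircle] at hp
    have hc := (A.T i).c_sphereCoord z hV
    have hcc : ContinuousAt (fun x => ‖(A.T i).c x‖) (ι (sphereCoord (A.T i).sgn z)) :=
      ((A.T i).contMDiffOn_c.continuousOn.continuousAt ((A.T i).isOpen.mem_nhds hV)).norm
    have hwc : ContinuousAt (fun x => ‖(A.T i).w x‖) (ι (sphereCoord (A.T i).sgn z)) :=
      ((A.T i).contMDiffOn_w.continuousOn.continuousAt ((A.T i).isOpen.mem_nhds hV)).norm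
    have hpos : 0 < min η (t * (1 / 2) ^ b) := by positivity
    filter_upwards [hcc.eventually_const_lt (by simp only [hc, hp]; norm_num : (1 / 2 : ℝ) < _),
      hcc.eventually_lt_const (by simp only [hc, hp]; norm_num : _ < (2 : ℝ)),
      hwc.eventually_lt_const (by simpa only [hw, norm_zero] using hpos)] with x h1 h2 h3 hx
    have hc0 : (A.T i).c x ≠ 0 := by
      intro h0
      rw [h0, norm_zero] at h1
      norm_num at h1
    refine ⟨hx, h3.trans_le (min_le_left _ _), affineValue_ne_zero_iff.2 hc0, ?_⟩
    refine (h3.le.trans (min_le_right _ _)).trans ?_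
    have : 1 / 2 ≤ poleDist ((A.T i).Z x) := by
      rw [TubeChart.Z, poleDist_affineValue, poleDist]
      refine le_min h1.le ?_
      rw [one_div]
      exact inv_anti₀ (by linarith) h2.le
    gcongr
  · filter_upwards [isClosed_closure.isOpen_compl.mem_nhds hcl] with x hx hxV
    exact absurd (subset_closure hxV) hx

/-- Points with invariant coordinate of norm one stay close to the circle. -/
theorem TubeAtlas.exists_forall_iterate_mem [Finite I] (A : TubeAtlas E ι I)
    (D : TubeDynamics f b A.V' A.V (fun i => (A.T i).Z) (fun i x => ‖(A.T i).w x‖) C η)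
    (R : IsTubeRadius b C η θ μ) {idx : N → I} (hidx : ∀ x, (∃ i, x ∈ A.V' i) → x ∈ A.V' (idx x))
    {O : Set N} (hO : O ∈ 𝓝ˢ (ι '' sphereUnitCircle)) :
    ∃ τ > 0, ∀ t, 0 ≤ t → t ≤ θ → ∀ x,
      TubeStart b A.V' A.V (fun i => (A.T i).Z) (fun i x => ‖(A.T i).w x‖) η t x →
      ‖tubeLimit f b (fun i => (A.T i).Z) idx x‖ = 1 → ∀ n, μ ^ n * t ≤ τ → f^[n] x ∈ O := by
  obtain ⟨ε, hε, hmem⟩ := A.exists_forall_near_circle_mem hO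
  have hC := D.one_le_C
  -- With `e = μ ^ n * t`, the first bound gives `‖u‖ ≤ 1` for the exponential estimate; the second
  -- makes the total displacement `e + 4 C e` less than `ε`.
  refine ⟨min (1 / (2 * C)) (ε / (2 * (1 + 4 * C))), by positivity, ?_⟩
  intro t ht htθ x hx hφ n hn
  obtain ⟨u, hu, hun⟩ := D.exists_Z_iterate_eq R ht htθ hidx hx n
  obtain ⟨hV', hV, -, hZ0, hm⟩ := D.iterate_mem_of_start R ht htθ hidx hx n
  set i := idx (f^[n] x) with hi
  set y := f^[n] x with hy
  set e := μ ^ n * t with he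
  have he0 : 0 ≤ e := mul_nonneg (pow_nonneg (D.mu_nonneg R (ht.trans htθ)) n) ht
  have h1 : 2 * (C * e) ≤ 1 := by
    have := hn.trans (min_le_left _ _)
    rw [le_div_iff₀ (by positivity)] at this
    linarith
  have h2 : e * (1 + 4 * C) < ε := by
    have := hn.trans (min_le_right _ _)
    rw [le_div_iff₀ (by positivity)] at this
    linarith
  have hw : ‖(A.T i).w y‖ ≤ e :=
    hm.trans (mul_le_of_le_one_right he0 (pow_le_one₀ (poleDist_nonneg _) (poleDist_le_one _)))
  have hexp : ∀ v : ℂ, ‖v‖ = ‖u‖ → |‖Complex.exp v‖ - 1| ≤ 4 * C * e := by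
    intro v hv
    have h3 := abs_norm_sub_norm_le (Complex.exp v) 1
    rw [norm_one] at h3
    have h4 := Complex.norm_exp_sub_one_le (x := v) (by rw [hv]; exact hun.trans h1)
    rw [hv] at h4
    linarith
  have hZ : ‖(A.T i).Z y‖ = ‖Complex.exp u‖ := by
    rw [hu, norm_mul, norm_pow, hφ, one_pow, one_mul]
  have hc : |‖(A.T i).c y‖ - 1| ≤ 4 * C * e := by
    rw [TubeChart.Z, affineValue] at hZ
    split_ifs at hZ with hs
    · rw [hZ]; exact hexp u rfl
    · rw [norm_inv] at hZ
      have h3 : ‖(A.T i).c y‖ = ‖Complex.exp (-u)‖ := by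
        rw [Complex.exp_neg, norm_inv, ← hZ, inv_inv]
      rw [h3]
      exact hexp (-u) (norm_neg u)
  refine hmem i y hV ?_
  linarith

variable [IsManifold 𝓘(ℂ, E) ω N]

/-- A function that restricts to the affine coordinate of the embedded sphere is regular at the
points of the sphere. -/
theorem IsSphereEmbedding.fderiv_ne_zero_of_eq_coord (hι : IsSphereEmbedding E ι) {φ : N → ℂ}
    {z : ℂ} {p : N} (hz : ι (sphereCoord true z) ∈ (chartAt E p).source)
    (hφ : DifferentiableAt ℂ (fun u => φ ((chartAt E p).symm u))
      (chartAt E p (ι (sphereCoord true z))))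
    (heq : ∀ᶠ z' in 𝓝 z, φ (ι (sphereCoord true z')) = z') :
    fderiv ℂ (fun u => φ ((chartAt E p).symm u)) (chartAt E p (ι (sphereCoord true z))) ≠ 0 := by
  intro hzero
  set κ := chartAt E p with hκ
  have hγs := hι.contMDiff_sphereCoord true
  have hγ : DifferentiableAt ℂ (fun z => κ (ι (sphereCoord true z))) z := by
    rw [← mdifferentiableAt_iff_differentiableAt]
    exact MDifferentiableAt.comp (I' := 𝓘(ℂ, E)) (g := κ) z
      (((contMDiffOn_chart (I := 𝓘(ℂ, E)) (n := ω) (x := p)).contMDiffAt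
        (κ.open_source.mem_nhds hz)).mdifferentiableAt (by simp))
      (hγs.mdifferentiableAt (by simp))
  have h1 := hφ.hasFDerivAt.comp_hasDerivAt z hγ.hasDerivAt
  rw [hzero, zero_apply] at h1
  have h2 : (fun z' : ℂ => z') =ᶠ[𝓝 z]
      (fun u => φ (κ.symm u)) ∘ fun z => κ (ι (sphereCoord true z)) := by
    filter_upwards [heq, hγs.continuous.continuousAt.eventually_mem (κ.open_source.mem_nhds hz)]
      with z' h3 h4
    rw [Function.comp_apply, κ.left_inv h4, h3]
  exact one_ne_zero ((hasDerivAt_id' z).unique (h1.congr_of_eventuallyEq h2))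

end CircleNeighbourhoods

/-! ### Choice of constants and conclusion. -/

theorem exists_tubeRadius {b : ℕ} {C η : ℝ} (hC : 1 ≤ C) (hη : 0 < η) :
    ∃ θ μ : ℝ, 0 < θ ∧ IsTubeRadius b C η θ μ ∧ μ ≤ (1 / (2 * C)) ^ 4 := by
  set θ := min (η / 2) (min (1 / (2 * C * (b + 1)))
    (min (1 / 2) ((1 / (2 * C)) ^ 4) / (C * 2 ^ b))) with hθ
  have h2 : θ ≤ 1 / (2 * C * (b + 1)) := (min_le_right _ _).trans (min_le_left _ _)
  have h3 : C * 2 ^ b * θ ≤ min (1 / 2) ((1 / (2 * C)) ^ 4) := by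
    have h4 := (min_le_right (η / 2) _).trans (min_le_right (1 / (2 * C * (b + 1)))
      (min (1 / 2) ((1 / (2 * C)) ^ 4) / (C * 2 ^ b)))
    rw [← hθ, le_div_iff₀ (by positivity)] at h4
    linarith
  refine ⟨θ, C * 2 ^ b * θ, by positivity, ⟨?_, ?_, rfl, h3.trans (min_le_left _ _)⟩,
    h3.trans (min_le_right _ _)⟩
  · exact (min_le_left _ _).trans_lt (half_lt_self hη)
  · rw [le_div_iff₀ (by positivity)] at h2
    linarith

theorem theoremA
    {E : Type*} [NormedAddCommGroup E] [NormedSpace ℂ E] [FiniteDimensional ℂ E]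
    (hdim : 2 ≤ Module.finrank ℂ E)
    {N : Type*} [TopologicalSpace N] [T2Space N] [SecondCountableTopology N]
    [ChartedSpace E N] [IsManifold 𝓘(ℂ, E) ω N]
    (f : N → N) (hf : ContMDiff 𝓘(ℂ, E) 𝓘(ℂ, E) ω f) (hdom : IsDominantMap f)
    (ι : OnePoint ℂ → N) (hι : IsSphereEmbedding E ι)
    (a b : ℕ) (hb : 2 ≤ b)
    (hconj : ∀ p : OnePoint ℂ, f (ι p) = ι (spherePow b p))
    (hsuper : TransversallySuperattracting E f (range ι) a)
    (hab : b ≤ a) :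
    ∃ Ω₀ : Set N, IsOpen Ω₀ ∧ ι '' sphereUnitCircle ⊆ Ω₀ ∧
      ∀ Ω : Set N, IsOpen Ω → ι '' sphereUnitCircle ⊆ Ω → Ω ⊆ Ω₀ →
        IsRealAnalyticHypersurface E (localStableSet f (ι '' sphereUnitCircle) Ω) := by
  have : IsManifold 𝓘(ℝ, E) ω N := IsManifold.real_of_complex
  obtain ⟨n, ⟨A⟩⟩ := hι.exists_tubeAtlas E
  obtain ⟨C, η, hη, D, hlip⟩ := A.exists_tubeDynamics hι hf hb hconj (hsuper.mono hab)
  obtain ⟨θ, μ, hθ, R, hμ⟩ := exists_tubeRadius (b := b) D.one_le_C hη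
  have hidx : ∃ idx : N → Fin n, ∀ x, (∃ i, x ∈ A.V' i) → x ∈ A.V' (idx x) := by
    obtain ⟨i₀, -⟩ := mem_iUnion.1 (A.cover (mem_range_self (OnePoint.infty : OnePoint ℂ)))
    have : ∀ x, ∃ j, (∃ i, x ∈ A.V' i) → x ∈ A.V' j := by
      intro x
      by_cases h : ∃ i, x ∈ A.V' i
      · exact ⟨h.choose, fun _ => h.choose_spec⟩
      · exact ⟨i₀, fun h' => absurd h' h⟩
    choose idx hidx using this
    exact ⟨idx, hidx⟩
  obtain ⟨idx, hidx⟩ := hidx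
  set φ : N → ℂ := tubeLimit f b (fun i => (A.T i).Z) idx with hφ
  set S := ι '' sphereUnitCircle with hS
  obtain ⟨Ω₁, hΩ₁, hSΩ₁, hstart⟩ := mem_nhdsSet_iff_exists.1 (A.eventually_tubeStart b hη hθ)
  have hchart : ∀ i, ∀ x ∈ A.V' i, x ∈ (chartAt E (A.T i).base).source := fun i x hx =>
    (A.T i).subset_source (A.closure_V i (subset_closure (D.subset i hx)))
  have hanalytic : ∀ x ∈ Ω₁, ∀ i, x ∈ A.V' i →
      AnalyticAt ℂ (fun u => φ ((chartAt E (A.T i).base).symm u)) (chartAt E (A.T i).base x) :=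
    fun x hx i hi => A.analyticAt_tubeLimit hf D R hθ.le hμ hlip hidx hΩ₁ hstart hx hi
  -- Equality with the affine coordinate on the sphere gives both `‖φ‖ = 1` on the circle and a
  -- nonzero differential there.
  have hcoord : ∀ z, ι (sphereCoord true z) ∈ Ω₁ → φ (ι (sphereCoord true z)) = z := by
    intro z hz
    have h0 := A.tubeStart_zero _ (hstart hz)
    obtain ⟨i, hi⟩ := h0.1
    rw [hφ, D.tubeLimit_eq_of_start_zero R hθ.le hidx h0 (D.subset i hi)]
    exact (A.T i).Z_sphereCoord_true (A.closure_V i (subset_closure (D.subset i hi)))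
  have hev : ∀ᶠ x in 𝓝ˢ S, x ∈ Ω₁ ∧ (1 / 2 < ‖φ x‖ ∧ ‖φ x‖ < 2) ∧ ∃ i, x ∈ A.V' i ∧
      fderiv ℂ (fun u => φ ((chartAt E (A.T i).base).symm u)) (chartAt E (A.T i).base x) ≠ 0 := by
    refine eventually_nhdsSet_iff_forall.2 ?_
    intro x hx
    have hxΩ₁ := hSΩ₁ hx
    obtain ⟨i, hi⟩ := (hstart hxΩ₁).1
    obtain ⟨_, ⟨z, hz, rfl⟩, rfl⟩ := hx
    change ι (sphereCoord true z) ∈ Ω₁ at hxΩ₁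
    change ι (sphereCoord true z) ∈ A.V' i at hi
    change ∀ᶠ x in 𝓝 (ι (sphereCoord true z)), _
    set x := ι (sphereCoord true z) with hxdef
    set κ := chartAt E (A.T i).base with hκ
    have hxκ : x ∈ κ.source := hchart i x hi
    have hG := hanalytic x hxΩ₁ i hi
    have hGd := hι.fderiv_ne_zero_of_eq_coord (φ := φ) hxκ hG.differentiableAt (by
      filter_upwards [(hι.contMDiff_sphereCoord true).continuous.continuousAt.eventually_mem
        (hΩ₁.mem_nhds hxΩ₁)] with z' hz'
      exact hcoord z' hz')
    have hφx : ‖φ x‖ = 1 := by rw [hxdef, hcoord z hxΩ₁]; exact hz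
    have hφc : ContinuousAt (fun y => ‖φ y‖) x := by
      have h1 : ContinuousAt (fun y => φ (κ.symm (κ y))) x :=
        ContinuousAt.comp (g := fun u => φ (κ.symm u)) hG.continuousAt (κ.continuousAt hxκ)
      refine (h1.congr ?_).norm
      filter_upwards [κ.open_source.mem_nhds hxκ] with y hy
      rw [κ.left_inv hy]
    have hdc : ContinuousAt (fun y => fderiv ℂ (fun u => φ (κ.symm u)) (κ y)) x :=
      ContinuousAt.comp (g := fderiv ℂ (fun u => φ (κ.symm u))) hG.fderiv.continuousAt
        (κ.continuousAt hxκ)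
    filter_upwards [hΩ₁.mem_nhds hxΩ₁, (A.isOpen_V' i).mem_nhds hi,
      hφc.eventually_const_lt (by simp only [hφx]; norm_num : (1 / 2 : ℝ) < _),
      hφc.eventually_lt_const (by simp only [hφx]; norm_num : _ < (2 : ℝ)),
      hdc.eventually_ne hGd] with y h1 h2 h3 h4 h5
    exact ⟨h1, ⟨h3, h4⟩, i, h2, h5⟩
  obtain ⟨Ω₀, hΩ₀, hSΩ₀, hΩ₀'⟩ := mem_nhdsSet_iff_exists.1 hev
  have hne : ∀ x ∈ Ω₀, φ x ≠ 0 := by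
    intro x hx h0
    have := (hΩ₀' hx).2.1.1
    rw [h0, norm_zero] at this
    norm_num at this
  refine ⟨Ω₀, hΩ₀, hSΩ₀, fun Ω hΩ hSΩ hΩΩ₀ => ?_⟩
  refine isRealAnalyticHypersurface_localStableSet hf.continuous hb (φ := φ) (Ω₀ := Ω₀)
    (fun x hx => D.tubeLimit_map R hθ.le le_rfl hidx (hstart (hΩ₀' hx).1))
    (fun x hx => (hΩ₀' hx).2.1) ?_ ?_ ?_ ?_ hΩ hSΩ hΩΩ₀
  · intro x hx
    obtain ⟨h1, -, i, hi, -⟩ := hΩ₀' hx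
    exact contMDiffAt_log_norm (hchart i x hi) (hanalytic x h1 i hi) (hne x hx)
  · intro x hx
    obtain ⟨h1, -, i, hi, hd⟩ := hΩ₀' hx
    exact mfderiv_log_norm_ne_zero (hchart i x hi) (hanalytic x h1 i hi) (hne x hx) hd
  · intro O hO
    obtain ⟨τ, hτ, h⟩ := A.exists_forall_iterate_mem D R hidx hO
    filter_upwards [A.eventually_tubeStart b hη (lt_min hθ hτ)] with x hx hφx k
    -- For stability the initial size is already at most `τ`, so the estimate holds from time 0.
    have h0 : 0 ≤ min θ τ := (lt_min hθ hτ).le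
    refine h _ h0 (min_le_left _ _) x hx hφx k ?_
    refine (mul_le_of_le_one_left h0 (pow_le_one₀ (D.mu_nonneg R hθ.le) ?_)).trans (min_le_right _ _)
    linarith [R.mu_le]
  · intro x hx hφx
    refine tendsto_iff_forall_eventually_mem.2 fun O hO => ?_
    obtain ⟨τ, hτ, h⟩ := A.exists_forall_iterate_mem D R hidx hO
    -- For convergence the initial size is fixed at `θ`, and contraction brings it below `τ` after
    -- finitely many steps.
    have hlim : Tendsto (fun k => μ ^ k * θ) atTop (𝓝 0) := by
      have := (tendsto_pow_atTop_nhds_zero_of_lt_one (D.mu_nonneg R hθ.le)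
        (by linarith [R.mu_le])).mul_const θ
      rwa [zero_mul] at this
    filter_upwards [hlim.eventually (gt_mem_nhds hτ)] with k hk
    exact h θ hθ.le le_rfl x (hstart (hΩ₀' hx).1) hφx k hk.le
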